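/- **Model (external memory with indivisible records).** An input consists of $n$ records stored in an array on disk, in consecutive blocks of $B$ records; main memory is initially empty and holds at most $M$ records. An I/O either reads a disk block (after any records of main memory have been discarded, and provided everything then fits into main memory) or writes a block of at most $B$ records that are in main memory to any disk address. Records can be copied but not split or combined; internal computation is free. In each problem below some ordered pairs of records are *linked*, and every record has a *label*. At any moment the algorithm sees which records are in main memory, their labels, and the links both of whose end records are in main memory (the links that have come into main memory). The sequence of I/Os may be chosen with full knowledge of the input (address information is free), but the output is computed from the I/Os performed and from what was seen. The algorithm is correct if, for every input $I$, its I/Os are allowed and its output is a solution of every input $J$ on which the I/Os chosen for $I$ show exactly the same things in main memory as on $I$ (in particular for $J=I$). Its cost on $I$ is the number of I/Os it performs on $I$; writing the output is not charged. **Problems of size $N$.** A system of doubly linked lists is an array of $N$ nodes, each with a possibly NULL successor and a possibly NULL predecessor, such that $j$ is the successor of $i$ iff $i$ is the predecessor of $j$. Records are nodes, links go from a node to its successor, and the label of a node says which of its two pointers are NULL. The system is *monotonic* if the successor of $i$ is always larger than $i$. * MLCC: given a collection of disjoint monotonic doubly linked lists, label every node with the first node of its list. $K$ is the number of lists. * 2MLC: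 given such a collection, colour the nodes with 2 colours so that linked nodes get different colours. $K$ is the number of lists. * 3LC: given a single (not necessarily monotonic) doubly linked list, colour the nodes with 3 colours so that linked nodes get different colours. $K$ is the total number of maximal stretches of forward links and of backward links. * IGC: given $N$ closed intervals with $2N$ distinct endpoints by the sorted array of their endpoints, colour the interval graph properly with the minimum number of colours. Records are endpoints, the two endpoints of an interval are linked, and the label of an endpoint says whether it is a left endpoint. $K$ is the chromatic number of the interval graph. Put $\mathrm{sort}(x)=\frac{x}{B}\log_{M/B}\frac{x}{B}$. **Theorem.** There is an absolute constant $c>0$ such that for all integers $B\ge1$, $M\ge 2B$, $K\ge 1$, $N\ge 2K$ with $\mathrm{sort}(N)\le N$, and for each of the problems IGC, 3LC, MLCC and 2MLC: every algorithm that solves the problem correctly for all inputs of size $N$ performs at least $$c\cdot\frac{N}{K}\,\mathrm{sort}(K)$$ I/Os on some input of size $N$ with parameter $K$. -/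

import Mathlib

/-! ### The external memory model with indivisible records -/

/-- A problem whose inputs consist of `size` records, given in an array.  A record carries a label
of its own, and some ordered pairs of records are linked (one points to the other). -/
structure RecordProblem where
  size : ℕ
  Input : Type
  Label : Type
  Output : Type
  label : Input → Fin size → Label
  link : Input → Fin size → Fin size → Prop
  IsSolution : Input → Output → Prop

/-- Contents of main memory and of the disk; the disk is divided into blocks addressed by `ℕ`.
Records are indivisible; they may be copied and may be present in several places. -/
structure EMState (n : ℕ) where
  mem : Finset (Fin n)
  disk : ℕ → Finset (Fin n)

/-- An I/O. `read k keep` discards all of main memory except `keep`, then brings in block `k`.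
`write k S` writes a block consisting of the records `S` of main memory to address `k`. -/
inductive EMOp (n : ℕ) where
  | read (k : ℕ) (keep : Finset (Fin n))
  | write (k : ℕ) (S : Finset (Fin n))

namespace EMState

/-- Main memory is empty; the input array occupies consecutive blocks of `B` records each. -/
def initial (n B : ℕ) : EMState n where
  mem := ∅
  disk := fun k => Finset.univ.filter fun i : Fin n => i.val / B = k

/-- The I/O respects main memory size `M` and block size `B`. -/
def Allowed {n : ℕ} (M B : ℕ) (s : EMState n) : EMOp n → Prop
  | .read k keep => keep ⊆ s.mem ∧ (keep ∪ s.disk k).card ≤ M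
  | .write _ S => S ⊆ s.mem ∧ S.card ≤ B

def apply {n : ℕ} (s : EMState n) : EMOp n → EMState n
  | .read k keep => { mem := keep ∪ s.disk k, disk := s.disk }
  | .write k S => { mem := s.mem, disk := Function.update s.disk k S }

def AllowedSeq {n : ℕ} (M B : ℕ) : EMState n → List (EMOp n) → Prop
  | _, [] => True
  | s, op :: ops => s.Allowed M B op ∧ AllowedSeq M B (s.apply op) ops

/-- The successive contents of main memory, one after each I/O. -/
def memories {n : ℕ} : EMState n → List (EMOp n) → List (Finset (Fin n))
  | _, [] => []
  | s, op :: ops => (s.apply op).mem :: memories (s.apply op) ops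

end EMState

namespace RecordProblem

/-- What is in main memory at one moment: the records present, their labels, and the links that
are in main memory, that is, the links both of whose records are present. -/
structure Observation (P : RecordProblem) where
  mem : Finset (Fin P.size)
  label : Fin P.size → Option P.Label
  link : Fin P.size → Fin P.size → Prop

def observe (P : RecordProblem) (I : P.Input) (m : Finset (Fin P.size)) : P.Observation where
  mem := m
  label := fun u => if u ∈ m then some (P.label I u) else none
  link := fun u v => u ∈ m ∧ v ∈ m ∧ P.link I u v

/-- Everything that comes into main memory when the I/Os `ops` are performed on the input `I`. -/
def transcript (P : RecordProblem) (B : ℕ) (ops : List (EMOp P.size)) (I : P.Input) :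
    List P.Observation :=
  ((EMState.initial P.size B).memories ops).map (P.observe I)

/-- An algorithm in the external memory model.  Which I/Os it performs may depend on the whole
input: the addresses of linked records are known to it free of charge when it decides what to
move.  The output is computed, by arbitrary and uncharged internal computation, from the I/Os
performed and from what came into main memory. -/
structure EMAlgorithm (P : RecordProblem) where
  ops : P.Input → List (EMOp P.size)
  output : List (EMOp P.size) → List P.Observation → P.Output

/-- The algorithm is correct with main memory size `M` and block size `B`: its I/Os are allowed,
and the output is right for every input on which these I/Os show the same things in main memory
(so the free address information is used for moving records only). -/
def EMAlgorithm.Solves {P : RecordProblem} (A : P.EMAlgorithm) (M B : ℕ) : Prop :=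
  ∀ I : P.Input,
    (EMState.initial P.size B).AllowedSeq M B (A.ops I) ∧
    ∀ J : P.Input, P.transcript B (A.ops I) J = P.transcript B (A.ops I) I →
      P.IsSolution J (A.output (A.ops I) (P.transcript B (A.ops I) J))

/-- Worst-case lower bound: every correct algorithm performs at least `t` I/Os on some input of
the class `S`. -/
def RequiresIOs (P : RecordProblem) (S : P.Input → Prop) (M B : ℕ) (t : ℝ) : Prop :=
  ∀ A : P.EMAlgorithm, A.Solves M B → ∃ I : P.Input, S I ∧ t ≤ ((A.ops I).length : ℝ)

end RecordProblem

/-- `sort(x) = (x/B) log_{M/B} (x/B)`. -/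
noncomputable def sortIO (M B x : ℕ) : ℝ :=
  ((x : ℝ) / B) * Real.logb ((M : ℝ) / B) ((x : ℝ) / B)

/-! ### Doubly linked lists -/

/-- A system of successor and predecessor pointers on an array of `n` nodes. -/
structure DoublyLinked (n : ℕ) where
  succ : Fin n → Option (Fin n)
  pred : Fin n → Option (Fin n)
  succ_iff_pred : ∀ i j, succ i = some j ↔ pred j = some i

namespace DoublyLinked

def Link {n : ℕ} (D : DoublyLinked n) (i j : Fin n) : Prop := D.succ i = some j

/-- `h` is the first element of the list that contains `v`. -/
def IsFirstOf {n : ℕ} (D : DoublyLinked n) (h v : Fin n) : Prop :=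
  D.pred h = none ∧ Relation.ReflTransGen D.Link h v

/-- Whether the predecessor and the successor pointer of a node are NULL. -/
def nulls {n : ℕ} (D : DoublyLinked n) (i : Fin n) : Bool × Bool :=
  ((D.pred i).isNone, (D.succ i).isNone)

/-- A maximal stretch of forward links, or of backward links, starts at `i`: there is a link out
of `i`, and the link into `i`, if there is one, has the other direction. -/
def StretchStart {n : ℕ} (D : DoublyLinked n) (i : Fin n) : Prop :=
  ∃ j, D.Link i j ∧ ∀ h, D.Link h i → (h < i ↔ ¬ i < j)

/-- The total number of forward and backward stretches. -/
noncomputable def numStretches {n : ℕ} (D : DoublyLinked n) : ℕ :=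
  {i | D.StretchStart i}.ncard

/-- The number of nodes without a predecessor, that is, of lists. -/
noncomputable def numHeads {n : ℕ} (D : DoublyLinked n) : ℕ :=
  {i | D.pred i = none}.ncard

end DoublyLinked

/-- A collection of disjoint monotonic doubly linked lists: successors have larger numbers. -/
structure MonotonicLists (n : ℕ) extends DoublyLinked n where
  mono : ∀ i j, succ i = some j → i < j

/-- A single doubly linked list. -/
structure SingleList (n : ℕ) extends DoublyLinked n where
  single : ∃ h, ∀ v, toDoublyLinked.IsFirstOf h v

/-- MLCC: label each node of a collection of disjoint monotonic doubly linked lists by the first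
element of its list. -/
def MLCC (n : ℕ) : RecordProblem where
  size := n
  Input := MonotonicLists n
  Label := Bool × Bool
  Output := Fin n → Fin n
  label := fun I => I.nulls
  link := fun I => I.Link
  IsSolution := fun I c => ∀ v, I.IsFirstOf (c v) v

/-- 2MLC: colour the nodes of a collection of disjoint monotonic doubly linked lists with two
colours. -/
def TwoMLC (n : ℕ) : RecordProblem where
  size := n
  Input := MonotonicLists n
  Label := Bool × Bool
  Output := Fin n → Fin 2
  label := fun I => I.nulls
  link := fun I => I.Link
  IsSolution := fun I c => ∀ u v, I.Link u v → c u ≠ c v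

/-- 3LC: colour the nodes of a doubly linked list with three colours. -/
def ThreeLC (n : ℕ) : RecordProblem where
  size := n
  Input := SingleList n
  Label := Bool × Bool
  Output := Fin n → Fin 3
  label := fun I => I.nulls
  link := fun I => I.Link
  IsSolution := fun I c => ∀ u v, I.Link u v → c u ≠ c v

/-! ### Interval graphs -/

/-- `n` intervals with distinct endpoints, given by the array of the `2 * n` endpoints in sorted
order, in which each endpoint knows the other endpoint of its interval. -/
structure IntervalRep (n : ℕ) where
  partner : Fin (2 * n) → Fin (2 * n)
  partner_ne : ∀ i, partner i ≠ i
  partner_partner : ∀ i, partner (partner i) = i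

namespace IntervalRep

/-- An interval is named by its left endpoint. -/
def Interval {n : ℕ} (R : IntervalRep n) : Type := {i : Fin (2 * n) // i < R.partner i}

def Interval.points {n : ℕ} {R : IntervalRep n} (v : R.Interval) : Set (Fin (2 * n)) :=
  Set.Icc v.1 (R.partner v.1)

/-- The interval graph: distinct intervals are adjacent iff they overlap. -/
def graph {n : ℕ} (R : IntervalRep n) : SimpleGraph R.Interval where
  Adj u v := u ≠ v ∧ (u.points ∩ v.points).Nonempty
  symm := ⟨fun _ _ h => ⟨h.1.symm, by rw [Set.inter_comm]; exact h.2⟩⟩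
  loopless := ⟨fun _ h => h.1 rfl⟩

end IntervalRep

/-- IGC: colour an interval graph, given by the sorted endpoints of its `n` intervals, properly
with the minimum number of colours. The colour of an interval is stored at its left endpoint.
The label of an endpoint says whether it is a left endpoint. -/
noncomputable def IGC (n : ℕ) : RecordProblem where
  size := 2 * n
  Input := IntervalRep n
  Label := Bool
  Output := Fin (2 * n) → ℕ
  label := fun R i => decide (i < R.partner i)
  link := fun R i j => R.partner i = j
  IsSolution := fun R c =>
    (∀ u v : R.Interval, R.graph.Adj u v → c u.1 ≠ c v.1) ∧
    (Set.range fun v : R.Interval => c v.1).encard = R.graph.chromaticNumber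

/-! An output must be right for every input with the same transcript. Links between records that
have never been in main memory together can therefore be changed freely, as long as labels and links
between records that did meet stay the same. `EMAlgorithm.Solves.exists_common_solution` provides
one output that is right for all these inputs.

Each problem gets inputs with order of `N / K` groups of order of `K` items. An item owns tagged
records and one target record, and the targets of a group are assigned by an arbitrary permutation
(`HiddenPerms`). An item is seen if a tagged record of it meets its target; two items cross if
records of both meet. If two items of a group (three for 3LC), of equal colour for 2MLC and 3LC, are
unseen and do not cross, exchanging their links gives an indistinguishable input on which the common
output is wrong. So every run is `Resolved`. The exchanges are in
`ListShape.exists_indistinguishable` for MLCC and 2MLC, in `DoublyLinked.exists_segment_exchange`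
for 3LC, where the result has to remain one list, and in `IGC.met_of_lt` for intervals.

Consider runs of at most `T` I/Os, with groups of size `k` (`HiddenPerms.lower_bound`). If for some
choice of permutations at most half of the items are seen, then order of `G * k ^ 2` pairs of items
cross (`Resolved.card_cross`). An I/O makes at most `2 * B * M` pairs of records meet, so `T` is at
least of order `N * K / (B * M)`, which suffices for `K ≥ M`.

Otherwise more than half of the items are seen for every choice of permutations
(`pow_le_of_forall_perms`). A run is encoded by a word that reveals the targets of the seen items,
so few choices of permutations share a word. Words are not counted but weighted: `B / M` for a
discarded or written record, `1 / B` for a recorded partner. Memory starts empty and an I/O moves at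
most `B` records, so at most `T * B` records are discarded or written in total. Hence no word in use
is too light, whereas the total weight of the alphabet is `N` times a power of `M / B` with exponent
`O(B)`. Summation gives that `(k / (e * B)) ^ (G * k / 2)` is at most the `T`-th power of such a
number. Now `sort(N) ≤ N` means `log (N / B) ≤ B * log (M / B)`; it absorbs the factor `N`, and
logarithms give the claim.

If `K < M` or `K < 100 * B`, the claimed bound is `O(N / B)`, and it is enough that a constant
fraction of the input must be read (the `scan` lemmas). If `K ≤ B`, the bound is not positive. -/

/-! ### Records that meet in main memory -/

namespace EMState

variable {n : ℕ}

/-- `a` and `b` are in main memory together after one of the I/Os `ops`. -/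
def Met (s : EMState n) (ops : List (EMOp n)) (a b : Fin n) : Prop :=
  ∃ m ∈ s.memories ops, a ∈ m ∧ b ∈ m

theorem Met.symm {s : EMState n} {ops : List (EMOp n)} {a b : Fin n} (h : s.Met ops a b) :
    s.Met ops b a := by
  obtain ⟨m, hm, ha, hb⟩ := h
  exact ⟨m, hm, hb, ha⟩

theorem Met.left {s : EMState n} {ops : List (EMOp n)} {a b : Fin n} (h : s.Met ops a b) :
    s.Met ops a a := by
  obtain ⟨m, hm, ha, hb⟩ := h
  exact ⟨m, hm, ha, ha⟩

theorem Met.right {s : EMState n} {ops : List (EMOp n)} {a b : Fin n} (h : s.Met ops a b) :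
    s.Met ops b b := h.symm.left

/-- Blocks hold at most `B` records and main memory at most `M`. -/
structure Bounded (M B : ℕ) (s : EMState n) : Prop where
  mem : s.mem.card ≤ M
  disk : ∀ k, (s.disk k).card ≤ B

theorem bounded_initial {M B : ℕ} (hB : 1 ≤ B) : (initial n B).Bounded M B where
  mem := by simp [initial]
  disk k := by
    have h : ((initial n B).disk k).card ≤ (Finset.Ico (k * B) (k * B + B)).card := by
      refine Finset.card_le_card_of_injOn (fun i : Fin n => i.val) ?_ (Fin.val_injective.injOn)
      intro i hi
      have hi' : i.val / B = k := by simpa [initial] using hi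
      have h1 := Nat.div_add_mod i.val B
      have h2 := Nat.mod_lt i.val hB
      rw [hi', Nat.mul_comm] at h1
      simp only [Finset.coe_Ico, Set.mem_Ico]
      omega
    simpa using h

theorem Bounded.apply {M B : ℕ} {s : EMState n} (h : s.Bounded M B) {op : EMOp n}
    (ha : s.Allowed M B op) : (s.apply op).Bounded M B := by
  cases op with
  | read k keep => exact ⟨ha.2, h.disk⟩
  | write k S =>
    refine ⟨h.mem, fun j => ?_⟩
    by_cases hj : j = k
    · subst hj
      simpa [EMState.apply] using ha.2
    · simpa [EMState.apply, hj] using h.disk j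

/-- Every I/O brings at most `B` records into main memory. -/
theorem exists_touched_finset {M B : ℕ} (ops : List (EMOp n)) :
    ∀ s : EMState n, s.Bounded M B → s.AllowedSeq M B ops →
      ∃ P : Finset (Fin n), P.card ≤ ops.length * B ∧
        ∀ a, s.Met ops a a → a ∈ P ∨ a ∈ s.mem := by
  induction ops with
  | nil => exact fun s _ _ => ⟨∅, by simp, by rintro a ⟨m, hm, -⟩; simp [memories] at hm⟩
  | cons op ops ih =>
    intro s hs hal
    obtain ⟨P, hP, hPm⟩ := ih _ (hs.apply hal.1) hal.2
    cases op with
    | read k keep =>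
      refine ⟨P ∪ s.disk k, ?_, ?_⟩
      · have := Finset.card_union_le P (s.disk k)
        have := hs.disk k
        simp only [List.length_cons]
        nlinarith
      · rintro a ⟨m, hm, ha, -⟩
        have key : a ∈ P ∨ a ∈ (s.apply (.read k keep)).mem := by
          rcases List.mem_cons.1 hm with rfl | hm
          · exact .inr ha
          · exact hPm a ⟨m, hm, ha, ha⟩
        rcases key with h | h
        · exact .inl (Finset.mem_union_left _ h)
        · rcases Finset.mem_union.1 h with h | h
          · exact .inr (hal.1.1 h)
          · exact .inl (Finset.mem_union_right _ h)
    | write k S =>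
      refine ⟨P, hP.trans (Nat.mul_le_mul_right _ (by simp)), ?_⟩
      rintro a ⟨m, hm, ha, -⟩
      rcases List.mem_cons.1 hm with rfl | hm
      · exact .inr ha
      · exact hPm a ⟨m, hm, ha, ha⟩

/-- Every I/O makes at most `2 * B * M` ordered pairs of records meet. -/
theorem exists_met_finset {M B : ℕ} (ops : List (EMOp n)) :
    ∀ s : EMState n, s.Bounded M B → s.AllowedSeq M B ops →
      ∃ P : Finset (Fin n × Fin n), P.card ≤ ops.length * (2 * B * M) ∧
        ∀ a b, s.Met ops a b → (a, b) ∈ P ∨ (a ∈ s.mem ∧ b ∈ s.mem) := by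
  induction ops with
  | nil => exact fun s _ _ => ⟨∅, by simp, by rintro a b ⟨m, hm, -⟩; simp [memories] at hm⟩
  | cons op ops ih =>
    intro s hs hal
    obtain ⟨P, hP, hPm⟩ := ih _ (hs.apply hal.1) hal.2
    cases op with
    | read k keep =>
      set m' := keep ∪ s.disk k with hm'
      refine ⟨P ∪ (s.disk k ×ˢ m' ∪ m' ×ˢ s.disk k), ?_, ?_⟩
      · have h1 := Finset.card_union_le P (s.disk k ×ˢ m' ∪ m' ×ˢ s.disk k)
        have h2 := Finset.card_union_le (s.disk k ×ˢ m') (m' ×ˢ s.disk k)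
        have h3 : (s.disk k).card * m'.card ≤ B * M := Nat.mul_le_mul (hs.disk k) hal.1.2
        rw [Finset.card_product, Finset.card_product, Nat.mul_comm m'.card] at h2
        simp only [List.length_cons]
        nlinarith
      · rintro a b ⟨m, hm, ha, hb⟩
        have key : (a, b) ∈ P ∨ (a ∈ m' ∧ b ∈ m') := by
          rcases List.mem_cons.1 hm with rfl | hm
          · exact .inr ⟨ha, hb⟩
          · exact hPm a b ⟨m, hm, ha, hb⟩
        rcases key with h | ⟨h1, h2⟩
        · exact .inl (Finset.mem_union_left _ h)
        -- Two records that both avoid the block just read were kept, so they were together before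
        -- the read.
        · by_cases hka : a ∈ s.disk k
          · left; simp [hka, h2]
          by_cases hkb : b ∈ s.disk k
          · left; simp [hkb, h1]
          right
          simp only [hm', Finset.mem_union, hka, hkb, or_false] at h1 h2
          exact ⟨hal.1.1 h1, hal.1.1 h2⟩
    | write k S =>
      refine ⟨P, hP.trans (Nat.mul_le_mul_right _ (by simp)), ?_⟩
      rintro a b ⟨m, hm, ha, hb⟩
      rcases List.mem_cons.1 hm with rfl | hm
      · exact .inr ⟨ha, hb⟩
      · exact hPm a b ⟨m, hm, ha, hb⟩

end EMState

/-! ### Inputs with equal transcripts -/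

namespace RecordProblem

variable {P : RecordProblem}

/-- The I/Os show the same things on two inputs that agree on the labels of the records brought
into main memory and on the links between records that meet there. -/
theorem transcript_congr {B : ℕ} {ops : List (EMOp P.size)} {I J : P.Input}
    (hlabel : ∀ a, (EMState.initial P.size B).Met ops a a → P.label J a = P.label I a)
    (hlink : ∀ a b, (EMState.initial P.size B).Met ops a b → (P.link J a b ↔ P.link I a b)) :
    P.transcript B ops J = P.transcript B ops I := by
  refine List.map_congr_left fun m hm => ?_
  simp only [observe, Observation.mk.injEq, true_and]
  constructor
  · funext u
    split_ifs with hu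
    · rw [hlabel u ⟨m, hm, hu, hu⟩]
    · rfl
  · funext u v
    refine propext ⟨fun h => ⟨h.1, h.2.1, ?_⟩, fun h => ⟨h.1, h.2.1, ?_⟩⟩
    · exact (hlink u v ⟨m, hm, h.1, h.2.1⟩).1 h.2.2
    · exact (hlink u v ⟨m, hm, h.1, h.2.1⟩).2 h.2.2

/-- A correct algorithm has an output on `I` that solves every input that looks the same. -/
theorem EMAlgorithm.Solves.exists_common_solution {A : P.EMAlgorithm} {M B : ℕ}
    (hA : A.Solves M B) (I : P.Input) :
    ∃ c, ∀ J, (∀ a, (EMState.initial P.size B).Met (A.ops I) a a → P.label J a = P.label I a) →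
      (∀ a b, (EMState.initial P.size B).Met (A.ops I) a b → (P.link J a b ↔ P.link I a b)) →
      P.IsSolution J c := by
  refine ⟨A.output (A.ops I) (P.transcript B (A.ops I) I), fun J h1 h2 => ?_⟩
  have h := transcript_congr h1 h2
  have := (hA I).2 J h
  rwa [h] at this

end RecordProblem

/-! ### Encoding runs by words over a fixed weighted alphabet -/

/-- The position of `a` in an enumeration of `m`. -/
noncomputable def Finset.slot {α : Type*} [DecidableEq α] (m : Finset α) (a : α) : ℕ :=
  if h : a ∈ m then (m.equivFin ⟨a, h⟩ : ℕ) else 0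

theorem Finset.slot_lt {α : Type*} [DecidableEq α] {m : Finset α} {a : α} (h : a ∈ m) :
    m.slot a < m.card := by
  simp [Finset.slot, h]

theorem Finset.slot_injOn {α : Type*} [DecidableEq α] (m : Finset α) :
    Set.InjOn m.slot (m : Set α) := by
  intro a ha b hb h
  have ha' : a ∈ m := ha
  have hb' : b ∈ m := hb
  simp only [Finset.slot, ha', hb', dif_pos] at h
  simpa using m.equivFin.injective (Fin.ext h)

/-- The elements of `m` at the positions in `D`. -/
noncomputable def Finset.pick {α : Type*} [DecidableEq α] {M : ℕ} (m : Finset α)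
    (D : Finset (Fin M)) : Finset α :=
  m.filter fun a => ∃ d ∈ D, (d : ℕ) = m.slot a

theorem Finset.exists_pick_eq {α : Type*} [DecidableEq α] {M : ℕ} {m X : Finset α}
    (hm : m.card ≤ M) (hX : X ⊆ m) : ∃ D : Finset (Fin M), D.card = X.card ∧ m.pick D = X := by
  classical
  let φ : X → Fin M := fun a => ⟨m.slot a, (Finset.slot_lt (hX a.2)).trans_le hm⟩
  have hφ : Function.Injective φ := fun a b h =>
    Subtype.ext (m.slot_injOn (hX a.2) (hX b.2) (congrArg Fin.val h))
  refine ⟨Finset.univ.image φ, ?_, ?_⟩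
  · rw [Finset.card_image_of_injective _ hφ]; simp
  · ext a
    simp only [Finset.pick, Finset.mem_filter, Finset.mem_image, Finset.mem_univ, true_and,
      Subtype.exists]
    constructor
    · rintro ⟨ha, d, ⟨b, hb, rfl⟩, h⟩
      have h' : m.slot b = m.slot a := h
      rwa [← m.slot_injOn (hX hb) ha h']
    · exact fun ha => ⟨hX ha, _, ⟨a, ha, rfl⟩, rfl⟩

namespace EMState

/-- A letter describes an I/O: a read by the number of the block contents among those that have
occurred so far, the positions of the discarded records, and for some records of the block the
position of a partner in main memory; a write by the positions of the written records. -/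
abbrev Letter (M B S : ℕ) : Type :=
  (Fin S × Finset (Fin M) × (Fin B → Option (Fin M))) ⊕ Finset (Fin M)

/-- A discarded or written record has weight `x`, a recorded partner has weight `y`. -/
noncomputable def Letter.weight {M B S : ℕ} (x y : ℝ) : Letter M B S → ℝ
  | .inl (_, D, f) => x ^ D.card * ∏ i, (f i).elim 1 fun _ => y
  | .inr W => x ^ W.card

theorem Letter.weight_nonneg {M B S : ℕ} {x y : ℝ} (hx : 0 ≤ x) (hy : 0 ≤ y)
    (l : Letter M B S) : 0 ≤ l.weight x y := by
  rcases l with ⟨j, D, f⟩ | W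
  · refine mul_nonneg (pow_nonneg hx _) (Finset.prod_nonneg fun i _ => ?_)
    cases f i <;> simp [hy]
  · exact pow_nonneg hx _

theorem sum_pow_card_finset (M : ℕ) (x : ℝ) :
    ∑ D : Finset (Fin M), x ^ D.card = (1 + x) ^ M := by
  have h := Finset.prod_one_add (f := fun _ : Fin M => x) Finset.univ
  simp only [Finset.prod_const, Finset.card_univ, Fintype.card_fin] at h
  rw [h, Finset.powerset_univ]

/-- The weight is multiplicative over independent choices: each of the `M` positions is discarded or
not, and each of the `B` block positions has no partner or one of `M`. The two summands come from
reads and writes. -/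
theorem Letter.sum_weight {M B S : ℕ} (x y : ℝ) :
    ∑ l : Letter M B S, l.weight x y = S * ((1 + x) ^ M * (1 + M * y) ^ B) + (1 + x) ^ M := by
  rw [Fintype.sum_sum_type]
  have h1 : ∑ f : Fin B → Option (Fin M), ∏ i, ((f i).elim 1 fun _ => y) = (1 + M * y) ^ B := by
    have h := Finset.prod_univ_sum (fun _ : Fin B => (Finset.univ : Finset (Option (Fin M))))
      (fun _ o => o.elim (1 : ℝ) fun _ => y)
    rw [Fintype.piFinset_univ] at h
    rw [← h]
    simp [Fintype.sum_option]
  simp only [weight, Fintype.sum_prod_type, ← Finset.mul_sum, ← Finset.sum_mul, h1,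
    sum_pow_card_finset]
  simp only [Finset.sum_const, Finset.card_univ, Fintype.card_fin, nsmul_eq_mul]
  ring

variable {n M B S : ℕ}

/-- The pairs of a record of the block `b` and its partner in `m` that `f` describes. -/
noncomputable def recordedPairs (b m : Finset (Fin n)) (f : Fin B → Option (Fin M)) :
    Finset (Fin n × Fin n) :=
  (b ×ˢ m).filter fun p => ∃ i j, f i = some j ∧ (i : ℕ) = b.slot p.1 ∧ (j : ℕ) = m.slot p.2

/-- The pairs of records that a word describes when main memory is `m` and the block contents that
have occurred are those in the list `A`. -/
noncomputable def wordPairs :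
    Finset (Fin n) → List (Finset (Fin n)) → List (Letter M B S) → Finset (Fin n × Fin n)
  | _, _, [] => ∅
  | m, A, .inl (j, D, f) :: w =>
    recordedPairs (A.getD j ∅) (m \ m.pick D ∪ A.getD j ∅) f ∪
      wordPairs (m \ m.pick D ∪ A.getD j ∅) A w
  | m, A, .inr W :: w => wordPairs m (m.pick W :: A) w

/-- By `hown` the first record of a pair determines the item. Distinct items therefore use distinct
positions of the block, and one function on block positions can store a partner for each of them. -/
theorem exists_recordedPairs {ι : Type*} [DecidableEq ι] {g : ι → Fin n → Fin n → Prop}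
    (hown : ∀ t t' a b b', g t a b → g t' a b' → t = t')
    {b m : Finset (Fin n)} (hb : b.card ≤ B) (hm : m.card ≤ M) (X : Finset ι)
    (hX : ∀ t ∈ X, ∃ z ∈ b, ∃ q ∈ m, g t z q) (y : ℝ) :
    ∃ f : Fin B → Option (Fin M), (∏ i, ((f i).elim 1 fun _ => y)) = y ^ X.card ∧
      (∀ p ∈ recordedPairs b m f, ∃ t ∈ X, g t p.1 p.2) ∧
      ∀ t ∈ X, ∃ p ∈ recordedPairs b m f, g t p.1 p.2 := by
  classical
  rcases X.eq_empty_or_nonempty with rfl | ⟨t0, ht0⟩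
  · exact ⟨fun _ => none, by simp, by simp [recordedPairs], by simp⟩
  have : Nonempty (Fin n) := let ⟨z, _⟩ := hX t0 ht0; ⟨z⟩
  choose! z hz q hq hzq using hX
  have hinj : ∀ t ∈ X, ∀ t' ∈ X, b.slot (z t) = b.slot (z t') → t = t' := by
    intro t ht t' ht' h
    have h' := b.slot_injOn (hz t ht) (hz t' ht') h
    refine hown t t' (z t) (q t) (q t') (hzq t ht) ?_
    rw [h']; exact hzq t' ht'
  let Z : ι → ℕ := fun t => b.slot (z t)
  have hZ : ∀ t ∈ X, Z t < B := fun t ht => (Finset.slot_lt (hz t ht)).trans_le hb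
  have hQ : ∀ t ∈ X, m.slot (q t) < M := fun t ht => (Finset.slot_lt (hq t ht)).trans_le hm
  let f : Fin B → Option (Fin M) := fun i =>
    if h : ∃ t, t ∈ X ∧ Z t = i then some ⟨m.slot (q h.choose), hQ _ h.choose_spec.1⟩ else none
  have hf : ∀ t (ht : t ∈ X), f ⟨Z t, hZ t ht⟩ = some ⟨m.slot (q t), hQ t ht⟩ := by
    intro t ht
    have h : ∃ t', t' ∈ X ∧ Z t' = (⟨Z t, hZ t ht⟩ : Fin B) := ⟨t, ht, rfl⟩
    have h2 : h.choose = t := hinj _ h.choose_spec.1 _ ht h.choose_spec.2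
    simp only [f, dif_pos h, h2]
  have hf' : ∀ i j, f i = some j → ∃ t ∈ X, Z t = i ∧ m.slot (q t) = j := by
    intro i j hij
    by_cases h : ∃ t, t ∈ X ∧ Z t = i
    · refine ⟨h.choose, h.choose_spec.1, h.choose_spec.2, ?_⟩
      simp only [f, dif_pos h, Option.some.injEq] at hij
      rw [← hij]
    · simp [f, dif_neg h] at hij
  refine ⟨f, ?_, ?_, ?_⟩
  · have h1 : ∀ i, ((f i).elim (1 : ℝ) fun _ => y) =
        if i ∈ (X.attach.image fun t => (⟨Z t.1, hZ t.1 t.2⟩ : Fin B)) then y else 1 := by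
      intro i
      split_ifs with h
      · obtain ⟨t, -, rfl⟩ := Finset.mem_image.1 h
        rw [hf _ t.2]; rfl
      · cases hfi : f i with
        | none => rfl
        | some j =>
          obtain ⟨t, ht, h2, -⟩ := hf' i j hfi
          exact absurd (Finset.mem_image.2 ⟨⟨t, ht⟩, Finset.mem_attach _ _, Fin.ext h2⟩) h
    rw [Finset.prod_congr rfl fun i _ => h1 i, Finset.prod_ite_mem, Finset.univ_inter,
      Finset.prod_const, Finset.card_image_of_injective, Finset.card_attach]
    intro t t' h
    exact Subtype.ext (hinj _ t.2 _ t'.2 (congrArg Fin.val h))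
  · rintro ⟨a, c⟩ hp
    simp only [recordedPairs, Finset.mem_filter, Finset.mem_product] at hp
    obtain ⟨⟨ha, hc⟩, i, j, hij, hi, hj⟩ := hp
    obtain ⟨t, ht, h1, h2⟩ := hf' i j hij
    refine ⟨t, ht, ?_⟩
    rw [← b.slot_injOn (hz t ht) ha (h1.trans hi), ← m.slot_injOn (hq t ht) hc (h2.trans hj)]
    exact hzq t ht
  · intro t ht
    refine ⟨(z t, q t), ?_, hzq t ht⟩
    simp only [recordedPairs, Finset.mem_filter, Finset.mem_product]
    exact ⟨⟨hz t ht, hq t ht⟩, _, _, hf t ht, rfl, rfl⟩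

/-- Every run is described by a word that, for each `t ∈ X`, describes one of the pairs `g t` that
meet during the run. -/
theorem exists_word {ι : Type*} [DecidableEq ι] {g : ι → Fin n → Fin n → Prop}
    (hg : ∀ t a b, g t a b → g t b a) (hown : ∀ t t' a b b', g t a b → g t' a b' → t = t')
    (x y : ℝ) (ops : List (EMOp n)) :
    ∀ (s : EMState n) (A : List (Finset (Fin n))) (X : Finset ι),
      (∀ k, s.disk k ∈ A) → A.length + ops.length ≤ S → s.Bounded M B → s.AllowedSeq M B ops →
      (∀ t ∈ X, ∃ a b, g t a b ∧ s.Met ops a b) →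
      (∀ t ∈ X, ∀ a b, g t a b → a ∈ s.mem → b ∉ s.mem) →
      ∃ w : List (Letter M B S), w.length = ops.length ∧
        (∀ p ∈ wordPairs s.mem A w, ∃ t ∈ X, g t p.1 p.2) ∧
        (∀ t ∈ X, ∃ p ∈ wordPairs s.mem A w, g t p.1 p.2) ∧
        ∃ e ≤ s.mem.card + ops.length * B,
          (w.map (Letter.weight x y)).prod = x ^ e * y ^ X.card := by
  classical
  induction ops with
  | nil =>
    intro s A X _ _ _ _ h _
    have hX : X = ∅ := Finset.eq_empty_of_forall_notMem fun t ht => by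
      obtain ⟨a, b, -, m, hm, -⟩ := h t ht
      simp [memories] at hm
    subst hX
    exact ⟨[], rfl, by simp [wordPairs], by simp, 0, by simp, by simp⟩
  | cons op ops ih =>
    intro s A X hA hlen hs hal hmet hmem
    have hs' := hs.apply hal.1
    cases op with
    | read k keep =>
      set b := s.disk k with hb
      set m := keep ∪ b with hm
      -- The items that first meet at this read are recorded in this letter. The others are left to
      -- the rest of the word, so each item costs exactly one factor `y`.
      let X₁ := X.filter fun t => ∃ u v, g t u v ∧ u ∈ m ∧ v ∈ m
      let X₂ := X.filter fun t => ¬ ∃ u v, g t u v ∧ u ∈ m ∧ v ∈ m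
      have hcard : X₁.card + X₂.card = X.card := Finset.card_filter_add_card_filter_not _
      have hX₁ : ∀ t ∈ X₁, ∃ z ∈ b, ∃ q ∈ m, g t z q := by
        intro t ht
        obtain ⟨ht, u, v, huv, hu, hv⟩ := Finset.mem_filter.1 ht
        by_cases hub : u ∈ b
        · exact ⟨u, hub, v, hv, huv⟩
        by_cases hvb : v ∈ b
        · exact ⟨v, hvb, u, hu, hg t u v huv⟩
        simp only [hm, Finset.mem_union, hub, hvb, or_false] at hu hv
        -- A pair outside the block would have been in memory before the read, contrary to `hmem`.
        -- So a new pair has a record in the block, and only block positions need partners.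
        exact absurd (hal.1.1 hv) (hmem t ht u v huv (hal.1.1 hu))
      obtain ⟨f, hfw, hf1, hf2⟩ := exists_recordedPairs hown (hs.disk k) hal.1.2 X₁ hX₁ y
      obtain ⟨w, hwl, hw1, hw2, e, he, hwe⟩ := ih (s.apply (.read k keep)) A X₂ hA
        (by simp only [List.length_cons] at hlen; omega) hs' hal.2
        (by
          intro t ht
          obtain ⟨ht, hno⟩ := Finset.mem_filter.1 ht
          obtain ⟨u, v, huv, m', hm', hu, hv⟩ := hmet t ht
          rcases List.mem_cons.1 hm' with rfl | hm'
          · exact absurd ⟨u, v, huv, hu, hv⟩ hno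
          · exact ⟨u, v, huv, m', hm', hu, hv⟩)
        (by
          intro t ht u v huv hu hv
          exact (Finset.mem_filter.1 ht).2 ⟨u, v, huv, hu, hv⟩)
      obtain ⟨D, hDc, hD⟩ := Finset.exists_pick_eq (X := s.mem \ keep) hs.mem
        Finset.sdiff_subset
      obtain ⟨j, hj, hjb⟩ := List.mem_iff_getElem.1 (hA k)
      have hjS : j < S := by omega
      have hget : A.getD (⟨j, hjS⟩ : Fin S) ∅ = b := by
        simp [List.getD_eq_getElem?_getD, hj, hjb, hb]
      have hkeep : s.mem \ s.mem.pick D = keep := by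
        rw [hD, Finset.sdiff_sdiff_eq_self hal.1.1]
      have hpairs : wordPairs s.mem A (.inl (⟨j, hjS⟩, D, f) :: w) =
          recordedPairs b m f ∪ wordPairs m A w := by
        rw [wordPairs, hget, hkeep]
      refine ⟨.inl (⟨j, hjS⟩, D, f) :: w, by simp [hwl], ?_, ?_, D.card + e, ?_, ?_⟩
      · rw [hpairs]
        intro p hp
        rcases Finset.mem_union.1 hp with hp | hp
        · obtain ⟨t, ht, h⟩ := hf1 p hp
          exact ⟨t, (Finset.mem_filter.1 ht).1, h⟩
        · obtain ⟨t, ht, h⟩ := hw1 p hp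
          exact ⟨t, (Finset.mem_filter.1 ht).1, h⟩
      · rw [hpairs]
        intro t ht
        by_cases h : ∃ u v, g t u v ∧ u ∈ m ∧ v ∈ m
        · obtain ⟨p, hp, h⟩ := hf2 t (Finset.mem_filter.2 ⟨ht, h⟩)
          exact ⟨p, Finset.mem_union_left _ hp, h⟩
        · obtain ⟨p, hp, h⟩ := hw2 t (Finset.mem_filter.2 ⟨ht, h⟩)
          exact ⟨p, Finset.mem_union_right _ hp, h⟩
      -- The size of main memory serves as a potential: discards are paid from it, and the read
      -- refills it by at most `B`.
      · have h1 : (s.mem \ keep).card + keep.card = s.mem.card :=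
          Finset.card_sdiff_add_card_eq_card hal.1.1
        have h2 : m.card ≤ keep.card + b.card := Finset.card_union_le _ _
        have h3 : b.card ≤ B := hs.disk k
        have h4 : e ≤ m.card + ops.length * B := he
        simp only [List.length_cons, Nat.add_mul, one_mul]
        omega
      · simp only [List.map_cons, List.prod_cons, hwe, Letter.weight, hfw, ← hcard, pow_add]
        ring
    | write k W =>
      obtain ⟨D, hDc, hD⟩ := Finset.exists_pick_eq (X := W) hs.mem hal.1.1
      obtain ⟨w, hwl, hw1, hw2, e, he, hwe⟩ := ih (s.apply (.write k W)) (W :: A) X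
        (by
          intro i
          by_cases hi : i = k
          · subst hi; simp [EMState.apply]
          · simp [EMState.apply, hi, hA i])
        (by simp only [List.length_cons] at hlen ⊢; omega) hs' hal.2
        (by
          intro t ht
          obtain ⟨u, v, huv, m', hm', hu, hv⟩ := hmet t ht
          rcases List.mem_cons.1 hm' with rfl | hm'
          · exact absurd hv (hmem t ht u v huv hu)
          · exact ⟨u, v, huv, m', hm', hu, hv⟩)
        hmem
      have hpairs : wordPairs s.mem A (.inr D :: w) = wordPairs s.mem (W :: A) w := by
        rw [wordPairs, hD]
      refine ⟨.inr D :: w, by simp [hwl], by rw [hpairs]; exact hw1, by rw [hpairs]; exact hw2,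
        D.card + e, ?_, ?_⟩
      · have h4 : e ≤ s.mem.card + ops.length * B := he
        have h5 := hal.1.2
        simp only [List.length_cons, Nat.add_mul, one_mul]
        omega
      · simp only [List.map_cons, List.prod_cons, hwe, Letter.weight, pow_add]
        ring

end EMState

/-! ### Counting permutations with prescribed values -/

/-- Comparing factors gives `r! * k ^ r ≤ k.descFactorial r * r ^ r`, and `r ^ r ≤ r! * e ^ r` is
one term of the exponential series. -/
theorem Nat.factorial_sub_mul_pow_le {k r : ℕ} (hr : r ≤ k) :
    ((k - r).factorial : ℝ) * (k : ℝ) ^ r ≤ k.factorial * Real.exp 1 ^ r := by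
  have h1 : r.factorial * k ^ r ≤ k.descFactorial r * r ^ r := by
    rw [← Nat.descFactorial_self r, Nat.descFactorial_eq_prod_range,
      Nat.descFactorial_eq_prod_range]
    have hc : ∀ c : ℕ, c ^ r = ∏ _i ∈ Finset.range r, c := fun c => by simp
    rw [hc k, hc r, ← Finset.prod_mul_distrib, ← Finset.prod_mul_distrib]
    refine Finset.prod_le_prod' fun i hi => ?_
    have hir := Finset.mem_range.1 hi
    zify [hir.le, hir.le.trans hr]
    have : (i : ℤ) * r ≤ i * k := by gcongr
    linarith
  have h2 : (r : ℝ) ^ r ≤ r.factorial * Real.exp 1 ^ r := by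
    have := Real.pow_div_factorial_le_exp (r : ℝ) (by positivity) r
    rw [div_le_iff₀ (by positivity), mul_comm] at this
    rwa [Real.exp_one_pow]
  have h3 : (k : ℝ) ^ r ≤ k.descFactorial r * Real.exp 1 ^ r := by
    have h1' : (r.factorial : ℝ) * (k : ℝ) ^ r ≤ k.descFactorial r * (r : ℝ) ^ r := by
      exact_mod_cast h1
    have h4 : (k.descFactorial r : ℝ) * (r : ℝ) ^ r ≤
        k.descFactorial r * (r.factorial * Real.exp 1 ^ r) := by gcongr
    refine le_of_mul_le_mul_left (a := (r.factorial : ℝ)) ?_ (by positivity)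
    linarith
  rw [← Nat.factorial_mul_descFactorial hr, Nat.cast_mul, mul_assoc]
  gcongr

/-- Composition with `σ₀⁻¹` turns agreement with `σ₀` on `X` into fixing `X` pointwise. -/
theorem Equiv.Perm.card_filter_eqOn_le {α : Type*} [Fintype α] [DecidableEq α] (X : Finset α)
    (σ₀ : Equiv.Perm α) :
    (Finset.univ.filter fun σ : Equiv.Perm α => ∀ t ∈ X, σ t = σ₀ t).card ≤
      (Fintype.card α - X.card).factorial := by
  classical
  have h1 : Fintype.card {f : Equiv.Perm α // ∀ a, ¬ a ∉ X → f a = a} =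
      (Fintype.card α - X.card).factorial := by
    rw [Fintype.card_congr (Equiv.Perm.subtypeEquivSubtypePerm fun a => a ∉ X).symm,
      Fintype.card_perm, Fintype.card_subtype_compl, Fintype.card_coe]
  rw [← h1, ← Fintype.card_coe]
  refine Fintype.card_le_of_injective (fun σ => ⟨σ₀⁻¹ * σ.1, fun a ha => ?_⟩) ?_
  · rw [Equiv.Perm.mul_apply, (Finset.mem_filter.1 σ.2).2 a (not_not.1 ha)]
    simp
  · intro σ τ h
    exact Subtype.ext (mul_left_cancel (congrArg Subtype.val h))

/-- The groups are independent, so the count is a product. Up to the factor `e`, each prescribed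
value saves a factor `k`. -/
theorem card_filter_perms_le {G k : ℕ} (X : Finset (Fin G × Fin k))
    (σ₀ : Fin G → Equiv.Perm (Fin k)) :
    ((Finset.univ.filter fun σ : Fin G → Equiv.Perm (Fin k) =>
      ∀ p ∈ X, σ p.1 p.2 = σ₀ p.1 p.2).card : ℝ) * (k : ℝ) ^ X.card ≤
      (k.factorial : ℝ) ^ G * Real.exp 1 ^ X.card := by
  classical
  let Y : Fin G → Finset (Fin k) := fun g => Finset.univ.filter fun t => (g, t) ∈ X
  have hX : X.card = ∑ g, (Y g).card := by
    rw [← Finset.card_sigma]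
    refine Finset.card_bij' (fun p _ => ⟨p.1, p.2⟩) (fun q _ => (q.1, q.2)) ?_ ?_ ?_ ?_ <;>
      simp [Y]
  have h1 : (Finset.univ.filter fun σ : Fin G → Equiv.Perm (Fin k) =>
      ∀ p ∈ X, σ p.1 p.2 = σ₀ p.1 p.2) =
      Fintype.piFinset fun g => Finset.univ.filter fun σ : Equiv.Perm (Fin k) =>
        ∀ t ∈ Y g, σ t = σ₀ g t := by
    ext σ
    simp [Y, Fintype.mem_piFinset, Prod.forall]
  rw [h1, Fintype.card_piFinset, hX, ← Finset.prod_pow_eq_pow_sum, ← Finset.prod_pow_eq_pow_sum,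
    Nat.cast_prod, ← Finset.prod_mul_distrib]
  have h2 : (k.factorial : ℝ) ^ G = ∏ _g : Fin G, (k.factorial : ℝ) := by simp
  rw [h2, ← Finset.prod_mul_distrib]
  refine Finset.prod_le_prod (fun g _ => by positivity) fun g _ => ?_
  have hY : (Y g).card ≤ k := by simpa using (Y g).card_le_univ
  refine le_trans ?_ (Nat.factorial_sub_mul_pow_le hY)
  gcongr
  have h3 := Equiv.Perm.card_filter_eqOn_le (Y g) (σ₀ g)
  rw [Fintype.card_fin] at h3
  refine le_trans (le_of_eq ?_) h3
  congr

/-! ### Counting the permutations that can be seen with few I/Os -/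

namespace EMState

variable {n M B G k : ℕ}

/-- If for every choice of the permutations `σ` a run of `T` I/Os makes `r` of the pairs linked by
`σ` meet, then `T` is large. -/
theorem pow_le_of_forall_perms (hB : 1 ≤ B) (hBM : B ≤ M) (T r : ℕ)
    (hk : Real.exp 1 * B ≤ k)
    {tag : Fin n → Option (Fin G × Fin k)} {y : Fin G × Fin k → Fin n}
    (hy : Function.Injective y) (hty : ∀ p, tag (y p) = none)
    (hrun : ∀ σ : Fin G → Equiv.Perm (Fin k), ∃ ops : List (EMOp n),
      (initial n B).AllowedSeq M B ops ∧ ops.length = T ∧ ∃ X : Finset (Fin G × Fin k),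
        r ≤ X.card ∧ ∀ t ∈ X, ∃ a, tag a = some t ∧
          (initial n B).Met ops a (y (t.1, σ t.1 t.2))) :
    ((k : ℝ) / (Real.exp 1 * B)) ^ r ≤
      ((((n + 1 + T : ℕ) : ℝ) * ((1 + (B : ℝ) / M) ^ M * (1 + M * (B : ℝ)⁻¹) ^ B) +
        (1 + (B : ℝ) / M) ^ M) * ((M : ℝ) / B) ^ B) ^ T := by
  classical
  have hB0 : (0 : ℝ) < B := by exact_mod_cast hB
  have hM0 : (0 : ℝ) < M := by exact_mod_cast hB.trans hBM
  have hk0 : (0 : ℝ) < k := lt_of_lt_of_le (by positivity) hk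
  set S := n + 1 + T with hS
  -- With this `x` the factor `(1 + x) ^ M` is at most `e ^ B`, and the lost factor `x ^ (T * B)`
  -- costs only `(M / B) ^ B` per I/O. The partner weight `1 / B` leaves a gain of `k / (e * B)` per
  -- seen item.
  set x : ℝ := (B : ℝ) / M with hx
  have hx0 : 0 < x := by positivity
  have hx1 : x ≤ 1 := by rw [hx, div_le_one hM0]; exact_mod_cast hBM
  let A : List (Finset (Fin n)) := (List.range (n + 1)).map (initial n B).disk
  let g : (Fin G → Equiv.Perm (Fin k)) → Fin G × Fin k → Fin n → Fin n → Prop := fun σ t a b =>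
    (tag a = some t ∧ b = y (t.1, σ t.1 t.2)) ∨ (tag b = some t ∧ a = y (t.1, σ t.1 t.2))
  have hgsymm : ∀ σ t a b, g σ t a b → g σ t b a := fun σ t a b h => h.symm
  have hown : ∀ σ t t' a b b', g σ t a b → g σ t' a b' → t = t' := by
    rintro σ t t' a b b' (⟨h1, h2⟩ | ⟨h1, h2⟩) (⟨h3, h4⟩ | ⟨h3, h4⟩)
    · exact Option.some.inj (h1.symm.trans h3)
    · rw [h4, hty] at h1; simp at h1
    · rw [h2, hty] at h3; simp at h3
    · obtain ⟨t1, t2⟩ := t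
      obtain ⟨t1', t2'⟩ := t'
      obtain ⟨h5, h6⟩ := Prod.mk.inj (hy (h2.symm.trans h4))
      dsimp only at h5 h6
      subst h5
      rw [(σ t1).injective h6]
  have hdisk : ∀ i, (initial n B).disk i ∈ A := by
    intro i
    by_cases hi : i ≤ n
    · exact List.mem_map.2 ⟨i, List.mem_range.2 (by omega), rfl⟩
    -- Block `n` is already empty because `a / B ≤ a < n`, so it represents all addresses above `n`.
    · refine List.mem_map.2 ⟨n, List.mem_range.2 (by omega), ?_⟩
      ext a
      have h1 : a.val / B ≤ a.val := Nat.div_le_self _ _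
      have h2 := a.isLt
      simp only [initial, Finset.mem_filter, Finset.mem_univ, true_and]
      omega
  have hword : ∀ σ : Fin G → Equiv.Perm (Fin k), ∃ X : Finset (Fin G × Fin k), r ≤ X.card ∧
      ∃ v : Fin T → Letter M B S,
        (∀ p ∈ wordPairs ∅ A (List.ofFn v), ∃ t ∈ X, g σ t p.1 p.2) ∧
        (∀ t ∈ X, ∃ p ∈ wordPairs ∅ A (List.ofFn v), g σ t p.1 p.2) ∧
        x ^ (T * B) * ((B : ℝ)⁻¹) ^ X.card ≤ ∏ i, (v i).weight x (B : ℝ)⁻¹ := by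
    intro σ
    obtain ⟨ops, hal, hT, X, hr, hX⟩ := hrun σ
    obtain ⟨w, hw, hw1, hw2, e, he, hwe⟩ := exists_word (S := S) (g := g σ) (hgsymm σ) (hown σ)
      x (B : ℝ)⁻¹ ops (initial n B) A X hdisk (by simp [A, hS, hT]) (bounded_initial hB) hal
      (fun t ht => let ⟨a, ha, hm⟩ := hX t ht; ⟨a, _, .inl ⟨ha, rfl⟩, hm⟩)
      (fun t _ a b _ ha => by simp [initial] at ha)
    have hwT : w.length = T := hw.trans hT
    obtain ⟨v, rfl⟩ : ∃ v : Fin T → Letter M B S, List.ofFn v = w :=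
      ⟨fun i => w.get (i.cast hwT.symm), List.ext_getElem (by simp [hwT]) (by simp)⟩
    refine ⟨X, hr, v, hw1, hw2, ?_⟩
    rw [List.map_ofFn, List.prod_ofFn] at hwe
    have he' : e ≤ T * B := by simpa [initial, hT] using he
    simp only [Function.comp_apply] at hwe
    rw [hwe]
    gcongr ?_ * _
    exact pow_le_pow_of_le_one hx0.le hx1 he'
  choose X hr v hv1 hv2 hv3 using hword
  have hfiber : ∀ u : Fin T → Letter M B S,
      ((Finset.univ.filter fun σ => v σ = u).card : ℝ) ≤
        (k.factorial : ℝ) ^ G * (Real.exp 1 * B / k) ^ r * (x⁻¹) ^ (T * B) *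
          ∏ i, (u i).weight x (B : ℝ)⁻¹ := by
    intro u
    have hprod : 0 ≤ ∏ i, (u i).weight x (B : ℝ)⁻¹ :=
      Finset.prod_nonneg fun i _ => Letter.weight_nonneg hx0.le (by positivity) _
    rcases (Finset.univ.filter fun σ => v σ = u).eq_empty_or_nonempty with h | ⟨σ₀, hσ₀⟩
    · rw [h]; simp only [Finset.card_empty, Nat.cast_zero]; positivity
    have hu : v σ₀ = u := (Finset.mem_filter.1 hσ₀).2
    -- A pair in the word identifies its item by the tag and the value of the permutation by the
    -- target. Hence all choices with the word `u` agree with `σ₀` on the items that the word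
    -- records.
    have hsub : (Finset.univ.filter fun σ => v σ = u) ⊆
        Finset.univ.filter fun σ : Fin G → Equiv.Perm (Fin k) =>
          ∀ p ∈ X σ₀, σ p.1 p.2 = σ₀ p.1 p.2 := by
      intro σ hσ
      have hσu : v σ = v σ₀ := (Finset.mem_filter.1 hσ).2.trans hu.symm
      refine Finset.mem_filter.2 ⟨Finset.mem_univ _, fun t ht => ?_⟩
      obtain ⟨⟨a, b⟩, hp, hab⟩ := hv2 σ₀ t ht
      rw [← hσu] at hp
      obtain ⟨t', ht', hab'⟩ := hv1 σ _ hp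
      rcases hab with ⟨h1, h2⟩ | ⟨h1, h2⟩ <;> rcases hab' with ⟨h3, h4⟩ | ⟨h3, h4⟩ <;>
        dsimp only at h1 h2 h3 h4
      · obtain rfl : t = t' := Option.some.inj (h1.symm.trans h3)
        simpa using (hy (h4.symm.trans h2))
      · rw [h4, hty] at h1; simp at h1
      · rw [h4, hty] at h1; simp at h1
      · obtain rfl : t = t' := Option.some.inj (h1.symm.trans h3)
        simpa using (hy (h4.symm.trans h2))
    have h1 := card_filter_perms_le (X σ₀) σ₀
    rw [← le_div_iff₀ (by positivity), mul_div_assoc, ← div_pow] at h1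
    -- The base `e * B / k` is at most `1` by `hk`, so its exponent may be lowered to `r`; the
    -- remaining power of `1 / B` is absorbed by the weight of the word.
    have h2 : (Real.exp 1 / k) ^ (X σ₀).card ≤
        (Real.exp 1 * B / k) ^ r * ((B : ℝ)⁻¹) ^ (X σ₀).card := by
      have h3 : Real.exp 1 / k = Real.exp 1 * B / k * (B : ℝ)⁻¹ := by field_simp
      rw [h3, mul_pow]
      gcongr ?_ * _
      refine pow_le_pow_of_le_one (by positivity) ?_ (hr σ₀)
      rwa [div_le_one hk0]
    have h3 : ((B : ℝ)⁻¹) ^ (X σ₀).card ≤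
        (x⁻¹) ^ (T * B) * ∏ i, (u i).weight x (B : ℝ)⁻¹ := by
      have := hv3 σ₀
      rw [hu] at this
      rw [inv_pow x, ← div_eq_inv_mul, le_div_iff₀ (by positivity), mul_comm]
      exact this
    calc ((Finset.univ.filter fun σ => v σ = u).card : ℝ)
        ≤ _ := by exact_mod_cast Finset.card_le_card hsub
      _ ≤ _ := h1
      _ ≤ (k.factorial : ℝ) ^ G * ((Real.exp 1 * B / k) ^ r *
            ((x⁻¹) ^ (T * B) * ∏ i, (u i).weight x (B : ℝ)⁻¹)) := by
          gcongr
          exact h2.trans (by gcongr)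
      _ = _ := by ring
  have htotal : (k.factorial : ℝ) ^ G ≤
      (k.factorial : ℝ) ^ G * (Real.exp 1 * B / k) ^ r * (x⁻¹) ^ (T * B) *
        (∑ l : Letter M B S, l.weight x (B : ℝ)⁻¹) ^ T := by
    have h1 : (k.factorial : ℝ) ^ G =
        ((Finset.univ : Finset (Fin G → Equiv.Perm (Fin k))).card : ℝ) := by
      simp [Fintype.card_perm]
    have h2 := Finset.card_eq_sum_card_fiberwise (f := v)
      (s := (Finset.univ : Finset (Fin G → Equiv.Perm (Fin k)))) (t := Finset.univ)
      (by intro _ _; simp)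
    conv_lhs => rw [h1, h2]
    rw [Fintype.sum_pow, Finset.mul_sum, Nat.cast_sum]
    exact Finset.sum_le_sum fun u _ => hfiber u
  rw [Letter.sum_weight, mul_assoc, mul_assoc] at htotal
  have hf0 : (0 : ℝ) < (k.factorial : ℝ) ^ G := by positivity
  have h1 := (le_mul_iff_one_le_right hf0).1 htotal
  have h2 : (Real.exp 1 * B / k) ^ r = (((k : ℝ) / (Real.exp 1 * B)) ^ r)⁻¹ := by
    rw [← inv_pow, inv_div]
  have hx' : x⁻¹ = (M : ℝ) / B := by rw [hx, inv_div]
  rw [h2, ← div_eq_inv_mul, le_div_iff₀ (by positivity), one_mul] at h1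
  rw [mul_pow, ← pow_mul, Nat.mul_comm B T, ← hx', mul_comm (_ ^ T)]
  exact h1

end EMState

/-! ### Graphs without independent triples -/

open Classical in
/-- A relation on `q` elements that holds for two of any three elements holds for at least
`(q - 2) ^ 2 / 4` ordered pairs. -/
theorem Finset.sq_card_sub_two_le_of_triples {α : Type*} (Q : Finset α) (adj : α → α → Prop)
    (h3 : ∀ a ∈ Q, ∀ b ∈ Q, ∀ c ∈ Q, a ≠ b → b ≠ c → a ≠ c → adj a b ∨ adj b c ∨ adj a c) :
    ((Q.card - 2 : ℕ) : ℝ) ^ 2 ≤ 4 * ((Q.offDiag.filter fun p => adj p.1 p.2).card : ℝ) := by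
  set E := Q.offDiag.filter fun p => adj p.1 p.2 with hE
  let F : α → Finset α := fun a => Q.filter fun b => b ≠ a ∧ ¬ adj a b
  -- The non-neighbours of any element are pairwise related. Either some element has at least half
  -- of `Q` as non-neighbours, which gives a large clique, or all degrees are large.
  by_cases h : ∃ a ∈ Q, Q.card ≤ 2 * (F a).card
  · obtain ⟨a, ha, hq⟩ := h
    have hsub : (F a).offDiag ⊆ E := by
      rintro ⟨b, c⟩ hbc
      obtain ⟨hb, hc, hne⟩ := Finset.mem_offDiag.1 hbc
      obtain ⟨hbQ, hba, hab⟩ := Finset.mem_filter.1 hb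
      obtain ⟨hcQ, hca, hac⟩ := Finset.mem_filter.1 hc
      refine Finset.mem_filter.2 ⟨Finset.mem_offDiag.2 ⟨hbQ, hcQ, hne⟩, ?_⟩
      rcases h3 a ha b hbQ c hcQ hba.symm hne hca.symm with h | h | h
      · exact absurd h hab
      · exact h
      · exact absurd h hac
    have h1 := Finset.card_le_card hsub
    rw [Finset.offDiag_card] at h1
    have h2 : (Q.card - 2) ^ 2 ≤ 4 * E.card := by
      refine le_trans ?_ (Nat.mul_le_mul_left 4 h1)
      rcases Nat.eq_zero_or_pos (F a).card with h0 | h0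
      · have : Q.card - 2 = 0 := by omega
        simp [this]
      · obtain ⟨f, hf⟩ := Nat.exists_eq_add_of_le' h0
        have h4 : Q.card - 2 ≤ 2 * f := by omega
        rw [hf]
        have h5 : (f + 1) * (f + 1) - (f + 1) = f * f + f := by
          rw [Nat.sub_eq_iff_eq_add (by nlinarith)]; ring
        rw [h5]
        nlinarith
    exact_mod_cast h2
  · push Not at h
    have h1 : ∀ a ∈ Q, Q.card - 2 ≤ 2 * (Q.filter fun b => a ≠ b ∧ adj a b).card := by
      intro a ha
      have h4 := h a ha
      have h5 : (F a).card + (Q.filter fun b => a ≠ b ∧ adj a b).card = (Q.erase a).card := by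
        rw [← Finset.card_union_of_disjoint]
        · congr 1
          ext b
          simp only [F, Finset.mem_union, Finset.mem_filter, Finset.mem_erase, ne_eq,
            eq_comm (a := b)]
          tauto
        · rw [Finset.disjoint_left]
          intro b hb hb'
          exact (Finset.mem_filter.1 hb).2.2 (Finset.mem_filter.1 hb').2.2
      rw [Finset.card_erase_of_mem ha] at h5
      omega
    have h2 : E.card = ∑ a ∈ Q, (Q.filter fun b => a ≠ b ∧ adj a b).card := by
      rw [← Finset.card_sigma]
      refine Finset.card_bij' (fun p _ => ⟨p.1, p.2⟩) (fun q _ => (q.1, q.2)) ?_ ?_ ?_ ?_ <;>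
        simp +contextual [E]
    have h4 : Q.card * (Q.card - 2) ≤ 2 * E.card := by
      rw [h2, Finset.mul_sum, ← smul_eq_mul, ← Finset.sum_const]
      exact Finset.sum_le_sum h1
    have h5 : (Q.card - 2) ^ 2 ≤ 4 * E.card := by
      have : Q.card - 2 ≤ Q.card := Nat.sub_le _ _
      nlinarith
    exact_mod_cast h5

/-! ### Hidden permutations -/

namespace EMState

variable {n : ℕ}

/-- Address `n` is empty at the start, so writing the empty block there changes nothing and can
serve as padding. -/
theorem exists_length_eq {M B T : ℕ} {ops : List (EMOp n)}
    (hal : (initial n B).AllowedSeq M B ops) (hT : ops.length ≤ T) :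
    ∃ ops' : List (EMOp n), (initial n B).AllowedSeq M B ops' ∧ ops'.length = T ∧
      ∀ a b, (initial n B).Met ops a b → (initial n B).Met ops' a b := by
  have hs : (initial n B).apply (.write n ∅) = initial n B := by
    have h : (initial n B).disk n = ∅ := by
      ext a
      have h1 : a.val / B ≤ a.val := Nat.div_le_self _ _
      have h2 := a.isLt
      simp only [initial, Finset.mem_filter, Finset.mem_univ, true_and, Finset.notMem_empty,
        iff_false]
      omega
    simp [EMState.apply, ← h]
  induction T, hT using Nat.le_induction with
  | base => exact ⟨ops, hal, rfl, fun _ _ h => h⟩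
  | succ T hT ih =>
    obtain ⟨ops', h1, h2, h3⟩ := ih
    refine ⟨.write n ∅ :: ops', ⟨⟨by simp, by simp⟩, by rwa [hs]⟩, by simp [h2], ?_⟩
    intro a b hab
    obtain ⟨m, hm, ha, hb⟩ := h3 a b hab
    refine ⟨m, List.mem_cons_of_mem _ ?_, ha, hb⟩
    rwa [hs]

/-- `G` groups of `k` items.  An item owns the records tagged with it and one further record, which
one is determined by a permutation of each group. -/
structure HiddenPerms (n G k : ℕ) where
  tag : Fin n → Option (Fin G × Fin k)
  target : Fin G × Fin k → Fin n
  target_injective : Function.Injective target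
  tag_target : ∀ p, tag (target p) = none

namespace HiddenPerms

variable {G k : ℕ} (H : HiddenPerms n G k) (σ : Fin G → Equiv.Perm (Fin k))

def Owns (p : Fin G × Fin k) (a : Fin n) : Prop :=
  H.tag a = some p ∨ a = H.target (p.1, σ p.1 p.2)

/-- A record tagged with `p` meets the further record of `p`. -/
def Seen (s : EMState n) (ops : List (EMOp n)) (p : Fin G × Fin k) : Prop :=
  ∃ a, H.tag a = some p ∧ s.Met ops a (H.target (p.1, σ p.1 p.2))

/-- A record of `p` meets a record of `q`. -/
def Cross (s : EMState n) (ops : List (EMOp n)) (p q : Fin G × Fin k) : Prop :=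
  ∃ a b, H.Owns σ p a ∧ H.Owns σ q b ∧ s.Met ops a b

variable {H σ}

/-- Targets are untagged, so the two kinds of ownership exclude each other. Within a kind, tags are
functional, and targets and permutations are injective. -/
theorem Owns.unique {p q : Fin G × Fin k} {a : Fin n} (hp : H.Owns σ p a) (hq : H.Owns σ q a) :
    p = q := by
  rcases hp with h1 | h1 <;> rcases hq with h2 | h2
  · exact Option.some.inj (h1.symm.trans h2)
  · rw [h2, H.tag_target] at h1; simp at h1
  · rw [h1, H.tag_target] at h2; simp at h2
  · obtain ⟨p1, p2⟩ := p
    obtain ⟨q1, q2⟩ := q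
    obtain ⟨h5, h6⟩ := Prod.mk.inj (H.target_injective (h1.symm.trans h2))
    dsimp only at h5 h6
    subst h5
    rw [(σ p1).injective h6]

theorem Cross.symm {s : EMState n} {ops : List (EMOp n)} {p q : Fin G × Fin k}
    (h : H.Cross σ s ops p q) : H.Cross σ s ops q p := by
  obtain ⟨a, b, ha, hb, hab⟩ := h
  exact ⟨b, a, hb, ha, hab.symm⟩

variable (H σ)

/-- The items of every group can be 3-coloured such that of any three unseen items of the same
colour two cross. -/
def Resolved (s : EMState n) (ops : List (EMOp n)) : Prop :=
  ∀ g, ∃ col : Fin k → Fin 3, ∀ t₁ t₂ t₃, t₁ ≠ t₂ → t₂ ≠ t₃ → t₁ ≠ t₃ →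
    col t₁ = col t₂ → col t₂ = col t₃ → ¬ H.Seen σ s ops (g, t₁) → ¬ H.Seen σ s ops (g, t₂) →
    ¬ H.Seen σ s ops (g, t₃) →
    H.Cross σ s ops (g, t₁) (g, t₂) ∨ H.Cross σ s ops (g, t₂) (g, t₃) ∨
      H.Cross σ s ops (g, t₁) (g, t₃)

variable {H σ}

open Classical in
theorem exists_large_color_class {S : Finset (Fin k)} (col : Fin k → Fin 3) :
    ∃ j, S.card ≤ 3 * (S.filter fun t => col t = j).card := by
  by_contra! h
  have h1 : S.card = ∑ j, (S.filter fun t => col t = j).card :=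
    Finset.card_eq_sum_card_fiberwise (by intro _ _; simp)
  have h2 := h 0
  have h3 := h 1
  have h4 := h 2
  rw [Fin.sum_univ_three] at h1
  omega

open Classical in
/-- If few items are seen, then many pairs of items cross. -/
theorem Resolved.card_cross {M B : ℕ} (hB : 1 ≤ B) {ops : List (EMOp n)}
    (hal : (initial n B).AllowedSeq M B ops) (hres : H.Resolved σ (initial n B) ops)
    (hk : 12 ≤ k)
    (hseen : 2 * (Finset.univ.filter fun p => H.Seen σ (initial n B) ops p).card ≤ G * k) :
    (G : ℝ) * ((k : ℝ) / 12 - 1) ^ 2 ≤ 2 * B * M * ops.length := by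
  obtain ⟨P, hPc, hP⟩ := exists_met_finset ops _ (bounded_initial hB) hal
  let U : Fin G → Finset (Fin k) := fun g =>
    Finset.univ.filter fun t => ¬ H.Seen σ (initial n B) ops (g, t)
  have hU : G * k ≤ 2 * ∑ g, (U g).card := by
    have h1 : ∑ g, (U g).card =
        (Finset.univ.filter fun p => ¬ H.Seen σ (initial n B) ops p).card := by
      rw [← Finset.card_sigma]
      refine Finset.card_bij' (fun q _ => (q.1, q.2)) (fun p _ => ⟨p.1, p.2⟩) ?_ ?_ ?_ ?_ <;>
        simp [U]
    have h2 := Finset.card_filter_add_card_filter_not (s := (Finset.univ : Finset (Fin G × Fin k)))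
      (fun p => H.Seen σ (initial n B) ops p)
    rw [Finset.card_univ, Fintype.card_prod, Fintype.card_fin, Fintype.card_fin] at h2
    rw [h1]
    omega
  have hgroup : ∀ g, ∃ Q : Finset (Fin k), (U g).card ≤ 3 * Q.card ∧
      ((Q.card - 2 : ℕ) : ℝ) ^ 2 ≤ 4 * ((Q.offDiag.filter fun p =>
        H.Cross σ (initial n B) ops (g, p.1) (g, p.2)).card : ℝ) := by
    intro g
    obtain ⟨col, hcol⟩ := hres g
    obtain ⟨j, hj⟩ := exists_large_color_class (S := U g) col
    refine ⟨_, hj, ?_⟩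
    convert Finset.sq_card_sub_two_le_of_triples ((U g).filter fun t => col t = j)
      (fun t t' => H.Cross σ (initial n B) ops (g, t) (g, t')) ?_
    intro a ha b hb c hc hab hbc hac
    simp only [U, Finset.mem_filter, Finset.mem_univ, true_and] at ha hb hc
    exact hcol a b c hab hbc hac (ha.2.trans hb.2.symm) (hb.2.trans hc.2.symm) ha.1 hb.1 hc.1
  choose Q hQ1 hQ2 using hgroup
  let E : Fin G → Finset (Fin k × Fin k) := fun g => (Q g).offDiag.filter fun p =>
    H.Cross σ (initial n B) ops (g, p.1) (g, p.2)
  -- A record has only one owner, so different crossing pairs of items yield different pairs of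
  -- records that meet.
  have hE : ∑ g, (E g).card ≤ P.card := by
    rw [← Finset.card_sigma]
    have hex : ∀ e ∈ Finset.univ.sigma E, ∃ p ∈ P, H.Owns σ (e.1, e.2.1) p.1 ∧
        H.Owns σ (e.1, e.2.2) p.2 := by
      rintro ⟨g, t, t'⟩ he
      obtain ⟨-, a, b, ha, hb, hab⟩ := Finset.mem_filter.1 (Finset.mem_sigma.1 he).2
      rcases hP a b hab with h | h
      · exact ⟨(a, b), h, ha, hb⟩
      · simp [initial] at h
    rcases (Finset.univ.sigma E).eq_empty_or_nonempty with h0 | ⟨e₀, he₀⟩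
    · simp [h0]
    have : Nonempty (Fin n × Fin n) := ⟨(hex e₀ he₀).choose⟩
    choose! f hf1 hf2 hf3 using hex
    refine Finset.card_le_card_of_injOn f hf1 ?_
    rintro ⟨g, t, t'⟩ he ⟨g', u, u'⟩ he' h
    have h1 := hf2 _ he
    have h2 := hf3 _ he
    rw [h] at h1 h2
    obtain ⟨h3, h4⟩ := Prod.mk.inj (h1.unique (hf2 _ he'))
    obtain ⟨h5, h6⟩ := Prod.mk.inj (h2.unique (hf3 _ he'))
    dsimp only at h3 h4 h6
    subst h3 h4 h6
    rfl
  set z : ℝ := (k : ℝ) / 12 - 1 with hz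
  have hz0 : 0 ≤ z := by
    have : (12 : ℝ) ≤ k := by exact_mod_cast hk
    linarith
  -- The square is replaced by its tangent at `z`, because only the sum of the `(U g).card` is
  -- bounded below. With the mean value `k / 2` the bracket becomes `k / 12 - 1 = z`.
  have hterm : ∀ g, 2 * z * ((U g).card / 6 - 1) - z ^ 2 ≤ ((E g).card : ℝ) := by
    intro g
    have h1 : ((U g).card : ℝ) ≤ 3 * (Q g).card := by exact_mod_cast hQ1 g
    have h2 : ((Q g).card : ℝ) - 2 ≤ ((Q g).card - 2 : ℕ) := by
      have : (Q g).card ≤ ((Q g).card - 2) + 2 := by omega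
      have : ((Q g).card : ℝ) ≤ ((Q g).card - 2 : ℕ) + 2 := by exact_mod_cast this
      linarith
    have h3 := hQ2 g
    set q : ℝ := (((Q g).card - 2 : ℕ) : ℝ) with hq
    have h4 : ((U g).card : ℝ) / 6 - 1 ≤ q / 2 := by linarith
    have h5 : 2 * z * ((U g).card / 6 - 1) ≤ 2 * z * (q / 2) := by gcongr
    change _ ≤ ((E g).card : ℝ)
    have h6 : q ^ 2 ≤ 4 * ((E g).card : ℝ) := h3
    nlinarith [sq_nonneg (q / 2 - z)]
  have hsum := Finset.sum_le_sum fun g (_ : g ∈ (Finset.univ : Finset (Fin G))) => hterm g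
  rw [Finset.sum_sub_distrib, ← Finset.mul_sum, Finset.sum_sub_distrib, ← Finset.sum_div] at hsum
  simp only [Finset.sum_const, Finset.card_univ, Fintype.card_fin, nsmul_eq_mul, mul_one] at hsum
  have h1 : ((∑ g, (E g).card : ℕ) : ℝ) ≤ ops.length * (2 * B * M) := by
    exact_mod_cast hE.trans hPc
  push_cast at h1
  have h2 : (G : ℝ) * k ≤ 2 * ∑ g, ((U g).card : ℝ) := by exact_mod_cast hU
  have h3 : 2 * z * ((G : ℝ) * z) ≤ 2 * z * ((∑ g, ((U g).card : ℝ)) / 6 - G) := by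
    gcongr
    rw [hz]
    linarith
  nlinarith

/-- Resolving all permutations requires many crossings or many I/Os. -/
theorem lower_bound {M B : ℕ} (hB : 1 ≤ B) (hBM : B ≤ M) (H : HiddenPerms n G k) (T : ℕ)
    (hk12 : 12 ≤ k) (hk : Real.exp 1 * B ≤ k)
    (hrun : ∀ σ : Fin G → Equiv.Perm (Fin k), ∃ ops : List (EMOp n),
      (initial n B).AllowedSeq M B ops ∧ ops.length ≤ T ∧ H.Resolved σ (initial n B) ops) :
    (G : ℝ) * ((k : ℝ) / 12 - 1) ^ 2 ≤ 2 * B * M * T ∨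
    ((k : ℝ) / (Real.exp 1 * B)) ^ (G * k / 2) ≤
      ((((n + 1 + T : ℕ) : ℝ) * ((1 + (B : ℝ) / M) ^ M * (1 + M * (B : ℝ)⁻¹) ^ B) +
        (1 + (B : ℝ) / M) ^ M) * ((M : ℝ) / B) ^ B) ^ T := by
  classical
  -- A single choice of permutations with at most half of the items seen forces many crossings.
  -- Failing that, more than half are seen for all choices, as the counting bound requires.
  by_cases h : ∃ σ : Fin G → Equiv.Perm (Fin k), ∃ ops : List (EMOp n),
      (initial n B).AllowedSeq M B ops ∧ ops.length ≤ T ∧ H.Resolved σ (initial n B) ops ∧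
      2 * (Finset.univ.filter fun p => H.Seen σ (initial n B) ops p).card ≤ G * k
  · obtain ⟨σ, ops, hal, hT, hres, hseen⟩ := h
    left
    refine (hres.card_cross hB hal hk12 hseen).trans ?_
    gcongr
  · right
    push Not at h
    refine pow_le_of_forall_perms hB hBM T (G * k / 2) hk H.target_injective H.tag_target
      fun σ => ?_
    obtain ⟨ops, hal, hT, hres⟩ := hrun σ
    obtain ⟨ops', hal', hT', hmet⟩ := exists_length_eq hal hT
    refine ⟨ops', hal', hT', Finset.univ.filter fun p => H.Seen σ (initial n B) ops p, ?_, ?_⟩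
    · have := h σ ops hal hT hres
      omega
    · intro t ht
      obtain ⟨a, ha, hm⟩ := (Finset.mem_filter.1 ht).2
      exact ⟨a, ha, hmet _ _ hm⟩

end HiddenPerms

end EMState

/-! ### From hidden permutations to the sorting bound -/

theorem weight_bound {n T M B N : ℕ} (hB : 1 ≤ B) (hM : 2 * B ≤ M) (hn : n ≤ 2 * N) (hT : T ≤ N)
    (hN : 2 ≤ N) :
    (((n + 1 + T : ℕ) : ℝ) * ((1 + (B : ℝ) / M) ^ M * (1 + M * (B : ℝ)⁻¹) ^ B) +
        (1 + (B : ℝ) / M) ^ M) * ((M : ℝ) / B) ^ B ≤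
      (5 * N) * (Real.exp B * (2 * ((M : ℝ) / B)) ^ B) * ((M : ℝ) / B) ^ B := by
  have hB0 : (0 : ℝ) < B := by exact_mod_cast hB
  have hM2 : (2 : ℝ) * B ≤ M := by exact_mod_cast hM
  have hM0 : (0 : ℝ) < M := by linarith
  have h1 : (1 + (B : ℝ) / M) ^ M ≤ Real.exp B := by
    have h2 : 1 + (B : ℝ) / M ≤ Real.exp ((B : ℝ) / M) := by
      rw [add_comm]; exact Real.add_one_le_exp _
    calc (1 + (B : ℝ) / M) ^ M ≤ Real.exp ((B : ℝ) / M) ^ M := by gcongr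
      _ = Real.exp B := by rw [← Real.exp_nat_mul]; congr 1; field_simp
  have hMB : 2 ≤ (M : ℝ) / B := by rwa [le_div_iff₀ hB0]
  have h2 : (1 + M * (B : ℝ)⁻¹) ^ B ≤ (2 * ((M : ℝ) / B)) ^ B := by
    rw [← div_eq_mul_inv]
    gcongr
    linarith
  have h3 : (1 : ℝ) ≤ (2 * ((M : ℝ) / B)) ^ B := one_le_pow₀ (by linarith)
  have h4 : (1 + (B : ℝ) / M) ^ M ≤ Real.exp B * (2 * ((M : ℝ) / B)) ^ B :=
    h1.trans (le_mul_of_one_le_right (Real.exp_nonneg _) h3)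
  have h5 : (1 + (B : ℝ) / M) ^ M * (1 + M * (B : ℝ)⁻¹) ^ B ≤
      Real.exp B * (2 * ((M : ℝ) / B)) ^ B := by gcongr
  have h6 : (((n + 1 + T : ℕ) : ℝ)) + 1 ≤ 5 * N := by
    have : n + 1 + T + 1 ≤ 5 * N := by omega
    exact_mod_cast this
  gcongr ?_ * _
  calc _ ≤ ((n + 1 + T : ℕ) : ℝ) * (Real.exp B * (2 * ((M : ℝ) / B)) ^ B) +
        Real.exp B * (2 * ((M : ℝ) / B)) ^ B := by gcongr
    _ = (((n + 1 + T : ℕ) : ℝ) + 1) * (Real.exp B * (2 * ((M : ℝ) / B)) ^ B) := by ring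
    _ ≤ _ := by gcongr

/-- Here `sort(N) ≤ N` is used, in the form `hsort`: it bounds the cost of naming one of `O(N)`
blocks by the cost `B * log (M / B)` of describing the moved records. Since `M ≥ 2 * B`, this
logarithm exceeds `0.69`, which absorbs the remaining terms of order `B`. -/
theorem log_weight_bound {M B N : ℕ} (hB : 1 ≤ B) (hM : 2 * B ≤ M) (hN : 2 ≤ N)
    (hsort : Real.log ((N : ℝ) / B) ≤ B * Real.log ((M : ℝ) / B)) :
    Real.log ((5 * N) * (Real.exp B * (2 * ((M : ℝ) / B)) ^ B) * ((M : ℝ) / B) ^ B) ≤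
      14 * (B * Real.log ((M : ℝ) / B)) := by
  have hB0 : (0 : ℝ) < B := by exact_mod_cast hB
  have hM2 : (2 : ℝ) * B ≤ M := by exact_mod_cast hM
  have hN0 : (0 : ℝ) < N := by positivity
  have hMB : 2 ≤ (M : ℝ) / B := by rwa [le_div_iff₀ hB0]
  have hL : 0.69 ≤ Real.log ((M : ℝ) / B) := by
    have := Real.log_le_log (by norm_num) hMB
    have := Real.log_two_gt_d9
    linarith
  have h5N : Real.log (5 * N) = Real.log ((N : ℝ) / B) + Real.log (5 * B) := by
    rw [← Real.log_mul (by positivity) (by positivity)]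
    congr 1
    field_simp
  have h2M : Real.log (2 * ((M : ℝ) / B)) = Real.log 2 + Real.log ((M : ℝ) / B) :=
    Real.log_mul (by norm_num) (by positivity)
  rw [Real.log_mul (by positivity) (by positivity), Real.log_mul (by positivity) (by positivity),
    Real.log_mul (Real.exp_ne_zero _) (by positivity), Real.log_exp, Real.log_pow, Real.log_pow,
    h5N, h2M]
  have h1 : Real.log (5 * (B : ℝ)) ≤ 5 * B := Real.log_le_self (by positivity)
  have h2 : Real.log 2 ≤ 1 := by have := Real.log_two_lt_d9; linarith
  nlinarith

/-- Passing from `K` to `k / e` loses at most a factor `3 * e`. Since `(3 * e) ^ 2 ≤ 100 ≤ K / B`,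
this is at most the square root of `K / B`. -/
theorem log_div_le_two_mul {K k B : ℝ} (hB : 0 < B) (hk : K ≤ 3 * k) (hK : 100 * B ≤ K) :
    Real.log (K / B) ≤ 2 * Real.log (k / (Real.exp 1 * B)) := by
  have he : Real.exp 1 < 2.72 := by have := Real.exp_one_lt_d9; linarith
  have he0 : 0 < Real.exp 1 := Real.exp_pos 1
  have hK0 : 0 < K := by linarith
  have hq : 100 ≤ K / B := by rwa [le_div_iff₀ hB]
  have h5 : K / B / (3 * Real.exp 1) ≤ k / (Real.exp 1 * B) := by
    rw [div_div, div_le_div_iff₀ (by positivity) (by positivity)]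
    have := mul_le_mul_of_nonneg_left hk (by positivity : 0 ≤ Real.exp 1 * B)
    linarith
  have h6 : K / B ≤ (K / B / (3 * Real.exp 1)) ^ 2 := by
    rw [div_pow, le_div_iff₀ (by positivity), sq (K / B)]
    have : (3 * Real.exp 1) ^ 2 ≤ 100 := by nlinarith
    gcongr
    linarith
  have h7 := Real.log_le_log (by positivity) (h6.trans (pow_le_pow_left₀ (by positivity) h5 2))
  rw [Real.log_pow] at h7
  exact_mod_cast h7

namespace RecordProblem

open EMState in
/-- The lower bound holds if every correct algorithm has to read a constant fraction of the input
and to resolve hidden permutations of groups of size about `K`. -/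
theorem requiresIOs_of_hiddenPerms {P : RecordProblem} {S : P.Input → Prop} {N K M B : ℕ}
    (hB : 1 ≤ B) (hM : 2 * B ≤ M) (hK : 1 ≤ K) (hKN : 2 * K ≤ N) (hsort : sortIO M B N ≤ N)
    (hsize : P.size ≤ 2 * N) (hinst : ∃ I, S I)
    (hscan : 2 ≤ K → ∀ A : P.EMAlgorithm, A.Solves M B →
      ∃ I, S I ∧ N ≤ 8 * ((A.ops I).length * B))
    (hcore : 2 ≤ K → ∃ (G k : ℕ) (H : HiddenPerms P.size G k), N ≤ 12 * (G * k) ∧ K ≤ 3 * k ∧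
      ∀ A : P.EMAlgorithm, A.Solves M B → ∀ σ, ∃ I, S I ∧
        H.Resolved σ (initial P.size B) (A.ops I)) :
    P.RequiresIOs S M B (1 / 100000 * (((N : ℝ) / K) * sortIO M B K)) := by
  intro A hA
  have hB0 : (0 : ℝ) < B := by exact_mod_cast hB
  have hM2 : (2 : ℝ) * B ≤ M := by exact_mod_cast hM
  have hM0 : (0 : ℝ) < M := by linarith
  have hK0 : (0 : ℝ) < K := by exact_mod_cast hK
  have hN2 : 2 ≤ N := by omega
  have hN0 : (0 : ℝ) < N := by exact_mod_cast (by omega : 0 < N)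
  have hMB : 2 ≤ (M : ℝ) / B := by rwa [le_div_iff₀ hB0]
  set L := Real.log ((M : ℝ) / B) with hL
  have hL0 : 0.69 ≤ L := by
    have := Real.log_le_log (by norm_num) hMB
    have := Real.log_two_gt_d9
    linarith
  set l := Real.log ((K : ℝ) / B) with hl
  have hb : ((N : ℝ) / K) * sortIO M B K = (N : ℝ) / B * (l / L) := by
    rw [sortIO, Real.logb, ← hl, ← hL]
    field_simp
  rw [hb]
  -- For `K ≤ B` the logarithm is not positive and any run will do.
  rcases le_or_gt K B with hKB | hKB
  · obtain ⟨I, hI⟩ := hinst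
    refine ⟨I, hI, le_trans ?_ (Nat.cast_nonneg _)⟩
    have : l ≤ 0 := Real.log_nonpos (by positivity) (by
      rw [div_le_one hB0]; exact_mod_cast hKB)
    have h1 : l / L ≤ 0 := div_nonpos_of_nonpos_of_nonneg this (by linarith)
    have h2 : (N : ℝ) / B * (l / L) ≤ 0 := mul_nonpos_of_nonneg_of_nonpos (by positivity) h1
    linarith
  have hK2 : 2 ≤ K := by omega
  -- For `K < M` the quotient of logarithms is at most `1`, so scanning suffices.
  rcases lt_or_ge K M with hKM | hKM
  · obtain ⟨I, hI, hN⟩ := hscan hK2 A hA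
    refine ⟨I, hI, ?_⟩
    have h1 : l ≤ L := Real.log_le_log (by positivity) (by gcongr)
    have h2 : l / L ≤ 1 := by rw [div_le_one (by linarith)]; exact h1
    have h3 : (N : ℝ) ≤ 8 * ((A.ops I).length * B) := by exact_mod_cast hN
    have h4 : (N : ℝ) / B ≤ 8 * (A.ops I).length := by rw [div_le_iff₀ hB0]; linarith
    have h5 : (N : ℝ) / B * (l / L) ≤ (N : ℝ) / B * 1 := by gcongr
    have h6 : (0 : ℝ) ≤ (A.ops I).length := Nat.cast_nonneg _
    linarith
  -- For `K < 100 * B` the quotient is bounded by a constant, so scanning suffices again. Beyond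
  -- this range `k` is large enough for the counting.
  rcases lt_or_ge K (100 * B) with hKB2 | hKB2
  · obtain ⟨I, hI, hN⟩ := hscan hK2 A hA
    refine ⟨I, hI, ?_⟩
    have h1 : l ≤ 69 := by
      have h7 : (K : ℝ) / B ≤ 2 ^ 7 := by
        rw [div_le_iff₀ hB0]
        have : (K : ℝ) ≤ 100 * B := by exact_mod_cast hKB2.le
        linarith
      have h8 := Real.log_le_log (by positivity) h7
      rw [Real.log_pow] at h8
      have := Real.log_two_lt_d9
      push_cast at h8
      linarith
    have h2 : l / L ≤ 100 := by rw [div_le_iff₀ (by linarith)]; linarith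
    have h3 : (N : ℝ) ≤ 8 * ((A.ops I).length * B) := by exact_mod_cast hN
    have h4 : (N : ℝ) / B ≤ 8 * (A.ops I).length := by rw [div_le_iff₀ hB0]; linarith
    have h5 : (N : ℝ) / B * (l / L) ≤ (N : ℝ) / B * 100 := by gcongr
    have h6 : (0 : ℝ) ≤ (A.ops I).length := Nat.cast_nonneg _
    linarith
  have hKM' : (M : ℝ) ≤ K := by exact_mod_cast hKM
  have hKB' : (100 : ℝ) * B ≤ K := by exact_mod_cast hKB2
  have hKBd : 100 ≤ (K : ℝ) / B := by rwa [le_div_iff₀ hB0]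
  have hKN' : (K : ℝ) ≤ N := by exact_mod_cast (by omega : K ≤ N)
  have hl0 : 0 < l := Real.log_pos (by linarith)
  by_contra! hlt
  obtain ⟨G, k, H, hGk, hKk, hH⟩ := hcore hK2
  set b := (N : ℝ) / B * (l / L) with hbdef
  have hLpos : 0 < L := by linarith
  have hb0 : 0 < b := by positivity
  have hsort' : (N : ℝ) / B * (Real.log ((N : ℝ) / B) / L) ≤ N := hsort
  have hlogN : Real.log ((N : ℝ) / B) ≤ B * L := by
    rw [div_mul_div_comm, div_le_iff₀ (by positivity)] at hsort'
    exact le_of_mul_le_mul_left hsort' hN0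
  have hbN : b ≤ N := by
    refine le_trans ?_ hsort'
    have : l ≤ Real.log ((N : ℝ) / B) := Real.log_le_log (by positivity) (by gcongr)
    rw [hbdef]
    gcongr
  -- If the claim fails, every run on the class `S` has at most this many I/Os.
  set T := ⌊1 / 100000 * b⌋₊ with hT
  have hTb : (T : ℝ) ≤ 1 / 100000 * b := Nat.floor_le (by positivity)
  have hTN : T ≤ N := by
    have : (T : ℝ) ≤ N := by linarith
    exact_mod_cast this
  have hk12 : 12 ≤ k := by omega
  have hKk' : (K : ℝ) ≤ 3 * k := by exact_mod_cast hKk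
  have hGk' : (N : ℝ) ≤ 12 * (G * k) := by exact_mod_cast hGk
  have he : Real.exp 1 < 2.72 := by have := Real.exp_one_lt_d9; linarith
  have he0 : 0 < Real.exp 1 := Real.exp_pos 1
  have hek : Real.exp 1 * B ≤ k := by
    have := mul_le_mul_of_nonneg_right he.le hB0.le
    linarith only [this, hKk', hKB', hB0]
  have hrun : ∀ σ : Fin G → Equiv.Perm (Fin k), ∃ ops : List (EMOp P.size),
      (initial P.size B).AllowedSeq M B ops ∧ ops.length ≤ T ∧
        H.Resolved σ (initial P.size B) ops := by
    intro σ
    obtain ⟨I, hI, hres⟩ := hH A hA σ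
    exact ⟨A.ops I, (hA I).1, Nat.le_floor (hlt I hI).le, hres⟩
  rcases H.lower_bound hB (by omega) T hk12 hek hrun with h | h
  · have hk33 : (33 : ℝ) ≤ k := by linarith [show (1 : ℝ) ≤ B by exact_mod_cast hB]
    have h1 : (k : ℝ) / 24 ≤ (k : ℝ) / 12 - 1 := by linarith
    have h2 : (G : ℝ) * ((k : ℝ) / 24) ^ 2 ≤ 2 * B * M * T :=
      le_trans (by gcongr) h
    have h3 : (N : ℝ) * K ≤ 12 * (G * k) * (3 * k) := by gcongr
    have h4 : (N : ℝ) * K ≤ 41472 * (B * M * T) := by linarith only [h2, h3]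
    have h5 : l = Real.log ((K : ℝ) / M) + L := by
      rw [hl, hL, ← Real.log_mul (by positivity) (by positivity)]
      congr 1
      field_simp
    have h6 : Real.log ((K : ℝ) / M) ≤ (K : ℝ) / M - 1 := Real.log_le_sub_one_of_pos (by positivity)
    have h7 : 1 ≤ (K : ℝ) / M := by rwa [le_div_iff₀ hM0, one_mul]
    -- From `log (K / M) ≤ K / M - 1` and `L ≥ 0.69`: the bound from crossings grows linearly in `K
    -- / M`, the sorting bound only logarithmically.
    have h8 : l / L ≤ 1.5 * ((K : ℝ) / M) := by
      rw [div_le_iff₀ hLpos]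
      have h9 := mul_le_mul_of_nonneg_right hL0
        (by linarith only [h7] : 0 ≤ 1.5 * ((K : ℝ) / M) - 1)
      linarith only [h5, h6, h7, h9]
    have h9 : b ≤ (N : ℝ) / B * (1.5 * ((K : ℝ) / M)) := by rw [hbdef]; gcongr
    have h10 : (N : ℝ) / B * (1.5 * ((K : ℝ) / M)) = 1.5 * (N * K / (B * M)) := by
      field_simp
    have h11 : (N : ℝ) * K / (B * M) ≤ 41472 * T := by
      rw [div_le_iff₀ (by positivity)]; linarith
    have h12 : (0 : ℝ) < N * K / (B * M) := by positivity
    linarith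
  · have hZ := weight_bound hB hM hsize hTN hN2
    have hlogZ := log_weight_bound hB hM hN2 hlogN
    set Z := (5 * (N : ℝ)) * (Real.exp B * (2 * ((M : ℝ) / B)) ^ B) * ((M : ℝ) / B) ^ B with hZdef
    have hZ0 : 0 < Z := by positivity
    rw [← hL] at hlogZ
    clear_value Z L l b T
    have hk0 : (0 : ℝ) < k := by exact_mod_cast (by omega : 0 < k)
    have h1 : ((k : ℝ) / (Real.exp 1 * B)) ^ (G * k / 2) ≤ Z ^ T :=
      h.trans (pow_le_pow_left₀ (by positivity) hZ T)
    have h2 := Real.log_le_log (by positivity) h1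
    rw [Real.log_pow, Real.log_pow] at h2
    have h3 : l ≤ 2 * Real.log ((k : ℝ) / (Real.exp 1 * B)) :=
      hl ▸ log_div_le_two_mul hB0 hKk' hKB'
    have h4 : (N : ℝ) ≤ 36 * ((G * k / 2 : ℕ) : ℝ) := by
      have : N ≤ 36 * (G * k / 2) := by omega
      exact_mod_cast this
    have h5 : (N : ℝ) * l ≤ 72 * (14 * (T * (B * L))) := by
      have h6 : (T : ℝ) * Real.log Z ≤ T * (14 * (B * L)) := by gcongr
      have h7 : (N : ℝ) * l ≤ 36 * ((G * k / 2 : ℕ) : ℝ) *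
          (2 * Real.log ((k : ℝ) / (Real.exp 1 * B))) := by gcongr
      linarith only [h2, h6, h7]
    have h6 : b ≤ 1008 * T := by
      rw [hbdef, div_mul_div_comm, div_le_iff₀ (by positivity)]
      linarith only [h5]
    linarith only [h6, hTb, hb0]

end RecordProblem

/-! ### Operations on systems of doubly linked lists -/

namespace DoublyLinked

variable {n : ℕ}

/-- Replace the successor of `i` by the successor of `ρ i`. -/
def reroute (D : DoublyLinked n) (ρ : Equiv.Perm (Fin n)) : DoublyLinked n where
  succ i := D.succ (ρ i)
  pred j := (D.pred j).map ρ.symm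
  succ_iff_pred i j := by
    rw [D.succ_iff_pred, Option.map_eq_some_iff]
    constructor
    · exact fun h => ⟨_, h, ρ.symm_apply_apply i⟩
    · rintro ⟨a, h, rfl⟩
      rw [h, ρ.apply_symm_apply]

/-- Keep only the links that lead to larger numbers. -/
def toMonotonic (D : DoublyLinked n) : MonotonicLists n where
  succ i := (D.succ i).filter fun j => i < j
  pred j := (D.pred j).filter fun i => i < j
  succ_iff_pred i j := by
    simp only [Option.filter_eq_some_iff, D.succ_iff_pred]
  mono i j h := by
    simpa using (Option.filter_eq_some_iff.1 h).2

/-- The list that visits the nodes in the order `e`. -/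
def ofOrder (e : Equiv.Perm (Fin n)) : DoublyLinked n where
  succ i := if h : (e.symm i).val + 1 < n then some (e ⟨(e.symm i).val + 1, h⟩) else none
  pred j := if 0 < (e.symm j).val then
    some (e ⟨(e.symm j).val - 1, (Nat.sub_le _ _).trans_lt (e.symm j).isLt⟩) else none
  succ_iff_pred i j := by
    have hi := (e.symm i).isLt
    have hj := (e.symm j).isLt
    simp only [Option.dite_none_right_eq_some, Option.ite_none_right_eq_some, Option.some.injEq,
      ← Equiv.eq_symm_apply, Fin.ext_iff]
    constructor
    · rintro ⟨h1, h2⟩; omega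
    · rintro ⟨h1, h2⟩; exact ⟨by omega, by omega⟩

theorem link_reroute {D : DoublyLinked n} {ρ : Equiv.Perm (Fin n)} {i j : Fin n} :
    (D.reroute ρ).Link i j ↔ D.Link (ρ i) j := Iff.rfl

theorem link_toMonotonic {D : DoublyLinked n} {i j : Fin n} :
    D.toMonotonic.Link i j ↔ D.Link i j ∧ i < j := by
  simp [Link, toMonotonic, Option.filter_eq_some_iff]

theorem link_ofOrder {e : Equiv.Perm (Fin n)} {i j : Fin n} :
    (ofOrder e).Link i j ↔ (e.symm i).val + 1 = (e.symm j).val := by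
  have hj := (e.symm j).isLt
  simp only [Link, ofOrder, Option.dite_none_right_eq_some, Option.some.injEq,
    ← Equiv.eq_symm_apply, Fin.ext_iff]
  constructor
  · rintro ⟨h1, h2⟩; omega
  · intro h; exact ⟨by omega, by omega⟩

theorem Link.pred_eq {D : DoublyLinked n} {i j : Fin n} (h : D.Link i j) : D.pred j = some i :=
  (D.succ_iff_pred i j).1 h

theorem pred_eq_none_iff {D : DoublyLinked n} {j : Fin n} :
    D.pred j = none ↔ ∀ i, ¬ D.Link i j := by
  simp only [Link, D.succ_iff_pred, Option.eq_none_iff_forall_ne_some, ne_eq]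

theorem succ_eq_none_iff {D : DoublyLinked n} {i : Fin n} :
    D.succ i = none ↔ ∀ j, ¬ D.Link i j := by
  simp only [Link, Option.eq_none_iff_forall_ne_some, ne_eq]

theorem nulls_eq_iff {D D' : DoublyLinked n} {i : Fin n} : D.nulls i = D'.nulls i ↔
    ((∃ h, D.Link h i) ↔ ∃ h, D'.Link h i) ∧ ((∃ j, D.Link i j) ↔ ∃ j, D'.Link i j) := by
  have h1 : ∀ (a b : Option (Fin n)), a.isNone = b.isNone ↔ (a = none ↔ b = none) := by
    intro a b
    cases a <;> cases b <;> simp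
  rw [nulls, nulls, Prod.mk.injEq, h1, h1, pred_eq_none_iff, pred_eq_none_iff, succ_eq_none_iff,
    succ_eq_none_iff, ← not_exists, ← not_exists, ← not_exists, ← not_exists, not_iff_not,
    not_iff_not]

theorem Link.unique_left {D : DoublyLinked n} {i i' j : Fin n} (h : D.Link i j)
    (h' : D.Link i' j) : i = i' :=
  Option.some.inj (h.pred_eq.symm.trans h'.pred_eq)

theorem Link.unique_right {D : DoublyLinked n} {i j j' : Fin n} (h : D.Link i j)
    (h' : D.Link i j') : j = j' :=
  Option.some.inj (Eq.symm (h : D.succ i = some j) |>.trans h')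

theorem IsFirstOf.tail {D : DoublyLinked n} {h i j : Fin n} (hi : D.IsFirstOf h i)
    (hij : D.Link i j) : D.IsFirstOf h j :=
  ⟨hi.1, hi.2.tail hij⟩

theorem IsFirstOf.unique {D : DoublyLinked n} {h h' v : Fin n} (hv : D.IsFirstOf h v)
    (hv' : D.IsFirstOf h' v) : h = h' := by
  obtain ⟨hn, hr⟩ := hv
  induction hr with
  | refl =>
    rcases hv'.2.cases_tail with h1 | ⟨c, -, h1⟩
    · exact h1
    · exact absurd h1 (pred_eq_none_iff.1 hn c)
  | tail hab hbc ih =>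
    rcases hv'.2.cases_tail with h1 | ⟨c, h1, h2⟩
    · rw [← h1] at hv'
      exact absurd hbc (pred_eq_none_iff.1 hv'.1 _)
    · exact ih ⟨hv'.1, by rwa [hbc.unique_left h2]⟩

theorem isFirstOf_ofOrder (hn : 0 < n) (e : Equiv.Perm (Fin n)) (v : Fin n) :
    (ofOrder e).IsFirstOf (e ⟨0, hn⟩) v := by
  refine ⟨pred_eq_none_iff.2 fun i hi => by simp [link_ofOrder] at hi, ?_⟩
  have h : ∀ p (hp : p < n), Relation.ReflTransGen (ofOrder e).Link (e ⟨0, hn⟩) (e ⟨p, hp⟩) := by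
    intro p
    induction p with
    | zero => exact fun _ => .refl
    | succ p ih => exact fun hp => (ih (by omega)).tail (by simp [link_ofOrder])
  simpa using h (e.symm v) (e.symm v).isLt

/-- The single list that visits the nodes in the order `e`. -/
def singleOfOrder (hn : 0 < n) (e : Equiv.Perm (Fin n)) : SingleList n where
  toDoublyLinked := ofOrder e
  single := ⟨_, isFirstOf_ofOrder hn e⟩

end DoublyLinked

/-! ### Lists that pass through layers -/

/-- A list on `N` nodes makes a number of passes, each of which visits one node of every layer;
then it visits the `rest` first nodes, of which it visits the `desc` first in descending order. -/
structure ListShape (N : ℕ) where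
  passes : ℕ
  layers : ℕ
  rest : ℕ
  desc : ℕ
  eq_add : N = passes * layers + rest
  two_le_layers : 2 ≤ layers
  one_le_desc : 1 ≤ desc
  desc_le_rest : desc ≤ rest

namespace ListShape

variable {N : ℕ} (S : ListShape N) (τ : ℕ → Equiv.Perm (Fin S.passes))

theorem pos (S : ListShape N) : 0 < N := by
  have h1 := S.eq_add
  have h2 := S.one_le_desc
  have h3 := S.desc_le_rest
  omega

theorem div_lt {p : ℕ} (h : p < S.passes * S.layers) : p / S.layers < S.passes :=
  Nat.div_lt_of_lt_mul (by rwa [Nat.mul_comm])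

/-- The node at position `p`; the pass `t` visits the node `τ l t` of layer `l`. -/
def node (p : ℕ) : ℕ :=
  if h : p < S.passes * S.layers then
    S.rest + S.passes * (p % S.layers) + τ (p % S.layers) ⟨p / S.layers, S.div_lt h⟩
  else if p - S.passes * S.layers < S.desc then S.desc - 1 - (p - S.passes * S.layers)
  else p - S.passes * S.layers

theorem node_lt {p : ℕ} (hp : p < N) : S.node τ p < N := by
  have h1 := S.eq_add
  have h3 := S.desc_le_rest
  have h4 := S.two_le_layers
  rw [node]
  split_ifs with h h'
  · have h5 := (τ (p % S.layers) ⟨p / S.layers, S.div_lt h⟩).isLt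
    have h6 : p % S.layers + 1 ≤ S.layers := Nat.mod_lt _ (by omega)
    have h7 := Nat.mul_le_mul_left S.passes h6
    rw [Nat.mul_add] at h7
    omega
  · omega
  · omega

theorem node_of_lt {p : ℕ} (h : p < S.passes * S.layers) :
    S.node τ p = S.rest + S.passes * (p % S.layers) + τ (p % S.layers) ⟨p / S.layers, S.div_lt h⟩ :=
  dif_pos h

theorem node_of_ge {p : ℕ} (h : S.passes * S.layers ≤ p) :
    S.node τ p = if p - S.passes * S.layers < S.desc then S.desc - 1 - (p - S.passes * S.layers)
      else p - S.passes * S.layers :=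
  dif_neg h.not_gt

theorem node_lt_rest_iff {p : ℕ} (hp : p < N) :
    S.node τ p < S.rest ↔ S.passes * S.layers ≤ p := by
  have h1 := S.eq_add
  have h3 := S.desc_le_rest
  have h4 := S.one_le_desc
  rcases lt_or_ge p (S.passes * S.layers) with h | h
  · rw [S.node_of_lt τ h]
    omega
  · rw [S.node_of_ge τ h]
    split_ifs <;> omega

theorem node_injOn {p q : ℕ} (hp : p < N) (hq : q < N) (h : S.node τ p = S.node τ q) : p = q := by
  have h1 := S.node_lt_rest_iff τ hp
  have h2 := S.node_lt_rest_iff τ hq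
  rw [h] at h1
  rcases lt_or_ge p (S.passes * S.layers) with hp' | hp'
  · have hq' : q < S.passes * S.layers := by omega
    rw [S.node_of_lt τ hp', S.node_of_lt τ hq'] at h
    set a := τ (p % S.layers) ⟨p / S.layers, S.div_lt hp'⟩ with ha
    set b := τ (q % S.layers) ⟨q / S.layers, S.div_lt hq'⟩ with hb
    have h3 : S.passes * (p % S.layers) + a = S.passes * (q % S.layers) + b := by omega
    have hk : 0 < S.passes := Nat.pos_of_ne_zero fun h0 => by simp [h0] at hp'
    have h4 := congrArg (· / S.passes) h3
    simp only [Nat.mul_add_div hk, Nat.div_eq_of_lt a.isLt, Nat.div_eq_of_lt b.isLt,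
      Nat.add_zero] at h4
    rw [h4] at h3 ha
    have h5 : a = b := Fin.ext (by omega)
    rw [ha, hb] at h5
    have h6 := Fin.mk.inj ((τ _).injective h5)
    rw [← Nat.div_add_mod p S.layers, ← Nat.div_add_mod q S.layers, h4, h6]
  · have hq' : S.passes * S.layers ≤ q := by omega
    rw [S.node_of_ge τ hp', S.node_of_ge τ hq'] at h
    split_ifs at h <;> omega

/-- The order in which the nodes are visited. -/
noncomputable def order : Equiv.Perm (Fin N) :=
  Equiv.ofBijective (fun p => ⟨S.node τ p, S.node_lt τ p.isLt⟩)
    (Finite.injective_iff_bijective.1 fun p q h =>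
      Fin.ext (S.node_injOn τ p.isLt q.isLt (Fin.mk.inj h)))

theorem val_order (p : Fin N) : (S.order τ p).val = S.node τ p := rfl

/-- A descending link leads to position `p`, or `p` is the first position. -/
def IsHead (p : ℕ) : Prop :=
  (p < S.passes * S.layers ∧ S.layers ∣ p) ∨
    (S.passes * S.layers ≤ p ∧ p < S.passes * S.layers + S.desc)

theorem isHead_zero : S.IsHead 0 := by
  rcases Nat.eq_zero_or_pos (S.passes * S.layers) with h | h
  · exact .inr ⟨h.le, by have := S.one_le_desc; omega⟩
  · exact .inl ⟨h, dvd_zero _⟩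

/-- A step within a pass goes up one layer. The step from the last layer to the first descends
because there are at least two layers; the step into the rest descends because the rest has the
smallest numbers. -/
theorem node_lt_node_succ_iff {p : ℕ} (hp : p + 1 < N) :
    S.node τ p < S.node τ (p + 1) ↔ ¬ S.IsHead (p + 1) := by
  have h1 := S.eq_add
  have h2 := S.two_le_layers
  have h3 := S.desc_le_rest
  have h4 := S.one_le_desc
  unfold IsHead
  rcases lt_or_ge p (S.passes * S.layers) with h | h
  · have hk : 0 < S.passes := Nat.pos_of_ne_zero fun h0 => by simp [h0] at h
    rw [S.node_of_lt τ h]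
    set a := τ (p % S.layers) ⟨p / S.layers, S.div_lt h⟩
    have ha := a.isLt
    rcases lt_or_ge (p + 1) (S.passes * S.layers) with h' | h'
    · rw [S.node_of_lt τ h']
      set b := τ ((p + 1) % S.layers) ⟨(p + 1) / S.layers, S.div_lt h'⟩
      have hb := b.isLt
      have h5 := Nat.div_add_mod p S.layers
      have h6 := Nat.div_add_mod (p + 1) S.layers
      by_cases hd : S.layers ∣ p + 1
      · rw [Nat.succ_div_of_dvd hd, Nat.mod_eq_zero_of_dvd hd, Nat.mul_add] at h6
        have h7 : p % S.layers = S.layers - 1 := by omega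
        have h8 : S.passes * 1 ≤ S.passes * (p % S.layers) := Nat.mul_le_mul_left _ (by omega)
        simp only [Nat.mod_eq_zero_of_dvd hd, hd, h', and_self, true_or, not_true_eq_false,
          iff_false, not_lt]
        omega
      · rw [Nat.succ_div_of_not_dvd hd] at h6
        have h7 : (p + 1) % S.layers = p % S.layers + 1 := by omega
        have h8 : S.passes * ((p + 1) % S.layers) = S.passes * (p % S.layers) + S.passes := by
          rw [h7, Nat.mul_add, Nat.mul_one]
        simp only [hd, and_false, false_or, h'.not_ge, false_and, not_false_eq_true, iff_true]
        omega
    · rw [S.node_of_ge τ h']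
      have : ¬ (p + 1 < S.passes * S.layers) := by omega
      simp only [this, false_and, false_or]
      split_ifs <;> omega
  · rw [S.node_of_ge τ h, S.node_of_ge τ (by omega)]
    have : ¬ (p + 1 < S.passes * S.layers) := by omega
    simp only [this, false_and, false_or]
    split_ifs <;> omega

theorem order_link_lt_iff {i j : Fin N} (h : (DoublyLinked.ofOrder (S.order τ)).Link i j) :
    i < j ↔ ¬ S.IsHead ((S.order τ).symm j) := by
  rw [DoublyLinked.link_ofOrder] at h
  have hj := ((S.order τ).symm j).isLt
  have h1 : ∀ i, i.val = S.node τ ((S.order τ).symm i) := fun i => by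
    rw [← val_order, Equiv.apply_symm_apply]
  rw [Fin.lt_def, h1 i, h1 j, ← h]
  exact S.node_lt_node_succ_iff τ (by omega)

/-- Only the links to larger numbers. -/
noncomputable def monotonicLists : MonotonicLists N :=
  (DoublyLinked.ofOrder (S.order τ)).toMonotonic

/-- All links. -/
noncomputable def singleList : SingleList N :=
  DoublyLinked.singleOfOrder S.pos (S.order τ)

theorem link_monotonicLists {i j : Fin N} : (S.monotonicLists τ).Link i j ↔
    ((S.order τ).symm i).val + 1 = ((S.order τ).symm j).val ∧
      ¬ S.IsHead ((S.order τ).symm j) := by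
  rw [monotonicLists, DoublyLinked.link_toMonotonic]
  constructor
  · exact fun h => ⟨DoublyLinked.link_ofOrder.1 h.1, (S.order_link_lt_iff τ h.1).1 h.2⟩
  · intro h
    have h' := DoublyLinked.link_ofOrder.2 h.1
    exact ⟨h', (S.order_link_lt_iff τ h').2 h.2⟩

theorem link_singleList {i j : Fin N} : (S.singleList τ).Link i j ↔
    ((S.order τ).symm i).val + 1 = ((S.order τ).symm j).val :=
  DoublyLinked.link_ofOrder

theorem ncard_order_preimage (A : Finset ℕ) (hA : ∀ p ∈ A, p < N) :
    {i : Fin N | ((S.order τ).symm i).val ∈ A}.ncard = A.card := by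
  rw [← Set.ncard_coe_finset A]
  refine Set.ncard_congr (fun i _ => ((S.order τ).symm i).val) (fun i hi => hi) ?_ ?_
  · intro i j _ _ h
    exact (S.order τ).symm.injective (Fin.ext h)
  · intro p hp
    exact ⟨S.order τ ⟨p, hA p hp⟩, by simpa using hp, by simp⟩

theorem mul_layers_lt {t : ℕ} (ht : t < S.passes) :
    t * S.layers + S.layers ≤ S.passes * S.layers := by
  have := Nat.mul_le_mul_right S.layers (Nat.succ_le_of_lt ht)
  rwa [Nat.succ_mul] at this

/-- Dropping the descending links cuts the list before each pass and before each of the first `desc`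
nodes of the rest. -/
theorem numHeads_monotonicLists : (S.monotonicLists τ).numHeads = S.passes + S.desc := by
  have h1 := S.eq_add
  have h2 := S.two_le_layers
  have h3 := S.desc_le_rest
  let A : Finset ℕ := (Finset.range S.passes).image (· * S.layers) ∪
    Finset.Ico (S.passes * S.layers) (S.passes * S.layers + S.desc)
  have hA : ∀ p, p ∈ A ↔ S.IsHead p := by
    intro p
    simp only [A, IsHead, Finset.mem_union, Finset.mem_image, Finset.mem_range, Finset.mem_Ico]
    refine or_congr ⟨?_, ?_⟩ Iff.rfl
    · rintro ⟨t, ht, rfl⟩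
      have := S.mul_layers_lt ht
      exact ⟨by omega, dvd_mul_left _ _⟩
    · rintro ⟨hp, t, rfl⟩
      refine ⟨t, ?_, Nat.mul_comm _ _⟩
      rw [Nat.mul_comm] at hp
      exact lt_of_mul_lt_mul_right hp (Nat.zero_le _)
  have hcard : A.card = S.passes + S.desc := by
    rw [Finset.card_union_of_disjoint, Finset.card_image_of_injective, Finset.card_range,
      Nat.card_Ico, Nat.add_sub_cancel_left]
    · exact fun a b h => Nat.eq_of_mul_eq_mul_right (by omega) h
    · rw [Finset.disjoint_left]
      intro p hp
      obtain ⟨t, ht, rfl⟩ := Finset.mem_image.1 hp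
      have := S.mul_layers_lt (Finset.mem_range.1 ht)
      simp only [Finset.mem_Ico]
      omega
  rw [← hcard, ← S.ncard_order_preimage τ A, DoublyLinked.numHeads]
  · congr 1
    ext i
    simp only [Set.mem_ofPred_eq, hA, DoublyLinked.pred_eq_none_iff, link_monotonicLists]
    constructor
    · intro h
      by_contra hi
      rcases Nat.eq_zero_or_pos ((S.order τ).symm i).val with h0 | h0
      · exact hi (h0 ▸ S.isHead_zero)
      · refine h (S.order τ ⟨((S.order τ).symm i).val - 1, by omega⟩) ⟨?_, hi⟩
        rw [Equiv.symm_apply_apply]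
        exact Nat.sub_add_cancel h0
    · exact fun h j hj => hj.2 h
  · intro p hp
    simp only [A, Finset.mem_union, Finset.mem_image, Finset.mem_range, Finset.mem_Ico] at hp
    rcases hp with ⟨t, ht, rfl⟩ | hp
    · have := S.mul_layers_lt ht
      omega
    · omega

/-- A stretch starts where the direction changes. Position `0` counts as a head, although nothing
leads to it, so `hS` is needed to ensure that the first link, if there is one, ascends. -/
theorem stretchStart_singleList_iff (hS : 1 ≤ S.passes ∨ S.desc = 1) (i : Fin N) :
    (S.singleList τ).StretchStart i ↔ ((S.order τ).symm i).val + 1 < N ∧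
      (¬ S.IsHead ((S.order τ).symm i) ↔ S.IsHead (((S.order τ).symm i).val + 1)) := by
  have h1 := S.eq_add
  have h2 := S.two_le_layers
  set p := ((S.order τ).symm i).val with hp
  have hpN : p < N := ((S.order τ).symm i).isLt
  have hlink : ∀ hp1 : p + 1 < N, (S.singleList τ).Link i (S.order τ ⟨p + 1, hp1⟩) :=
    fun hp1 => by rw [link_singleList, Equiv.symm_apply_apply]
  constructor
  · rintro ⟨j, hij, h⟩
    have hij' := hij
    rw [link_singleList, ← hp] at hij'
    have hj := ((S.order τ).symm j).isLt
    refine ⟨by omega, ?_⟩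
    rcases Nat.eq_zero_or_pos p with h0 | h0
    · rw [h0]
      refine iff_of_false (not_not_intro S.isHead_zero) ?_
      rintro (⟨-, h4⟩ | ⟨h4, h5⟩)
      · have := Nat.le_of_dvd one_pos h4
        omega
      · rcases hS with h6 | h6
        · have := Nat.mul_le_mul h6 h2
          omega
        · have : S.passes = 0 := by
            by_contra h7
            have := Nat.mul_le_mul (Nat.one_le_iff_ne_zero.2 h7) h2
            omega
          simp only [this] at h5
          omega
    · have hl : (S.singleList τ).Link (S.order τ ⟨p - 1, by omega⟩) i := by
        rw [link_singleList, Equiv.symm_apply_apply]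
        exact Nat.sub_add_cancel h0
      have h4 := h _ hl
      rw [S.order_link_lt_iff τ hl, S.order_link_lt_iff τ hij, not_not, ← hij'] at h4
      exact h4
  · rintro ⟨hp1, h⟩
    refine ⟨_, hlink hp1, fun j hj => ?_⟩
    rw [S.order_link_lt_iff τ hj, S.order_link_lt_iff τ (hlink hp1), not_not,
      Equiv.symm_apply_apply]
    exact h

/-- Each pass is a forward stretch, followed by a backward one. The backward stretch after the last
pass continues through the first `desc` nodes of the rest; a final forward stretch follows iff nodes
remain. -/
theorem numStretches_singleList (hS : 1 ≤ S.passes ∨ S.desc = 1) :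
    (S.singleList τ).numStretches = 2 * S.passes + if S.desc < S.rest then 1 else 0 := by
  have h1 := S.eq_add
  have h2 := S.two_le_layers
  have h3 := S.desc_le_rest
  have h4 := S.one_le_desc
  let A : Finset ℕ := (Finset.range S.passes).image (· * S.layers) ∪
    (Finset.range S.passes).image (fun t => t * S.layers + (S.layers - 1))
  let C : Finset ℕ := if S.desc < S.rest then {S.passes * S.layers + S.desc - 1} else ∅
  have hAlt : ∀ p ∈ A, p < S.passes * S.layers := by
    intro p hp
    simp only [A, Finset.mem_union, Finset.mem_image, Finset.mem_range] at hp
    rcases hp with ⟨t, ht, rfl⟩ | ⟨t, ht, rfl⟩ <;>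
    · have := S.mul_layers_lt ht
      omega
  have hCge : ∀ p ∈ C, S.passes * S.layers ≤ p := by
    intro p hp
    simp only [C] at hp
    split_ifs at hp
    · rw [Finset.mem_singleton.1 hp]; omega
    · simp at hp
  have hcard : (A ∪ C).card = 2 * S.passes + if S.desc < S.rest then 1 else 0 := by
    rw [Finset.card_union_of_disjoint, Finset.card_union_of_disjoint,
      Finset.card_image_of_injective, Finset.card_image_of_injective, Finset.card_range, ← two_mul]
    · congr 1
      simp only [C]
      split_ifs <;> simp
    · exact fun a b h => Nat.eq_of_mul_eq_mul_right (by omega) (Nat.add_right_cancel h)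
    · exact fun a b h => Nat.eq_of_mul_eq_mul_right (by omega) h
    · rw [Finset.disjoint_left]
      intro p hp hp'
      obtain ⟨t, ht, rfl⟩ := Finset.mem_image.1 hp
      obtain ⟨u, hu, h⟩ := Finset.mem_image.1 hp'
      have h5 := congrArg (· % S.layers) h
      simp only [Nat.mul_add_mod_self_right, Nat.mul_mod_left] at h5
      rw [Nat.mod_eq_of_lt (by omega)] at h5
      omega
    · rw [Finset.disjoint_left]
      exact fun p hp hp' => (hAlt p hp).not_ge (hCge p hp')
  rw [← hcard, ← S.ncard_order_preimage τ (A ∪ C), DoublyLinked.numStretches]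
  · congr 1
    ext i
    simp only [Set.mem_ofPred_eq, S.stretchStart_singleList_iff τ hS]
    set p := ((S.order τ).symm i).val with hp
    have hpN : p < N := ((S.order τ).symm i).isLt
    rcases lt_or_ge p (S.passes * S.layers) with h | h
    · have hC : p ∉ C := fun h' => (hCge p h').not_gt h
      have hhead : S.IsHead p ↔ S.layers ∣ p := by
        simp only [IsHead, h, true_and, h.not_ge, false_and, or_false]
      have hhead' : S.IsHead (p + 1) ↔ S.layers ∣ p + 1 := by
        simp only [IsHead]
        constructor
        · rintro (h' | h')
          · exact h'.2
          · have : p + 1 = S.passes * S.layers := by omega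
            exact this ▸ dvd_mul_left _ _
        · intro h'
          rcases lt_or_ge (p + 1) (S.passes * S.layers) with h5 | h5
          · exact .inl ⟨h5, h'⟩
          · exact .inr ⟨h5, by omega⟩
      rw [hhead, hhead', Finset.mem_union, or_iff_left hC]
      simp only [A, Finset.mem_union, Finset.mem_image, Finset.mem_range]
      have h5 := Nat.div_add_mod p S.layers
      have h6 := S.div_lt h
      rw [Nat.mul_comm] at h5
      constructor
      · rintro ⟨-, h7⟩
        by_cases h8 : S.layers ∣ p
        · left
          exact ⟨p / S.layers, h6, Nat.div_mul_cancel h8⟩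
        · right
          have h9 := h7.1 h8
          have h10 := Nat.div_add_mod (p + 1) S.layers
          rw [Nat.succ_div_of_dvd h9, Nat.mod_eq_zero_of_dvd h9, Nat.mul_comm, Nat.add_mul] at h10
          exact ⟨p / S.layers, h6, by omega⟩
      · intro h7
        refine ⟨by omega, ?_⟩
        rcases h7 with ⟨t, ht, h7⟩ | ⟨t, ht, h7⟩
        · have h8 : S.layers ∣ p := h7 ▸ dvd_mul_left _ _
          refine iff_of_false (not_not_intro h8) fun h9 => ?_
          have := Nat.le_of_dvd one_pos ((Nat.dvd_add_right h8).1 h9)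
          omega
        · have h8 : S.layers ∣ p + 1 := by
            refine ⟨t + 1, ?_⟩
            rw [← h7, Nat.mul_comm S.layers, Nat.add_mul]
            omega
          refine iff_of_true (fun h9 => ?_) h8
          have := Nat.le_of_dvd one_pos ((Nat.dvd_add_right h9).1 h8)
          omega
    · have hA : p ∉ A := fun h' => (hAlt p h').not_ge h
      rw [Finset.mem_union, or_iff_right hA]
      simp only [IsHead, C]
      have h5 : ¬ p < S.passes * S.layers := by omega
      have h6 : ¬ p + 1 < S.passes * S.layers := by omega
      simp only [h5, h6, false_and, false_or]
      split_ifs <;> simp <;> omega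
  · intro p hp
    rcases Finset.mem_union.1 hp with hp | hp
    · have := hAlt p hp
      omega
    · simp only [C] at hp
      split_ifs at hp
      · rw [Finset.mem_singleton.1 hp]; omega
      · simp at hp

end ListShape

/-! ### Exchanging links -/

namespace DoublyLinked

variable {n : ℕ}

/-- Exchanging the ends of two links of a monotonic system. -/
theorem exists_exchange (I : MonotonicLists n) {a a' b b' : Fin n} (ha : I.Link a a')
    (hb : I.Link b b') (hab : a < b') (hba : b < a') :
    ∃ J : MonotonicLists n, J.Link a b' ∧ (∀ i, J.nulls i = I.nulls i) ∧
      ∀ i j, (J.Link i j ↔ I.Link i j) ∨ (i = a ∧ (j = a' ∨ j = b')) ∨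
        (i = b ∧ (j = a' ∨ j = b')) := by
  have hJ : ∀ i j, (I.reroute (Equiv.swap a b)).toMonotonic.Link i j ↔
      I.Link (Equiv.swap a b i) j ∧ i < j := fun i j => by rw [link_toMonotonic, link_reroute]
  have h1 : (I.reroute (Equiv.swap a b)).toMonotonic.Link a b' := by
    rw [hJ, Equiv.swap_apply_left]; exact ⟨hb, hab⟩
  have h2 : (I.reroute (Equiv.swap a b)).toMonotonic.Link b a' := by
    rw [hJ, Equiv.swap_apply_right]; exact ⟨ha, hba⟩
  have h3 : ∀ i j, i ≠ a → i ≠ b →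
      ((I.reroute (Equiv.swap a b)).toMonotonic.Link i j ↔ I.Link i j) := fun i j hia hib => by
    rw [hJ, Equiv.swap_apply_of_ne_of_ne hia hib]
    exact ⟨fun h => h.1, fun h => ⟨h, I.mono _ _ h⟩⟩
  refine ⟨_, h1, fun i => nulls_eq_iff.2 ⟨⟨?_, ?_⟩, ?_, ?_⟩, fun i j => ?_⟩
  · rintro ⟨h, hh⟩
    exact ⟨_, ((hJ _ _).1 hh).1⟩
  · rintro ⟨h, hh⟩
    by_cases hha : h = a
    · subst hha
      exact ⟨b, ha.unique_right hh ▸ h2⟩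
    by_cases hhb : h = b
    · subst hhb
      exact ⟨a, hb.unique_right hh ▸ h1⟩
    exact ⟨h, (h3 h i hha hhb).2 hh⟩
  · rintro ⟨j, hj⟩
    by_cases hia : i = a
    · exact ⟨a', hia ▸ ha⟩
    by_cases hib : i = b
    · exact ⟨b', hib ▸ hb⟩
    exact ⟨j, (h3 i j hia hib).1 hj⟩
  · rintro ⟨j, hj⟩
    by_cases hia : i = a
    · exact ⟨b', hia ▸ h1⟩
    by_cases hib : i = b
    · exact ⟨a', hib ▸ h2⟩
    exact ⟨j, (h3 i j hia hib).2 hj⟩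
  · by_cases hia : i = a
    · subst hia
      by_cases hj : j = a' ∨ j = b'
      · exact .inr (.inl ⟨rfl, hj⟩)
      push Not at hj
      left
      refine iff_of_false (fun h => hj.2 (h.unique_right h1)) (fun h => hj.1 (h.unique_right ha))
    by_cases hib : i = b
    · subst hib
      by_cases hj : j = a' ∨ j = b'
      · exact .inr (.inr ⟨rfl, hj⟩)
      push Not at hj
      left
      refine iff_of_false (fun h => hj.1 (h.unique_right h2)) (fun h => hj.2 (h.unique_right hb))
    exact .inl (h3 i j hia hib)

/-- Bypassing a node of a monotonic system. -/
theorem exists_bypass (I : MonotonicLists n) {u v w : Fin n} (huv : I.Link u v)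
    (hvw : I.Link v w) :
    ∃ J : MonotonicLists n, J.Link u w ∧ J.IsFirstOf v v ∧
      (∀ i, i ≠ v → i ≠ w → J.nulls i = I.nulls i) ∧
      ∀ i j, i ≠ v → j ≠ v → j ≠ w → (J.Link i j ↔ I.Link i j) := by
  have hJ : ∀ i j, (I.reroute (Equiv.swap u v)).toMonotonic.Link i j ↔
      I.Link (Equiv.swap u v i) j ∧ i < j := fun i j => by rw [link_toMonotonic, link_reroute]
  have h1 : (I.reroute (Equiv.swap u v)).toMonotonic.Link u w := by
    rw [hJ, Equiv.swap_apply_left]; exact ⟨hvw, (I.mono _ _ huv).trans (I.mono _ _ hvw)⟩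
  have h3 : ∀ i j, i ≠ u → i ≠ v →
      ((I.reroute (Equiv.swap u v)).toMonotonic.Link i j ↔ I.Link i j) := fun i j hia hib => by
    rw [hJ, Equiv.swap_apply_of_ne_of_ne hia hib]
    exact ⟨fun h => h.1, fun h => ⟨h, I.mono _ _ h⟩⟩
  have h4 : ∀ i j, i ≠ v → j ≠ v → j ≠ w →
      ((I.reroute (Equiv.swap u v)).toMonotonic.Link i j ↔ I.Link i j) := by
    intro i j hi hj hjw
    by_cases hiu : i = u
    · subst hiu
      exact iff_of_false (fun h => hjw (h.unique_right h1)) (fun h => hj (h.unique_right huv))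
    · exact h3 i j hiu hi
  -- Rerouting turns `v` into its own successor, and `toMonotonic` deletes this loop; `v` becomes a
  -- list of its own.
  have h5 : ∀ j, ¬ (I.reroute (Equiv.swap u v)).toMonotonic.Link v j := by
    intro j h
    rw [hJ, Equiv.swap_apply_right] at h
    rw [huv.unique_right h.1] at h
    exact lt_irrefl _ h.2
  have h6 : ∀ i, ¬ (I.reroute (Equiv.swap u v)).toMonotonic.Link i v := by
    intro i h
    have h' := ((hJ _ _).1 h).1.unique_left huv
    rw [Equiv.swap_apply_eq_iff, Equiv.swap_apply_left] at h'
    exact h5 v (h' ▸ h)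
  refine ⟨_, h1, ⟨pred_eq_none_iff.2 h6, .refl⟩, fun i hiv hiw =>
    nulls_eq_iff.2 ⟨⟨?_, ?_⟩, ?_, ?_⟩, h4⟩
  · rintro ⟨h, hh⟩
    exact ⟨_, ((hJ _ _).1 hh).1⟩
  · rintro ⟨h, hh⟩
    refine ⟨h, (h4 h i ?_ hiv hiw).2 hh⟩
    rintro rfl
    exact hiw (hh.unique_right hvw)
  · rintro ⟨j, hj⟩
    by_cases hiu : i = u
    · exact ⟨v, hiu ▸ huv⟩
    · exact ⟨j, (h3 i j hiu hiv).1 hj⟩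
  · rintro ⟨j, hj⟩
    by_cases hiu : i = u
    · exact ⟨w, hiu ▸ h1⟩
    · exact ⟨j, (h3 i j hiu hiv).2 hj⟩

/-- Exchanging two consecutive segments of a single list. -/
theorem exists_segment_exchange (hn : 0 < n) (e : Equiv.Perm (Fin n)) {a a' b b' c c' : Fin n}
    (ha : (ofOrder e).Link a a') (hb : (ofOrder e).Link b b') (hc : (ofOrder e).Link c c')
    (hab : e.symm a < e.symm b) (hbc : e.symm b < e.symm c) :
    ∃ J : SingleList n, J.Link a b' ∧ (∀ i, J.nulls i = (ofOrder e).nulls i) ∧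
      ∀ i j, (J.Link i j ↔ (ofOrder e).Link i j) ∨ (i = a ∧ (j = a' ∨ j = b')) ∨
        (i = b ∧ (j = b' ∨ j = c')) ∨ (i = c ∧ (j = c' ∨ j = a')) := by
  have hne_ab : a ≠ b := fun h => by simp [h] at hab
  have hne_bc : b ≠ c := fun h => by simp [h] at hbc
  have hne_ac : a ≠ c := fun h => by rw [h] at hab; exact lt_asymm hab hbc
  -- A 3-cycle is used because exchanging the ends of just two links would split off a cycle.
  set ρ := Equiv.swap a b * Equiv.swap b c with hρ
  have hρa : ρ a = b := by
    rw [hρ, Equiv.Perm.mul_apply, Equiv.swap_apply_of_ne_of_ne hne_ab hne_ac,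
      Equiv.swap_apply_left]
  have hρb : ρ b = c := by
    rw [hρ, Equiv.Perm.mul_apply, Equiv.swap_apply_left,
      Equiv.swap_apply_of_ne_of_ne hne_ac.symm hne_bc.symm]
  have hρc : ρ c = a := by
    rw [hρ, Equiv.Perm.mul_apply, Equiv.swap_apply_right, Equiv.swap_apply_right]
  have hρi : ∀ i, i ≠ a → i ≠ b → i ≠ c → ρ i = i := fun i h1 h2 h3 => by
    rw [hρ, Equiv.Perm.mul_apply, Equiv.swap_apply_of_ne_of_ne h2 h3,
      Equiv.swap_apply_of_ne_of_ne h1 h2]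
  have hJ : ∀ i j, ((ofOrder e).reroute ρ).Link i j ↔ (ofOrder e).Link (ρ i) j :=
    fun i j => link_reroute
  have h1 : ((ofOrder e).reroute ρ).Link a b' := (hJ _ _).2 (hρa ▸ hb)
  have h2 : ((ofOrder e).reroute ρ).Link b c' := (hJ _ _).2 (hρb ▸ hc)
  have h3 : ((ofOrder e).reroute ρ).Link c a' := (hJ _ _).2 (hρc ▸ ha)
  have h4 : ∀ i j, i ≠ a → i ≠ b → i ≠ c →
      (((ofOrder e).reroute ρ).Link i j ↔ (ofOrder e).Link i j) := fun i j ha hb hc => by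
    rw [hJ, hρi i ha hb hc]
  -- The new list runs from the start to `a`, from `b'` to `c`, from `a'` to `b`, and from `c'` to
  -- the end. Reachability is propagated along these four segments in this order.
  have hsingle : ∃ h, ∀ v, ((ofOrder e).reroute ρ).IsFirstOf h v := by
    have hpred : ((ofOrder e).reroute ρ).pred (e ⟨0, hn⟩) = none :=
      pred_eq_none_iff.2 fun i hi => by simp [hJ, link_ofOrder] at hi
    let R : Fin n → Prop := Relation.ReflTransGen ((ofOrder e).reroute ρ).Link (e ⟨0, hn⟩)
    have hstep : ∀ i j, ((ofOrder e).reroute ρ).Link i j → R i → R j := fun i j h hR => hR.tail h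
    have hrun : ∀ p q (hp : p < n) (hq : q < n), p ≤ q →
        (∀ r, p ≤ r → r < q → r ≠ (e.symm a).val ∧ r ≠ (e.symm b).val ∧ r ≠ (e.symm c).val) →
        R (e ⟨p, hp⟩) → R (e ⟨q, hq⟩) := by
      intro p q hp hq hpq
      induction q, hpq using Nat.le_induction with
      | base => exact fun _ h => h
      | succ q hpq ih =>
        intro hr hRp
        have hRq := ih (by omega) (fun r h5 h6 => hr r h5 (by omega)) hRp
        obtain ⟨h5, h6, h7⟩ := hr q hpq (by omega)
        have hne : ∀ z : Fin n, q ≠ (e.symm z).val → e ⟨q, by omega⟩ ≠ z := by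
          rintro z hz rfl
          simp at hz
        refine hstep _ _ ((h4 _ _ (hne a h5) (hne b h6) (hne c h7)).2 ?_) hRq
        simp [link_ofOrder]
    have hab' : (e.symm a).val < (e.symm b).val := hab
    have hbc' : (e.symm b).val < (e.symm c).val := hbc
    have hpos : ∀ z, R z ↔ R (e ⟨(e.symm z).val, (e.symm z).isLt⟩) := fun z => by simp
    rw [link_ofOrder] at ha hb hc
    have R0 : R (e ⟨0, hn⟩) := .refl
    have Ra : R a := (hpos a).2 (hrun 0 _ hn _ (by omega) (by omega) R0)
    have Rb' : R b' := hstep _ _ h1 Ra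
    have Rc : R c := (hpos c).2 (hrun _ _ _ _ (by omega) (by omega) ((hpos b').1 Rb'))
    have Ra' : R a' := hstep _ _ h3 Rc
    have Rb : R b := (hpos b).2 (hrun _ _ _ _ (by omega) (by omega) ((hpos a').1 Ra'))
    have Rc' : R c' := hstep _ _ h2 Rb
    refine ⟨_, fun v => ⟨hpred, (hpos v).2 ?_⟩⟩
    rcases le_or_gt (e.symm v).val (e.symm a).val with h | h
    · exact hrun 0 _ hn _ (by omega) (by omega) R0
    rcases le_or_gt (e.symm v).val (e.symm b).val with h' | h'
    · exact hrun _ _ _ _ (by omega) (by omega) ((hpos a').1 Ra')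
    rcases le_or_gt (e.symm v).val (e.symm c).val with h'' | h''
    · exact hrun _ _ _ _ (by omega) (by omega) ((hpos b').1 Rb')
    · exact hrun _ _ _ _ (by omega) (by omega) ((hpos c').1 Rc')
  refine ⟨⟨(ofOrder e).reroute ρ, hsingle⟩, h1, fun i => nulls_eq_iff.2 ⟨⟨?_, ?_⟩, ?_, ?_⟩,
    fun i j => ?_⟩
  · rintro ⟨h, hh⟩
    exact ⟨_, (hJ _ _).1 hh⟩
  · rintro ⟨h, hh⟩
    refine ⟨ρ.symm h, (hJ _ _).2 ?_⟩
    rwa [ρ.apply_symm_apply]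
  · rintro ⟨j, hj⟩
    by_cases hia : i = a
    · exact ⟨a', hia ▸ ha⟩
    by_cases hib : i = b
    · exact ⟨b', hib ▸ hb⟩
    by_cases hic : i = c
    · exact ⟨c', hic ▸ hc⟩
    exact ⟨j, (h4 i j hia hib hic).1 hj⟩
  · rintro ⟨j, hj⟩
    by_cases hia : i = a
    · exact ⟨b', hia ▸ h1⟩
    by_cases hib : i = b
    · exact ⟨c', hib ▸ h2⟩
    by_cases hic : i = c
    · exact ⟨a', hic ▸ h3⟩
    exact ⟨j, (h4 i j hia hib hic).2 hj⟩
  · have key : ∀ z z₁ z₂, (ofOrder e).Link z z₁ → ((ofOrder e).reroute ρ).Link z z₂ →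
        (((ofOrder e).reroute ρ).Link z j ↔ (ofOrder e).Link z j) ∨ (j = z₁ ∨ j = z₂) := by
      intro z z₁ z₂ hz1 hz2
      by_cases hj : j = z₁ ∨ j = z₂
      · exact .inr hj
      push Not at hj
      exact .inl (iff_of_false (fun h => hj.2 (h.unique_right hz2))
        (fun h => hj.1 (h.unique_right hz1)))
    by_cases hia : i = a
    · subst hia
      exact (key i a' b' ha h1).imp_right fun h => .inl ⟨rfl, h⟩
    by_cases hib : i = b
    · subst hib
      exact (key i b' c' hb h2).imp_right fun h => .inr (.inl ⟨rfl, h⟩)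
    by_cases hic : i = c
    · subst hic
      exact (key i c' a' hc h3).imp_right fun h => .inr (.inr ⟨rfl, h⟩)
    exact .inl (h4 i j hia hib hic)

theorem nulls_ofOrder_congr {e e' : Equiv.Perm (Fin n)} {i : Fin n} (h : e.symm i = e'.symm i) :
    (ofOrder e).nulls i = (ofOrder e').nulls i := by
  simp only [nulls, ofOrder, h]
  split_ifs <;> rfl

end DoublyLinked

/-! ### Scanning -/

/-- Otherwise the complement of `s` in the interval and its shift by one are disjoint, and together
too large. -/
theorem Finset.exists_consecutive_notMem (s : Finset ℕ) {lo hi : ℕ}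
    (h : lo + 2 * s.card + 2 ≤ hi) : ∃ p, lo ≤ p ∧ p + 1 < hi ∧ p ∉ s ∧ p + 1 ∉ s := by
  by_contra! hno
  let U := Finset.Ico lo hi \ s
  have h1 : hi - lo ≤ U.card + s.card := by
    have := Finset.le_card_sdiff s (Finset.Ico lo hi)
    rw [Nat.card_Ico] at this
    have h2 : U.card = (Finset.Ico lo hi \ s).card := rfl
    omega
  have h2 : (U ∪ U.image (· + 1)).card = U.card + U.card := by
    rw [Finset.card_union_of_disjoint, Finset.card_image_of_injective _ (add_left_injective 1)]
    rw [Finset.disjoint_left]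
    intro p hp hp'
    obtain ⟨q, hq, rfl⟩ := Finset.mem_image.1 hp'
    simp only [U, Finset.mem_sdiff, Finset.mem_Ico] at hp hq
    exact hp.2 (hno q hq.1.1 hp.1.2 hq.2)
  have h3 : (U ∪ U.image (· + 1)) ⊆ Finset.Ico lo (hi + 1) := by
    intro p hp
    simp only [U, Finset.mem_union, Finset.mem_image, Finset.mem_sdiff, Finset.mem_Ico] at hp ⊢
    rcases hp with hp | ⟨q, hq, rfl⟩ <;> omega
  have h4 := Finset.card_le_card h3
  rw [h2, Nat.card_Ico] at h4
  omega

/-- One transposition moves `x` to `i`; a second one moves the image of `y` to `j` without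
disturbing `i`. -/
theorem Equiv.Perm.exists_map_pair {α : Type*} [DecidableEq α] {A : Set α} {x y i j : α}
    (hx : x ∈ A) (hy : y ∈ A) (hi : i ∈ A) (hj : j ∈ A) (hxy : x ≠ y) (hij : i ≠ j) :
    ∃ π : Equiv.Perm α, π x = i ∧ π y = j ∧ ∀ z ∉ A, π z = z := by
  have hy' : Equiv.swap x i y ∈ A := by
    rcases eq_or_ne y i with rfl | h
    · rwa [Equiv.swap_apply_right]
    · rwa [Equiv.swap_apply_of_ne_of_ne hxy.symm h]
  have hne : i ≠ Equiv.swap x i y := by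
    rw [ne_eq, eq_comm, Equiv.swap_apply_eq_iff, Equiv.swap_apply_right]
    exact hxy.symm
  refine ⟨Equiv.swap (Equiv.swap x i y) j * Equiv.swap x i, ?_, ?_, fun z hz => ?_⟩
  · rw [Equiv.Perm.mul_apply, Equiv.swap_apply_left, Equiv.swap_apply_of_ne_of_ne hne hij]
  · rw [Equiv.Perm.mul_apply, Equiv.swap_apply_left]
  · have h : ∀ a ∈ A, z ≠ a := fun a ha h => hz (h ▸ ha)
    rw [Equiv.Perm.mul_apply, Equiv.swap_apply_of_ne_of_ne (h x hx) (h i hi),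
      Equiv.swap_apply_of_ne_of_ne (h _ hy') (h j hj)]

theorem ThreeLC.exists_coloring {n M B : ℕ} {A : (ThreeLC n).EMAlgorithm} (hA : A.Solves M B)
    (I : SingleList n) : ∃ c : Fin n → Fin 3, ∀ J : SingleList n,
      (∀ a, (EMState.initial n B).Met (A.ops I) a a → J.nulls a = I.nulls a) →
      (∀ a b, (EMState.initial n B).Met (A.ops I) a b → (J.Link a b ↔ I.Link a b)) →
      ∀ u v, J.Link u v → c u ≠ c v :=
  hA.exists_common_solution I

theorem TwoMLC.exists_coloring {n M B : ℕ} {A : (TwoMLC n).EMAlgorithm} (hA : A.Solves M B)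
    (I : MonotonicLists n) : ∃ c : Fin n → Fin 2, ∀ J : MonotonicLists n,
      (∀ a, (EMState.initial n B).Met (A.ops I) a a → J.nulls a = I.nulls a) →
      (∀ a b, (EMState.initial n B).Met (A.ops I) a b → (J.Link a b ↔ I.Link a b)) →
      ∀ u v, J.Link u v → c u ≠ c v :=
  hA.exists_common_solution I

theorem MLCC.exists_labelling {n M B : ℕ} {A : (MLCC n).EMAlgorithm} (hA : A.Solves M B)
    (I : MonotonicLists n) : ∃ c : Fin n → Fin n, ∀ J : MonotonicLists n,
      (∀ a, (EMState.initial n B).Met (A.ops I) a a → J.nulls a = I.nulls a) →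
      (∀ a b, (EMState.initial n B).Met (A.ops I) a b → (J.Link a b ↔ I.Link a b)) →
      ∀ v, J.IsFirstOf (c v) v :=
  hA.exists_common_solution I

/-- The records that have been in main memory. -/
theorem EMState.exists_touched {n M B : ℕ} (hB : 1 ≤ B) {ops : List (EMOp n)}
    (hal : (initial n B).AllowedSeq M B ops) : ∃ P : Finset (Fin n), P.card ≤ ops.length * B ∧
      ∀ a ∉ P, ∀ b, ¬ (initial n B).Met ops a b ∧ ¬ (initial n B).Met ops b a := by
  obtain ⟨P, hP, hPm⟩ := exists_touched_finset ops _ (bounded_initial hB) hal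
  have h : ∀ a ∉ P, ¬ (initial n B).Met ops a a := fun a ha h => by
    rcases hPm a h with h | h
    · exact ha h
    · simp [initial] at h
  exact ⟨P, hP, fun a ha b => ⟨fun hab => h a ha hab.left, fun hba => h a ha hba.right⟩⟩

/-- With few records touched, two untouched nodes have the same colour and two consecutive positions
hold untouched nodes. Permuting only untouched nodes puts the former into these positions, unnoticed
by the algorithm. -/
theorem ThreeLC.scan {n M B : ℕ} (hB : 1 ≤ B) (hn : 4 ≤ n) {A : (ThreeLC n).EMAlgorithm}
    (hA : A.Solves M B) (e : Equiv.Perm (Fin n)) :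
    n ≤ 8 * ((A.ops (DoublyLinked.singleOfOrder (by omega) e)).length * B) := by
  set I : SingleList n := DoublyLinked.singleOfOrder (by omega) e
  by_contra! hlt
  obtain ⟨c, hc⟩ := ThreeLC.exists_coloring hA I
  obtain ⟨P, hP, hPm⟩ := EMState.exists_touched (n := n) hB (hA I).1
  have h8 : 8 * P.card < n := lt_of_le_of_lt (Nat.mul_le_mul_left 8 hP) hlt
  obtain ⟨p, -, hp, hpP, hpP'⟩ := Finset.exists_consecutive_notMem
    (P.image fun a => (e.symm a).val) (lo := 0) (hi := n) (by
      have : (P.image fun a => (e.symm a).val).card ≤ P.card := Finset.card_image_le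
      omega)
  have hout : ∀ q (hq : q < n), q ∉ P.image (fun a => (e.symm a).val) → e ⟨q, hq⟩ ∉ P := by
    intro q hq h h'
    exact h (Finset.mem_image.2 ⟨_, h', by simp⟩)
  obtain ⟨i, hi, j, hj, hij, hcij⟩ := Finset.exists_ne_map_eq_of_card_lt_of_maps_to
    (s := Pᶜ) (t := Finset.univ) (f := c) (by
      rw [Finset.card_univ, Fintype.card_fin, Finset.card_compl, Fintype.card_fin]
      omega) (by intro _ _; simp)
  obtain ⟨π, hπ1, hπ2, hπ⟩ := Equiv.Perm.exists_map_pair (A := {a | a ∉ P})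
    (hout p (by omega) hpP) (hout (p + 1) hp hpP') (Finset.mem_compl.1 hi) (Finset.mem_compl.1 hj)
    (fun h => by simp at h) hij
  have hfix : ∀ a ∈ P, (e.trans π).symm a = e.symm a := by
    intro a ha
    have : π.symm a = a := by
      rw [Equiv.symm_apply_eq]
      exact (hπ a (not_not_intro ha)).symm
    rw [Equiv.symm_trans_apply, this]
  have hmet : ∀ a b, (EMState.initial n B).Met (A.ops I) a b → a ∈ P ∧ b ∈ P := by
    intro a b hab
    exact ⟨by_contra fun h => (hPm a h b).1 hab, by_contra fun h => (hPm b h a).2 hab⟩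
  refine hc (DoublyLinked.singleOfOrder (by omega) (e.trans π)) ?_ ?_ i j ?_ hcij
  · intro a ha
    exact DoublyLinked.nulls_ofOrder_congr (hfix a (hmet a a ha).1)
  · intro a b hab
    change (DoublyLinked.ofOrder _).Link a b ↔ (DoublyLinked.ofOrder _).Link a b
    rw [DoublyLinked.link_ofOrder, DoublyLinked.link_ofOrder, hfix a (hmet a b hab).1,
      hfix b (hmet a b hab).2]
  · change (DoublyLinked.ofOrder _).Link i j
    rw [DoublyLinked.link_ofOrder, ← hπ1, ← hπ2]
    simp

/-- The list of the scanning bound for monotonic lists: one list and `K - 1` single nodes. -/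
def ListShape.oneLong {n K : ℕ} (hK : 2 ≤ K) (hn : 2 * K ≤ n) : ListShape n where
  passes := 1
  layers := n - (K - 1)
  rest := K - 1
  desc := K - 1
  eq_add := by omega
  two_le_layers := by omega
  one_le_desc := by omega
  desc_le_rest := le_rfl

theorem ListShape.exists_untouched_links {n K b : ℕ} (hK : 2 ≤ K) (hn : 2 * K ≤ n)
    (P : Finset (Fin n)) (hP : P.card ≤ b) (hb : 8 * b < n) :
    ∃ u v w, v ∉ P ∧ w ∉ P ∧ ((ListShape.oneLong hK hn).monotonicLists 1).Link u v ∧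
      ((ListShape.oneLong hK hn).monotonicLists 1).Link v w := by
  set S := ListShape.oneLong hK hn with hS
  have hpl : S.passes * S.layers = n - (K - 1) := Nat.one_mul _
  have hl : S.layers = n - (K - 1) := rfl
  have hd : S.desc = K - 1 := rfl
  set e := S.order 1
  obtain ⟨p, hp0, hp, hpP, hpP'⟩ := Finset.exists_consecutive_notMem
    (P.image fun a => (e.symm a).val) (lo := 1) (hi := n - (K - 1)) (by
      have : (P.image fun a => (e.symm a).val).card ≤ P.card := Finset.card_image_le
      omega)
  have hout : ∀ q (hq : q < n), q ∉ P.image (fun a => (e.symm a).val) → e ⟨q, hq⟩ ∉ P := by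
    intro q hq h h'
    exact h (Finset.mem_image.2 ⟨_, h', by simp⟩)
  have hhead : ∀ q, 0 < q → q < n - (K - 1) → ¬ S.IsHead q := by
    rintro q h0 hq (⟨-, h⟩ | ⟨h, -⟩)
    · have := Nat.le_of_dvd h0 h
      omega
    · omega
  refine ⟨e ⟨p - 1, by omega⟩, e ⟨p, by omega⟩, e ⟨p + 1, by omega⟩, hout _ _ hpP,
    hout _ _ hpP', ?_, ?_⟩
  · rw [S.link_monotonicLists, Equiv.symm_apply_apply, Equiv.symm_apply_apply]
    exact ⟨Nat.sub_add_cancel hp0, hhead p hp0 (by omega)⟩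
  · rw [S.link_monotonicLists, Equiv.symm_apply_apply, Equiv.symm_apply_apply]
    exact ⟨rfl, hhead (p + 1) p.succ_pos hp⟩

/-- If `v` and `w` are untouched in `u → v → w`, bypassing `v` cannot be noticed. The three nodes
would then need pairwise different colours. -/
theorem TwoMLC.scan {n M B K : ℕ} (hB : 1 ≤ B) (hK : 2 ≤ K) (hn : 2 * K ≤ n)
    {A : (TwoMLC n).EMAlgorithm} (hA : A.Solves M B) :
    n ≤ 8 * ((A.ops ((ListShape.oneLong hK hn).monotonicLists 1)).length * B) := by
  set I : MonotonicLists n := (ListShape.oneLong hK hn).monotonicLists 1 with hI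
  by_contra! hlt
  obtain ⟨c, hc⟩ := TwoMLC.exists_coloring hA I
  obtain ⟨P, hP, hPm⟩ := EMState.exists_touched (n := n) hB (hA I).1
  obtain ⟨u, v, w, hv, hw, huv, hvw⟩ := ListShape.exists_untouched_links hK hn P hP hlt
  rw [← hI] at huv hvw
  obtain ⟨J, hJ1, hJ2, hJ3, hJ4⟩ := DoublyLinked.exists_bypass I huv hvw
  have h1 := hc I (fun _ _ => rfl) (fun _ _ _ => Iff.rfl) u v huv
  have h2 := hc I (fun _ _ => rfl) (fun _ _ _ => Iff.rfl) v w hvw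
  have h3 := hc J
    (fun a ha => hJ3 a (by rintro rfl; exact (hPm a hv a).1 ha)
      (by rintro rfl; exact (hPm a hw a).1 ha))
    (fun a b hab => hJ4 a b (by rintro rfl; exact (hPm a hv b).1 hab)
      (by rintro rfl; exact (hPm b hv a).2 hab) (by rintro rfl; exact (hPm b hw a).2 hab)) u w hJ1
  omega

/-- After the bypass `v` is first in its list, so its label is `v`; in the original input `v` has a
predecessor. -/
theorem MLCC.scan {n M B K : ℕ} (hB : 1 ≤ B) (hK : 2 ≤ K) (hn : 2 * K ≤ n)
    {A : (MLCC n).EMAlgorithm} (hA : A.Solves M B) :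
    n ≤ 8 * ((A.ops ((ListShape.oneLong hK hn).monotonicLists 1)).length * B) := by
  set I : MonotonicLists n := (ListShape.oneLong hK hn).monotonicLists 1 with hI
  by_contra! hlt
  obtain ⟨c, hc⟩ := MLCC.exists_labelling hA I
  obtain ⟨P, hP, hPm⟩ := EMState.exists_touched (n := n) hB (hA I).1
  obtain ⟨u, v, w, hv, hw, huv, hvw⟩ := ListShape.exists_untouched_links hK hn P hP hlt
  rw [← hI] at huv hvw
  obtain ⟨J, hJ1, hJ2, hJ3, hJ4⟩ := DoublyLinked.exists_bypass I huv hvw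
  have h1 := hc I (fun _ _ => rfl) (fun _ _ _ => Iff.rfl) v
  have h3 := hc J
    (fun a ha => hJ3 a (by rintro rfl; exact (hPm a hv a).1 ha)
      (by rintro rfl; exact (hPm a hw a).1 ha))
    (fun a b hab => hJ4 a b (by rintro rfl; exact (hPm a hv b).1 hab)
      (by rintro rfl; exact (hPm b hv a).2 hab) (by rintro rfl; exact (hPm b hw a).2 hab)) v
  rw [h3.unique hJ2] at h1
  exact DoublyLinked.pred_eq_none_iff.1 h1.1 u huv

/-! ### Hidden permutations in layered lists -/

namespace ListShape

open DoublyLinked EMState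

variable {N : ℕ} (S : ListShape N)

/-- Pass `t` occupies `S.layers` consecutive positions, so quotient and remainder of a position give
pass and layer. -/
theorem symm_order_eq {τ : ℕ → Equiv.Perm (Fin S.passes)} {l : ℕ} (hl : l < S.layers)
    (t : Fin S.passes) {a : Fin N} (ha : a.val = S.rest + S.passes * l + τ l t) :
    ((S.order τ).symm a).val = t * S.layers + l := by
  have h1 := S.mul_layers_lt t.isLt
  have h2 : t * S.layers + l < S.passes * S.layers := by omega
  have h3 : t * S.layers + l < N := by have := S.eq_add; omega
  have h4 : (t * S.layers + l) % S.layers = l := by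
    rw [Nat.mul_comm, Nat.mul_add_mod, Nat.mod_eq_of_lt hl]
  have h5 : (t * S.layers + l) / S.layers = t := by
    rw [Nat.mul_comm, Nat.mul_add_div (by omega), Nat.div_eq_of_lt hl, Nat.add_zero]
  have h6 : a = S.order τ ⟨t * S.layers + l, h3⟩ := by
    refine Fin.ext ?_
    rw [ha, val_order, S.node_of_lt τ h2]
    simp only [h4, h5, Fin.eta]
  rw [h6, Equiv.symm_apply_apply]

theorem not_isHead_of_pos {l : ℕ} (hl0 : 0 < l) (hl : l < S.layers) (t : Fin S.passes) :
    ¬ S.IsHead (t * S.layers + l) := by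
  have h1 := S.mul_layers_lt t.isLt
  rintro (⟨-, h⟩ | ⟨h, -⟩)
  · have := Nat.le_of_dvd hl0 ((Nat.dvd_add_right (dvd_mul_left _ _)).1 h)
    omega
  · omega

variable {G : ℕ} (hG : S.layers = 3 * G)

/-- Groups consist of three consecutive layers; the layer `r` of the group `p.1`. -/
def groupNode (r : Fin 3) (p : Fin G × Fin S.passes) : Fin N :=
  ⟨S.rest + S.passes * (3 * p.1 + r) + p.2, by
    have h1 : 3 * p.1.val + r.val + 1 ≤ S.layers := by have := p.1.isLt; omega
    have h2 := Nat.mul_le_mul_left S.passes h1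
    have h3 := S.eq_add
    have h4 := p.2.isLt
    rw [Nat.mul_add] at h2
    omega⟩

theorem groupNode_inj {r r' : Fin 3} {p p' : Fin G × Fin S.passes}
    (h : S.groupNode hG r p = S.groupNode hG r' p') : r = r' ∧ p = p' := by
  have h1 : S.passes * (3 * p.1 + r) + p.2 = S.passes * (3 * p'.1 + r') + p'.2 := by
    have := Fin.mk.inj h
    omega
  have hk : 0 < S.passes := p.2.pos
  have h2 := congrArg (· / S.passes) h1
  simp only [Nat.mul_add_div hk, Nat.div_eq_of_lt p.2.isLt, Nat.div_eq_of_lt p'.2.isLt,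
    Nat.add_zero] at h2
  rw [h2] at h1
  exact ⟨Fin.ext (by omega), Prod.ext (Fin.ext (by omega)) (Fin.ext (by omega))⟩

open Classical in
/-- The nodes of the first and the last layer of a group are tagged with their numbers, the nodes
of the middle layer are visited in a hidden order. -/
noncomputable def hidden : HiddenPerms N G S.passes where
  tag a := if h : ∃ p, a = S.groupNode hG 0 p ∨ a = S.groupNode hG 2 p then some h.choose else none
  target := S.groupNode hG 1
  target_injective _ _ h := (S.groupNode_inj hG h).2
  tag_target p := by
    refine dif_neg ?_
    rintro ⟨q, h | h⟩
    · simpa using (S.groupNode_inj hG h).1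
    · simpa using (S.groupNode_inj hG h).1

theorem tag_groupNode {r : Fin 3} (hr : r ≠ 1) (p : Fin G × Fin S.passes) :
    (S.hidden hG).tag (S.groupNode hG r p) = some p := by
  have h : ∃ q, S.groupNode hG r p = S.groupNode hG 0 q ∨
      S.groupNode hG r p = S.groupNode hG 2 q := by
    refine ⟨p, ?_⟩
    fin_cases r
    · exact .inl rfl
    · exact absurd rfl hr
    · exact .inr rfl
  rw [hidden]
  simp only [dif_pos h, Option.some.injEq]
  rcases h.choose_spec with h' | h'
  · exact (S.groupNode_inj hG h').2.symm
  · exact (S.groupNode_inj hG h').2.symm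

/-- The middle layer of group `g` is visited in the order `σ g`. -/
def layerPerm (σ : Fin G → Equiv.Perm (Fin S.passes)) (l : ℕ) : Equiv.Perm (Fin S.passes) :=
  if h : l % 3 = 1 ∧ l / 3 < G then σ ⟨l / 3, h.2⟩ else 1

variable (σ : Fin G → Equiv.Perm (Fin S.passes))

/-- The nodes that pass `p.2` visits in group `p.1`. -/
def passNode (r : Fin 3) (p : Fin G × Fin S.passes) : Fin N :=
  S.groupNode hG r (p.1, if r = 1 then σ p.1 p.2 else p.2)

theorem symm_order_passNode (r : Fin 3) (p : Fin G × Fin S.passes) :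
    ((S.order (S.layerPerm σ)).symm (S.passNode hG σ r p)).val =
      p.2 * S.layers + (3 * p.1 + r) := by
  have hl : 3 * p.1.val + r.val < S.layers := by have := p.1.isLt; omega
  refine S.symm_order_eq hl p.2 ?_
  have h2 : (3 * p.1.val + r.val) / 3 = p.1 := by omega
  simp only [passNode, groupNode, layerPerm, h2]
  congr 2
  fin_cases r
  · simp
  · simp
  · simp

theorem owns_passNode (r : Fin 3) (p : Fin G × Fin S.passes) :
    (S.hidden hG).Owns σ p (S.passNode hG σ r p) := by
  by_cases hr : r = 1
  · subst hr
    exact .inr rfl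
  · refine .inl ?_
    simp only [passNode, if_neg hr]
    exact S.tag_groupNode hG hr p

variable {hG σ}

theorem not_met_of_not_seen {s : EMState N} {ops : List (EMOp N)} {p : Fin G × Fin S.passes}
    (h : ¬ (S.hidden hG).Seen σ s ops p) {r : Fin 3} (hr : r ≠ 1) :
    ¬ s.Met ops (S.passNode hG σ r p) (S.passNode hG σ 1 p) := fun hm =>
  h ⟨_, by simp only [passNode, if_neg hr]; exact S.tag_groupNode hG hr p, hm⟩

theorem not_met_of_not_cross {s : EMState N} {ops : List (EMOp N)} {p q : Fin G × Fin S.passes}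
    (h : ¬ (S.hidden hG).Cross σ s ops p q) (r r' : Fin 3) :
    ¬ s.Met ops (S.passNode hG σ r p) (S.passNode hG σ r' q) := fun hm =>
  h ⟨_, _, S.owns_passNode hG σ r p, S.owns_passNode hG σ r' q, hm⟩

variable (hG σ)

theorem link_passNode_single {r r' : Fin 3} (hr : r.val + 1 = r'.val)
    (p : Fin G × Fin S.passes) :
    (S.singleList (S.layerPerm σ)).Link (S.passNode hG σ r p) (S.passNode hG σ r' p) := by
  rw [S.link_singleList, symm_order_passNode, symm_order_passNode]
  omega

theorem link_passNode_monotonic {r r' : Fin 3} (hr : r.val + 1 = r'.val)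
    (p : Fin G × Fin S.passes) :
    (S.monotonicLists (S.layerPerm σ)).Link (S.passNode hG σ r p) (S.passNode hG σ r' p) := by
  rw [S.link_monotonicLists, symm_order_passNode, symm_order_passNode]
  refine ⟨by omega, S.not_isHead_of_pos (by omega) ?_ p.2⟩
  have := p.1.isLt
  omega

variable {σ}

/-- If two items are unseen and do not cross, then the middle nodes of both are linked in a system
that cannot be distinguished. -/
theorem exists_indistinguishable_of_lt {s : EMState N} {ops : List (EMOp N)} {g : Fin G}
    {t t' : Fin S.passes}
    (ht : ¬ (S.hidden hG).Seen σ s ops (g, t)) (ht' : ¬ (S.hidden hG).Seen σ s ops (g, t'))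
    (hc : ¬ (S.hidden hG).Cross σ s ops (g, t) (g, t')) (hlt : σ g t < σ g t') :
    ∃ J : MonotonicLists N,
      J.Link (S.passNode hG σ 1 (g, t)) (S.passNode hG σ 1 (g, t')) ∧
      (∀ i, J.nulls i = (S.monotonicLists (S.layerPerm σ)).nulls i) ∧
      ∀ i j, s.Met ops i j → (J.Link i j ↔ (S.monotonicLists (S.layerPerm σ)).Link i j) := by
  have h1 : S.passNode hG σ 1 (g, t) < S.passNode hG σ 1 (g, t') := by
    rw [Fin.lt_def] at hlt ⊢
    simpa [passNode, groupNode] using hlt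
  have h2 : S.passNode hG σ 0 (g, t') < S.passNode hG σ 2 (g, t) := by
    rw [Fin.lt_def]
    have h3 := t'.isLt
    have h4 : S.passes * (3 * g + 2) = S.passes * (3 * g) + 2 * S.passes := by ring
    simp only [passNode, groupNode, Fin.val_zero, Fin.val_two, h4, Nat.add_zero]
    simp
    omega
  -- The link out of the middle node of `t` and the link into the middle node of `t'` exchange ends.
  -- All pairs affected belong to `t`, to `t'` or to both, so none has met.
  obtain ⟨J, hJ1, hJ2, hJ3⟩ := exists_exchange _
    (S.link_passNode_monotonic hG σ (r := 1) (r' := 2) rfl (g, t))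
    (S.link_passNode_monotonic hG σ (r := 0) (r' := 1) rfl (g, t')) h1 h2
  refine ⟨J, hJ1, hJ2, fun i j hij => ?_⟩
  rcases hJ3 i j with h | ⟨rfl, rfl | rfl⟩ | ⟨rfl, rfl | rfl⟩
  · exact h
  · exact absurd hij.symm (S.not_met_of_not_seen ht (by decide))
  · exact absurd hij (S.not_met_of_not_cross hc _ _)
  · exact absurd hij.symm (S.not_met_of_not_cross hc _ _)
  · exact absurd hij (S.not_met_of_not_seen ht' (by decide))

/-- In a monotonic system the new link must lead from the smaller middle node to the larger, so the
order of `σ g t` and `σ g t'` decides its direction. -/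
theorem exists_indistinguishable {s : EMState N} {ops : List (EMOp N)} {g : Fin G}
    {t t' : Fin S.passes} (hne : t ≠ t')
    (ht : ¬ (S.hidden hG).Seen σ s ops (g, t)) (ht' : ¬ (S.hidden hG).Seen σ s ops (g, t'))
    (hc : ¬ (S.hidden hG).Cross σ s ops (g, t) (g, t')) :
    ∃ J : MonotonicLists N,
      (J.Link (S.passNode hG σ 1 (g, t)) (S.passNode hG σ 1 (g, t')) ∨
        J.Link (S.passNode hG σ 1 (g, t')) (S.passNode hG σ 1 (g, t))) ∧
      (∀ i, J.nulls i = (S.monotonicLists (S.layerPerm σ)).nulls i) ∧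
      ∀ i j, s.Met ops i j → (J.Link i j ↔ (S.monotonicLists (S.layerPerm σ)).Link i j) := by
  rcases lt_or_gt_of_ne ((σ g).injective.ne hne) with h | h
  · obtain ⟨J, h1, h2⟩ := S.exists_indistinguishable_of_lt hG ht ht' hc h
    exact ⟨J, .inl h1, h2⟩
  · obtain ⟨J, h1, h2⟩ := S.exists_indistinguishable_of_lt hG ht' ht (fun h => hc h.symm) h
    exact ⟨J, .inr h1, h2⟩

/-- Items are coloured like their middle nodes. The exchange links two middle nodes of equal colour,
which the common colouring forbids; two colours embed into the three that `Resolved` allows. -/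
theorem resolved_twoMLC {M B : ℕ} {A : (TwoMLC N).EMAlgorithm} (hA : A.Solves M B)
    (σ : Fin G → Equiv.Perm (Fin S.passes)) :
    (S.hidden hG).Resolved σ (initial N B) (A.ops (S.monotonicLists (S.layerPerm σ))) := by
  intro g
  obtain ⟨c, hc⟩ := TwoMLC.exists_coloring hA (S.monotonicLists (S.layerPerm σ))
  refine ⟨fun t => (c (S.passNode hG σ 1 (g, t))).castSucc, ?_⟩
  intro t₁ t₂ t₃ h12 _ _ hcol _ hs1 hs2 _
  left
  by_contra hcross
  obtain ⟨J, hJ1, hJ2, hJ3⟩ := S.exists_indistinguishable hG h12 hs1 hs2 hcross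
  have hcol' := Fin.castSucc_injective _ hcol
  rcases hJ1 with h | h
  · exact hc J (fun a _ => hJ2 a) hJ3 _ _ h hcol'
  · exact hc J (fun a _ => hJ2 a) hJ3 _ _ h hcol'.symm

/-- Links of the monotonic system never enter the first layer of a pass, so a list that ends in a
pass stays within it. -/
theorem div_eq_of_isFirstOf {τ : ℕ → Equiv.Perm (Fin S.passes)} {h v : Fin N}
    (hv : Relation.ReflTransGen (S.monotonicLists τ).Link h v)
    (hlt : ((S.order τ).symm v).val < S.passes * S.layers) :
    ((S.order τ).symm h).val / S.layers = ((S.order τ).symm v).val / S.layers := by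
  induction hv with
  | refl => rfl
  | @tail b c hab hbc ih =>
    rw [S.link_monotonicLists] at hbc
    obtain ⟨h1, h2⟩ := hbc
    have h3 : ¬ S.layers ∣ ((S.order τ).symm b).val + 1 := fun h => h2 (.inl ⟨hlt, h1 ▸ h⟩)
    rw [ih (by omega), ← h1, Nat.succ_div_of_not_dvd h3]

/-- The exchange puts two middle nodes into one list, so the common labelling labels them equally.
In the original input they lie on different passes and have different first nodes. -/
theorem resolved_mlcc {M B : ℕ} {A : (MLCC N).EMAlgorithm} (hA : A.Solves M B)
    (σ : Fin G → Equiv.Perm (Fin S.passes)) :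
    (S.hidden hG).Resolved σ (initial N B) (A.ops (S.monotonicLists (S.layerPerm σ))) := by
  intro g
  obtain ⟨c, hc⟩ := MLCC.exists_labelling hA (S.monotonicLists (S.layerPerm σ))
  refine ⟨fun _ => 0, ?_⟩
  intro t₁ t₂ t₃ h12 _ _ _ _ hs1 hs2 _
  left
  by_contra hcross
  obtain ⟨J, hJ1, hJ2, hJ3⟩ := S.exists_indistinguishable hG h12 hs1 hs2 hcross
  have hJc := hc J (fun a _ => hJ2 a) hJ3
  have hIc := hc _ (fun _ _ => rfl) (fun _ _ _ => Iff.rfl)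
  have hcol : c (S.passNode hG σ 1 (g, t₁)) = c (S.passNode hG σ 1 (g, t₂)) := by
    rcases hJ1 with h | h
    · exact ((hJc _).tail h).unique (hJc _)
    · exact (hJc _).unique ((hJc _).tail h)
  have hpos : ∀ t : Fin S.passes,
      t * S.layers + (3 * g + 1) < S.passes * S.layers ∧
        (t * S.layers + (3 * g + 1)) / S.layers = t := by
    intro t
    have h1 := S.mul_layers_lt t.isLt
    have h2 : 3 * g.val + 1 < S.layers := by have := g.isLt; omega
    refine ⟨by omega, ?_⟩
    rw [Nat.mul_comm, Nat.mul_add_div (by omega), Nat.div_eq_of_lt h2, Nat.add_zero]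
  have key : ∀ t, ((S.order (S.layerPerm σ)).symm (c (S.passNode hG σ 1 (g, t)))).val / S.layers =
      t := by
    intro t
    rw [S.div_eq_of_isFirstOf (hIc (S.passNode hG σ 1 (g, t))).2 (by
      rw [symm_order_passNode]; exact (hpos t).1), symm_order_passNode]
    exact (hpos t).2
  refine h12 (Fin.ext ?_)
  rw [← key t₁, ← key t₂, hcol]

/-- The segment exchange makes the middle node of `t₂` follow that of `t₁`, though they have the
same colour. The item `t₃` only supplies the third link that keeps the list in one piece. -/
theorem cross_of_lt {M B : ℕ} {A : (ThreeLC N).EMAlgorithm} (hA : A.Solves M B)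
    (σ : Fin G → Equiv.Perm (Fin S.passes)) (g : Fin G) :
    ∃ col : Fin S.passes → Fin 3, ∀ t₁ t₂ t₃, t₁ < t₂ → t₂ < t₃ → col t₁ = col t₂ →
      ∀ ops, ops = A.ops (S.singleList (S.layerPerm σ)) →
      ¬ (S.hidden hG).Seen σ (initial N B) ops (g, t₁) →
      ¬ (S.hidden hG).Seen σ (initial N B) ops (g, t₂) →
      ¬ (S.hidden hG).Seen σ (initial N B) ops (g, t₃) →
      (S.hidden hG).Cross σ (initial N B) ops (g, t₁) (g, t₂) ∨
        (S.hidden hG).Cross σ (initial N B) ops (g, t₂) (g, t₃) ∨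
        (S.hidden hG).Cross σ (initial N B) ops (g, t₁) (g, t₃) := by
  obtain ⟨c, hc⟩ := ThreeLC.exists_coloring hA (S.singleList (S.layerPerm σ))
  refine ⟨fun t => c (S.passNode hG σ 1 (g, t)), ?_⟩
  rintro t₁ t₂ t₃ h12 h23 hcol ops rfl hs1 hs2 hs3
  by_contra! hcross
  obtain ⟨hc12, hc23, hc13⟩ := hcross
  have hmul : ∀ {t t' : Fin S.passes}, t < t' → t * S.layers + S.layers ≤ t' * S.layers := by
    intro t t' h
    have := Nat.mul_le_mul_right S.layers (Nat.succ_le_of_lt (Fin.lt_def.1 h))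
    rwa [Nat.succ_mul] at this
  have hg : 3 * g.val + 2 < S.layers := by have := g.isLt; omega
  obtain ⟨J, hJ1, hJ2, hJ3⟩ := exists_segment_exchange S.pos (S.order (S.layerPerm σ))
    (S.link_passNode_single hG σ (r := 1) (r' := 2) rfl (g, t₁))
    (S.link_passNode_single hG σ (r := 0) (r' := 1) rfl (g, t₂))
    (S.link_passNode_single hG σ (r := 0) (r' := 1) rfl (g, t₃))
    (by
      rw [Fin.lt_def, symm_order_passNode, symm_order_passNode]
      have := hmul h12
      simp only [Fin.val_zero, Fin.val_one]
      omega)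
    (by
      rw [Fin.lt_def, symm_order_passNode, symm_order_passNode]
      have := hmul h23
      simp only [Fin.val_zero]
      omega)
  refine hc J (fun a _ => hJ2 a) (fun i j hij => ?_) _ _ hJ1 hcol
  rcases hJ3 i j with h | ⟨rfl, rfl | rfl⟩ | ⟨rfl, rfl | rfl⟩ | ⟨rfl, rfl | rfl⟩
  · exact h
  · exact absurd hij.symm (S.not_met_of_not_seen hs1 (by decide))
  · exact absurd hij (S.not_met_of_not_cross hc12 _ _)
  · exact absurd hij (S.not_met_of_not_seen hs2 (by decide))
  · exact absurd hij (S.not_met_of_not_cross hc23 _ _)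
  · exact absurd hij (S.not_met_of_not_seen hs3 (by decide))
  · exact absurd hij.symm (S.not_met_of_not_cross hc13 _ _)

/-- `cross_of_lt` needs the items in the order of their passes; the cases sort the triple. -/
theorem resolved_threeLC {M B : ℕ} {A : (ThreeLC N).EMAlgorithm} (hA : A.Solves M B)
    (σ : Fin G → Equiv.Perm (Fin S.passes)) :
    (S.hidden hG).Resolved σ (initial N B) (A.ops (S.singleList (S.layerPerm σ))) := by
  intro g
  obtain ⟨col, hcol⟩ := S.cross_of_lt hG hA σ g
  refine ⟨col, fun t₁ t₂ t₃ h12 h23 h13 hc12 hc23 hs1 hs2 hs3 => ?_⟩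
  have hc13 := hc12.trans hc23
  rcases lt_or_gt_of_ne h12 with h | h <;> rcases lt_or_gt_of_ne h23 with h' | h' <;>
    rcases lt_or_gt_of_ne h13 with h'' | h''
  · exact hcol _ _ _ h h' hc12 _ rfl hs1 hs2 hs3
  · exact absurd (h.trans h') h''.not_gt
  · rcases hcol _ _ _ h'' h' hc13 _ rfl hs1 hs3 hs2 with h | h | h
    · exact .inr (.inr h)
    · exact .inr (.inl h.symm)
    · exact .inl h
  · rcases hcol _ _ _ h'' h hc13.symm _ rfl hs3 hs1 hs2 with h | h | h
    · exact .inr (.inr h.symm)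
    · exact .inl h
    · exact .inr (.inl h.symm)
  · rcases hcol _ _ _ h h'' hc12.symm _ rfl hs2 hs1 hs3 with h | h | h
    · exact .inl h.symm
    · exact .inr (.inr h)
    · exact .inr (.inl h)
  · rcases hcol _ _ _ h' h'' hc23 _ rfl hs2 hs3 hs1 with h | h | h
    · exact .inr (.inl h)
    · exact .inr (.inr h.symm)
    · exact .inl h.symm
  · exact absurd (h'.trans h) h''.not_gt
  · rcases hcol _ _ _ h' h hc23.symm _ rfl hs3 hs2 hs1 with h | h | h
    · exact .inr (.inl h.symm)
    · exact .inl h.symm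
    · exact .inr (.inr h.symm)

end ListShape

/-! ### Inputs with prescribed parameter -/

/-- The shape of the inputs of the lower bounds for lists. -/
def ListShape.layered {N K l d : ℕ} (hl : 2 ≤ l) (hd : 1 ≤ d) (h : K / 2 * l + d ≤ N) :
    ListShape N where
  passes := K / 2
  layers := l
  rest := N - K / 2 * l
  desc := d
  eq_add := by omega
  two_le_layers := hl
  one_le_desc := hd
  desc_le_rest := by omega

/-- As many groups of three layers are taken as leave `K - K / 2` nodes for the single-node lists
that bring the number of heads up to `K`. -/
theorem exists_group_count {N K : ℕ} (hK : 2 ≤ K) (hN : 2 * K ≤ N) :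
    ∃ G, 1 ≤ G ∧ K / 2 * (3 * G) + (K - K / 2) ≤ N ∧ N ≤ 12 * (G * (K / 2)) := by
  set k := K / 2 with hk
  have hk0 : 0 < 3 * k := by omega
  refine ⟨(N - (K - k)) / (3 * k), ?_, ?_, ?_⟩
  · rw [Nat.le_div_iff_mul_le hk0]; omega
  · have := Nat.div_mul_le_self (N - (K - k)) (3 * k)
    have h2 : k * (3 * ((N - (K - k)) / (3 * k))) = (N - (K - k)) / (3 * k) * (3 * k) := by ring
    omega
  · have h1 := Nat.div_add_mod (N - (K - k)) (3 * k)
    have h2 := Nat.mod_lt (N - (K - k)) hk0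
    have h3 : 1 ≤ (N - (K - k)) / (3 * k) := by rw [Nat.le_div_iff_mul_le hk0]; omega
    have h4 : 3 * k * ((N - (K - k)) / (3 * k)) = 3 * ((N - (K - k)) / (3 * k) * k) := by ring
    have h5 := Nat.mul_le_mul_right k h3
    omega

theorem MonotonicLists.exists_numHeads_eq {N K : ℕ} (hK : 1 ≤ K) (hN : 2 * K ≤ N) :
    ∃ I : MonotonicLists N, I.numHeads = K := by
  let S : ListShape N := ⟨0, 2, N, K, by omega, le_rfl, hK, by omega⟩
  exact ⟨S.monotonicLists 1, (S.numHeads_monotonicLists 1).trans (Nat.zero_add K)⟩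

theorem ListShape.numHeads_oneLong {N K : ℕ} (hK : 2 ≤ K) (hN : 2 * K ≤ N) :
    ((ListShape.oneLong hK hN).monotonicLists 1).numHeads = K := by
  rw [ListShape.numHeads_monotonicLists]
  change 1 + (K - 1) = K
  omega

/-- `K / 2` passes give the even part of `K`. For even `K` the whole rest descends; for odd `K` it
ascends after its first node, which adds one stretch and needs two nodes. -/
theorem SingleList.exists_numStretches_eq {N K l : ℕ} (hK : 1 ≤ K) (hN : 2 * K ≤ N) (hl : 2 ≤ l)
    (h : K / 2 * l + (K - K / 2) ≤ N) :
    ∃ S : ListShape N, S.layers = l ∧ S.passes = K / 2 ∧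
      ∀ τ, (S.singleList τ).numStretches = K := by
  have hrest : K % 2 = 1 → 2 ≤ N - K / 2 * l := by
    intro h1
    rcases Nat.eq_zero_or_pos (K / 2) with h0 | h0
    · rw [h0] at h ⊢; omega
    · omega
  rcases Nat.mod_two_eq_zero_or_one K with h2 | h2
  · refine ⟨ListShape.layered (K := K) (d := N - K / 2 * l) hl (by omega) (by omega), rfl, rfl,
      fun τ => ?_⟩
    rw [ListShape.numStretches_singleList _ _ (.inl (by change 1 ≤ K / 2; omega))]
    change 2 * (K / 2) + (if N - K / 2 * l < N - K / 2 * l then 1 else 0) = K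
    rw [if_neg (lt_irrefl _)]
    omega
  · have h3 := hrest h2
    refine ⟨ListShape.layered (K := K) (d := 1) hl le_rfl (by omega), rfl, rfl, fun τ => ?_⟩
    rw [ListShape.numStretches_singleList _ _ (.inr rfl)]
    change 2 * (K / 2) + (if 1 < N - K / 2 * l then 1 else 0) = K
    rw [if_pos (by omega)]
    omega

/-! ### The bounds for the three list problems -/

section

variable {N K M B : ℕ} (hB : 1 ≤ B) (hM : 2 * B ≤ M) (hK : 1 ≤ K) (hKN : 2 * K ≤ N)
  (hsort : sortIO M B N ≤ N)

include hB hM hK hKN hsort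

theorem TwoMLC.requiresIOs : (TwoMLC N).RequiresIOs (fun D : MonotonicLists N => D.numHeads = K)
    M B (1 / 100000 * (((N : ℝ) / K) * sortIO M B K)) := by
  refine RecordProblem.requiresIOs_of_hiddenPerms hB hM hK hKN hsort (by change N ≤ _; omega)
    (MonotonicLists.exists_numHeads_eq hK hKN) ?_ ?_
  · exact fun hK2 A hA => ⟨_, ListShape.numHeads_oneLong hK2 hKN, TwoMLC.scan hB hK2 hKN hA⟩
  · intro hK2
    obtain ⟨G, hG1, hG2, hG3⟩ := exists_group_count hK2 hKN
    let S : ListShape N := ListShape.layered (K := K) (l := 3 * G) (d := K - K / 2) (by omega)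
      (by omega) hG2
    have hG : S.layers = 3 * G := rfl
    refine ⟨G, K / 2, S.hidden hG, hG3, by omega, fun A hA σ =>
      ⟨S.monotonicLists (S.layerPerm σ), ?_, S.resolved_twoMLC hG hA σ⟩⟩
    refine (S.numHeads_monotonicLists _).trans ?_
    change K / 2 + (K - K / 2) = K
    omega

theorem MLCC.requiresIOs : (MLCC N).RequiresIOs (fun D : MonotonicLists N => D.numHeads = K)
    M B (1 / 100000 * (((N : ℝ) / K) * sortIO M B K)) := by
  refine RecordProblem.requiresIOs_of_hiddenPerms hB hM hK hKN hsort (by change N ≤ _; omega)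
    (MonotonicLists.exists_numHeads_eq hK hKN) ?_ ?_
  · exact fun hK2 A hA => ⟨_, ListShape.numHeads_oneLong hK2 hKN, MLCC.scan hB hK2 hKN hA⟩
  · intro hK2
    obtain ⟨G, hG1, hG2, hG3⟩ := exists_group_count hK2 hKN
    let S : ListShape N := ListShape.layered (K := K) (l := 3 * G) (d := K - K / 2) (by omega)
      (by omega) hG2
    have hG : S.layers = 3 * G := rfl
    refine ⟨G, K / 2, S.hidden hG, hG3, by omega, fun A hA σ =>
      ⟨S.monotonicLists (S.layerPerm σ), ?_, S.resolved_mlcc hG hA σ⟩⟩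
    refine (S.numHeads_monotonicLists _).trans ?_
    change K / 2 + (K - K / 2) = K
    omega

theorem ThreeLC.requiresIOs : (ThreeLC N).RequiresIOs (fun D : SingleList N => D.numStretches = K)
    M B (1 / 100000 * (((N : ℝ) / K) * sortIO M B K)) := by
  obtain ⟨S, -, -, hS⟩ := SingleList.exists_numStretches_eq (l := 2) hK hKN le_rfl (by omega)
  refine RecordProblem.requiresIOs_of_hiddenPerms hB hM hK hKN hsort (by change N ≤ _; omega)
    ⟨S.singleList 1, hS 1⟩ ?_ ?_
  · exact fun hK2 A hA => ⟨_, hS 1, ThreeLC.scan hB (by omega) hA (S.order 1)⟩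
  · intro hK2
    obtain ⟨G, hG1, hG2, hG3⟩ := exists_group_count hK2 hKN
    obtain ⟨S', hG, hS'K, hS'⟩ :=
      SingleList.exists_numStretches_eq (l := 3 * G) hK hKN (by omega) hG2
    refine ⟨G, S'.passes, S'.hidden hG, by rwa [hS'K], by omega, fun A hA σ =>
      ⟨S'.singleList (S'.layerPerm σ), hS' _, S'.resolved_threeLC hG hA σ⟩⟩

end

/-! ### Interval representations with hidden permutations -/

namespace IntervalRep

/-- Partners in a group of `4 * K` endpoints: first `K` left endpoints `a`, whose right endpoints
`K + 2 * π a` alternate with `K` left endpoints `K + 2 * s + 1`, whose right endpoints come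
last. -/
def groupPartner {K : ℕ} (π : Equiv.Perm (Fin K)) (a : ℕ) : ℕ :=
  if h : a < K then K + 2 * π ⟨a, h⟩
  else if h' : a < 3 * K then
    if (a - K) % 2 = 0 then π.symm ⟨(a - K) / 2, by omega⟩ else 3 * K + (a - K) / 2
  else K + 2 * (a - 3 * K) + 1

section

variable {K : ℕ} (π : Equiv.Perm (Fin K))

theorem groupPartner_first (i : Fin K) : groupPartner π i = K + 2 * π i := by
  simp [groupPartner, i.isLt]

theorem groupPartner_right (s : Fin K) : groupPartner π (K + 2 * s) = π.symm s := by
  have := s.isLt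
  rw [groupPartner, dif_neg (by omega), dif_pos (by omega), if_pos (by omega)]
  congr 3
  omega

theorem groupPartner_second (s : Fin K) : groupPartner π (K + 2 * s + 1) = 3 * K + s := by
  have := s.isLt
  rw [groupPartner, dif_neg (by omega), dif_pos (by omega), if_neg (by omega)]
  omega

theorem groupPartner_last (s : Fin K) : groupPartner π (3 * K + s) = K + 2 * s + 1 := by
  have := s.isLt
  rw [groupPartner, dif_neg (by omega), dif_neg (by omega)]
  omega

theorem group_cases {a : ℕ} (ha : a < 4 * K) :
    (∃ i : Fin K, a = i) ∨ (∃ s : Fin K, a = K + 2 * s) ∨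
      (∃ s : Fin K, a = K + 2 * s + 1) ∨ ∃ s : Fin K, a = 3 * K + s := by
  rcases lt_or_ge a K with h | h
  · exact .inl ⟨⟨a, h⟩, rfl⟩
  rcases lt_or_ge a (3 * K) with h' | h'
  · rcases Nat.mod_two_eq_zero_or_one (a - K) with h2 | h2
    · exact .inr (.inl ⟨⟨(a - K) / 2, by omega⟩, by simp only; omega⟩)
    · exact .inr (.inr (.inl ⟨⟨(a - K) / 2, by omega⟩, by simp only; omega⟩))
  · exact .inr (.inr (.inr ⟨⟨a - 3 * K, by omega⟩, by simp only; omega⟩))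

theorem groupPartner_lt {a : ℕ} (ha : a < 4 * K) : groupPartner π a < 4 * K := by
  rcases group_cases ha with ⟨s, rfl⟩ | ⟨s, rfl⟩ | ⟨s, rfl⟩ | ⟨s, rfl⟩
  · rw [groupPartner_first]; omega
  · rw [groupPartner_right]; omega
  · rw [groupPartner_second]; omega
  · rw [groupPartner_last]; omega

theorem groupPartner_groupPartner {a : ℕ} (ha : a < 4 * K) :
    groupPartner π (groupPartner π a) = a := by
  rcases group_cases ha with ⟨s, rfl⟩ | ⟨s, rfl⟩ | ⟨s, rfl⟩ | ⟨s, rfl⟩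
  · rw [groupPartner_first, groupPartner_right, π.symm_apply_apply]
  · rw [groupPartner_right, groupPartner_first, π.apply_symm_apply]
  · rw [groupPartner_second, groupPartner_last]
  · rw [groupPartner_last, groupPartner_second]

theorem groupPartner_ne {a : ℕ} (ha : a < 4 * K) : groupPartner π a ≠ a := by
  rcases group_cases ha with ⟨s, rfl⟩ | ⟨s, rfl⟩ | ⟨s, rfl⟩ | ⟨s, rfl⟩
  · rw [groupPartner_first]; omega
  · rw [groupPartner_right]; omega
  · rw [groupPartner_second]; omega
  · rw [groupPartner_last]; omega

end

/-- The partner of endpoint `p` when there are `G` groups, followed by disjoint intervals. -/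
def groupsPartner {K : ℕ} (G : ℕ) (τ : ℕ → Equiv.Perm (Fin K)) (p : ℕ) : ℕ :=
  if p < 4 * K * G then 4 * K * (p / (4 * K)) + groupPartner (τ (p / (4 * K))) (p % (4 * K))
  else if (p - 4 * K * G) % 2 = 0 then p + 1 else p - 1

section

variable {K G N : ℕ} (τ : ℕ → Equiv.Perm (Fin K))

theorem group_add_lt {g a : ℕ} (hg : g < G) (ha : a < 4 * K) : 4 * K * g + a < 4 * K * G := by
  have := Nat.mul_le_mul_left (4 * K) (Nat.succ_le_of_lt hg)
  rw [Nat.mul_succ] at this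
  omega

theorem groupsPartner_group {g a : ℕ} (hg : g < G) (ha : a < 4 * K) :
    groupsPartner G τ (4 * K * g + a) = 4 * K * g + groupPartner (τ g) a := by
  rw [groupsPartner, if_pos (group_add_lt hg ha), Nat.mul_add_div (by omega),
    Nat.div_eq_of_lt ha, Nat.mul_add_mod, Nat.mod_eq_of_lt ha, Nat.add_zero]

theorem exists_group {p : ℕ} (hp : p < 4 * K * G) :
    ∃ g a, g < G ∧ a < 4 * K ∧ p = 4 * K * g + a := by
  have hK : 0 < 4 * K := Nat.pos_of_ne_zero fun h => by simp [h] at hp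
  exact ⟨p / (4 * K), p % (4 * K), Nat.div_lt_of_lt_mul hp, Nat.mod_lt _ hK,
    (Nat.div_add_mod _ _).symm⟩

theorem groupsPartner_spec (h : 4 * K * G ≤ 2 * N) {p : ℕ} (hp : p < 2 * N) :
    groupsPartner G τ p < 2 * N ∧ groupsPartner G τ p ≠ p ∧
      groupsPartner G τ (groupsPartner G τ p) = p := by
  rcases lt_or_ge p (4 * K * G) with h' | h'
  · obtain ⟨g, a, hg, ha, rfl⟩ := exists_group h'
    have h1 := groupPartner_lt (τ g) ha
    rw [groupsPartner_group τ hg ha, groupsPartner_group τ hg h1,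
      groupPartner_groupPartner (τ g) ha]
    have h2 := group_add_lt hg h1
    have h3 := groupPartner_ne (τ g) ha
    exact ⟨by omega, by omega, rfl⟩
  · have h4 : 4 * K * G = 2 * (2 * (K * G)) := by ring
    unfold groupsPartner
    rw [if_neg h'.not_gt]
    split_ifs <;> omega

/-- `G` groups of `2 * K` intervals, followed by disjoint intervals. -/
def groups (h : 4 * K * G ≤ 2 * N) : IntervalRep N where
  partner p := ⟨groupsPartner G τ p, (groupsPartner_spec τ h p.isLt).1⟩
  partner_ne p hp := (groupsPartner_spec τ h p.isLt).2.1 (congrArg Fin.val hp)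
  partner_partner p := Fin.ext (groupsPartner_spec τ h p.isLt).2.2

/-- Endpoint `a` of group `g`. -/
def groupPoint (h : 4 * K * G ≤ 2 * N) (g : Fin G) (a : ℕ) (ha : a < 4 * K) : Fin (2 * N) :=
  ⟨4 * K * g + a, (group_add_lt g.isLt ha).trans_le h⟩

variable (h : 4 * K * G ≤ 2 * N)

theorem groupPoint_inj {g g' : Fin G} {a a' : ℕ} {ha : a < 4 * K} {ha' : a' < 4 * K}
    (heq : groupPoint h g a ha = groupPoint h g' a' ha') : g = g' ∧ a = a' := by
  have h1 : 4 * K * g + a = 4 * K * g' + a' := Fin.mk.inj heq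
  have h2 := congrArg (· / (4 * K)) h1
  simp only [Nat.mul_add_div (by omega : 0 < 4 * K), Nat.div_eq_of_lt ha, Nat.div_eq_of_lt ha',
    Nat.add_zero] at h2
  rw [h2] at h1
  exact ⟨Fin.ext h2, by omega⟩

theorem partner_groupPoint (g : Fin G) (a : ℕ) (ha : a < 4 * K) :
    (groups τ h).partner (groupPoint h g a ha) =
      groupPoint h g (groupPartner (τ g) a) (groupPartner_lt (τ g) ha) :=
  Fin.ext (groupsPartner_group τ g.isLt ha)

end

theorem adj_of_mem {n : ℕ} {R : IntervalRep n} {u v : R.Interval} (hne : u.1 ≠ v.1)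
    {x : Fin (2 * n)} (hu : u.1 ≤ x) (hu' : x ≤ R.partner u.1) (hv : v.1 ≤ x)
    (hv' : x ≤ R.partner v.1) : R.graph.Adj u v :=
  ⟨fun h => hne (congrArg Subtype.val h), ⟨x, ⟨hu, hu'⟩, ⟨hv, hv'⟩⟩⟩

/-! ### Colouring the groups: a colour is reused as soon as its interval has ended -/

section

variable {K G : ℕ} (τ : ℕ → Equiv.Perm (Fin K))

/-- The colour of the interval that starts at `p`. -/
def groupsColor (hK : 1 ≤ K) (p : ℕ) : Fin K :=
  if h : p < 4 * K * G then
    if h' : p % (4 * K) < K then ⟨p % (4 * K), h'⟩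
    else if h'' : p % (4 * K) < 3 * K then
      (τ (p / (4 * K))).symm ⟨(p % (4 * K) - K) / 2, by omega⟩
    else ⟨0, hK⟩
  else ⟨0, hK⟩

theorem groupsColor_first (hK : 1 ≤ K) {g : ℕ} (hg : g < G) (i : Fin K) :
    groupsColor (G := G) τ hK (4 * K * g + i) = i := by
  have h1 : (4 * K * g + i) % (4 * K) = i := by
    rw [Nat.mul_add_mod, Nat.mod_eq_of_lt (by omega)]
  rw [groupsColor, dif_pos (group_add_lt hg (by omega)), dif_pos (by omega)]
  exact Fin.ext h1

theorem groupsColor_second (hK : 1 ≤ K) {g : ℕ} (hg : g < G) (s : Fin K) :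
    groupsColor (G := G) τ hK (4 * K * g + (K + 2 * s + 1)) = (τ g).symm s := by
  have h1 : (4 * K * g + (K + 2 * s + 1)) % (4 * K) = K + 2 * s + 1 := by
    rw [Nat.mul_add_mod, Nat.mod_eq_of_lt (by omega)]
  have h2 : (4 * K * g + (K + 2 * s + 1)) / (4 * K) = g := by
    rw [Nat.mul_add_div (by omega), Nat.div_eq_of_lt (by omega), Nat.add_zero]
  rw [groupsColor, dif_pos (group_add_lt hg (by omega)), dif_neg (by omega), dif_pos (by omega)]
  congr 1
  · rw [h2]
  · simp only [h1]
    exact Fin.ext (by simp only; omega)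

theorem left_cases {p : ℕ} (hp : p < groupsPartner G τ p) :
    (∃ g i, g < G ∧ ∃ hi : i < K, p = 4 * K * g + i ∧
      groupsPartner G τ p = 4 * K * g + (K + 2 * τ g ⟨i, hi⟩)) ∨
    (∃ g s, g < G ∧ s < K ∧ p = 4 * K * g + (K + 2 * s + 1) ∧
      groupsPartner G τ p = 4 * K * g + (3 * K + s)) ∨
    (4 * K * G ≤ p ∧ groupsPartner G τ p = p + 1 ∧ (p - 4 * K * G) % 2 = 0) := by
  rcases lt_or_ge p (4 * K * G) with h' | h'
  · obtain ⟨g, a, hg, ha, rfl⟩ := exists_group h'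
    rw [groupsPartner_group τ hg ha] at hp ⊢
    rcases group_cases ha with ⟨s, rfl⟩ | ⟨s, rfl⟩ | ⟨s, rfl⟩ | ⟨s, rfl⟩
    · exact .inl ⟨g, s, hg, s.isLt, rfl, by rw [groupPartner_first]⟩
    · rw [groupPartner_right] at hp
      omega
    · exact .inr (.inl ⟨g, s, hg, s.isLt, rfl, by rw [groupPartner_second]⟩)
    · rw [groupPartner_last] at hp
      omega
  · unfold groupsPartner at hp ⊢
    rw [if_neg h'.not_gt] at hp ⊢
    split_ifs at hp ⊢ with h2
    · exact .inr (.inr ⟨h', rfl, h2⟩)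
    · omega

/-- Intervals of the same colour do not overlap. -/
theorem eq_of_groupsColor_eq (hK : 1 ≤ K) {p q : ℕ} (hp : p < groupsPartner G τ p)
    (hq : q < groupsPartner G τ q) (hpq : q ≤ groupsPartner G τ p) (hqp : p ≤ groupsPartner G τ q)
    (hc : groupsColor (G := G) τ hK p = groupsColor (G := G) τ hK q) : p = q := by
  -- Groups occupy disjoint ranges of endpoints, so overlapping intervals lie in the same group.
  have hgg : ∀ {g g' a a' : ℕ}, a < 4 * K → a' < 4 * K → 4 * K * g ≤ 4 * K * g' + a' →
      4 * K * g' ≤ 4 * K * g + a → g = g' := by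
    intro g g' a a' ha ha' h1 h2
    rcases lt_trichotomy g g' with h3 | h3 | h3
    · have := Nat.mul_le_mul_left (4 * K) (Nat.succ_le_of_lt h3)
      rw [Nat.mul_succ] at this
      omega
    · exact h3
    · have := Nat.mul_le_mul_left (4 * K) (Nat.succ_le_of_lt h3)
      rw [Nat.mul_succ] at this
      omega
  rcases left_cases τ hp with ⟨g, i, hg, hi, hp1, hp2⟩ | ⟨g, s, hg, hs, hp1, hp2⟩ | ⟨hp0, hp1, hp2⟩
    <;> rcases left_cases τ hq with ⟨g', i', hg', hi', hq1, hq2⟩ | ⟨g', s', hg', hs', hq1, hq2⟩ |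
      ⟨hq0, hq1, hq2⟩
  · obtain rfl := hgg (g := g) (g' := g')
      (a := K + 2 * τ g ⟨i, hi⟩) (a' := K + 2 * τ g' ⟨i', hi'⟩) (by omega)
      (by omega) (by omega) (by omega)
    have h1 := groupsColor_first τ hK hg ⟨i, hi⟩
    have h2 := groupsColor_first τ hK hg ⟨i', hi'⟩
    simp only [← hp1, ← hq1] at h1 h2
    rw [h1, h2, Fin.mk.injEq] at hc
    omega
  · obtain rfl := hgg (g := g) (g' := g')
      (a := K + 2 * τ g ⟨i, hi⟩) (a' := 3 * K + s') (by omega)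
      (by omega) (by omega) (by omega)
    have h1 := groupsColor_first τ hK hg ⟨i, hi⟩
    have h2 := groupsColor_second τ hK hg ⟨s', hs'⟩
    simp only [← hp1, ← hq1] at h1 h2
    rw [h1, h2, Equiv.eq_symm_apply] at hc
    -- Equal colours mean that the second interval starts one position after the first one ends.
    rw [hc] at hp2
    simp only at hp2
    omega
  · have := group_add_lt (K := K) hg (a := K + 2 * τ g ⟨i, hi⟩) (by omega)
    omega
  · obtain rfl := hgg (g := g) (g' := g')
      (a := 3 * K + s) (a' := K + 2 * τ g' ⟨i', hi'⟩) (by omega)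
      (by omega) (by omega) (by omega)
    have h1 := groupsColor_second τ hK hg ⟨s, hs⟩
    have h2 := groupsColor_first τ hK hg ⟨i', hi'⟩
    simp only [← hp1, ← hq1] at h1 h2
    rw [h1, h2, eq_comm, Equiv.eq_symm_apply] at hc
    rw [hc] at hq2
    simp only at hq2
    omega
  · obtain rfl := hgg (g := g) (g' := g')
      (a := 3 * K + s) (a' := 3 * K + s') (by omega)
      (by omega) (by omega) (by omega)
    have h1 := groupsColor_second τ hK hg ⟨s, hs⟩
    have h2 := groupsColor_second τ hK hg ⟨s', hs'⟩
    simp only [← hp1, ← hq1] at h1 h2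
    rw [h1, h2] at hc
    have := Fin.mk.inj ((τ g).symm.injective hc)
    omega
  · have := group_add_lt (K := K) hg (a := 3 * K + s) (by omega)
    omega
  · have := group_add_lt (K := K) hg' (a := K + 2 * τ g' ⟨i', hi'⟩) (by omega)
    omega
  · have := group_add_lt (K := K) hg' (a := 3 * K + s') (by omega)
    omega
  · omega

end

/-! ### Cliques of open intervals and the forced colour -/

section

variable {K G N : ℕ} (τ : ℕ → Equiv.Perm (Fin K)) (h : 4 * K * G ≤ 2 * N)

/-- The interval that is open at the `t`-th right endpoint and is the first or the second of the
two intervals that have the colour of the `b`-th interval of the group. -/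
def openPoint (π : Equiv.Perm (Fin K)) (t b : Fin K) : ℕ :=
  if t ≤ π b then b else K + 2 * π b + 1

/-- Of the two intervals that share a colour, one ends at `K + 2 * π b` and the other starts at the
next point; comparing `t` with `π b` selects the one that is open. Only the interval that ends at
the `t`-th right endpoint itself fails to reach the next point. -/
theorem openPoint_le (π : Equiv.Perm (Fin K)) (t b : Fin K) :
    openPoint π t b ≤ K + 2 * t ∧ K + 2 * t ≤ groupPartner π (openPoint π t b) ∧
      (π b ≠ t → K + 2 * t + 1 ≤ groupPartner π (openPoint π t b)) := by
  unfold openPoint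
  split_ifs with h1
  · rw [groupPartner_first]
    rw [Fin.le_def] at h1
    refine ⟨by omega, by omega, fun h2 => ?_⟩
    have : (π b).val ≠ t.val := fun h3 => h2 (Fin.ext h3)
    omega
  · rw [groupPartner_second]
    rw [Fin.le_def] at h1
    exact ⟨by omega, by omega, fun _ => by omega⟩

theorem openPoint_inj {π : Equiv.Perm (Fin K)} {t b b' : Fin K}
    (heq : openPoint π t b = openPoint π t b') : b = b' := by
  unfold openPoint at heq
  split_ifs at heq
  · exact Fin.ext heq
  · omega
  · omega
  · exact π.injective (Fin.ext (by omega))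

/-- The intervals that are open at the `t`-th right endpoint of group `g`. -/
def openInterval (g : Fin G) (t b : Fin K) : (groups τ h).Interval :=
  ⟨groupPoint h g (openPoint (τ g) t b)
    (by have := (openPoint_le (τ g) t b).1; have := t.isLt; omega), by
    rw [partner_groupPoint, Fin.lt_def]
    have h1 := openPoint_le (τ g) t b
    have h2 := groupPartner_ne (τ g) (a := openPoint (τ g) t b) (by omega)
    simp only [groupPoint]
    omega⟩

theorem openInterval_adj (g : Fin G) (t : Fin K) {b b' : Fin K} (hb : b ≠ b') :
    (groups τ h).graph.Adj (openInterval τ h g t b) (openInterval τ h g t b') := by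
  have h1 := openPoint_le (τ g) t b
  have h2 := openPoint_le (τ g) t b'
  refine adj_of_mem (x := groupPoint h g (K + 2 * t) (by omega)) ?_ ?_ ?_ ?_ ?_
  · intro heq
    have h3 := Fin.val_eq_of_eq heq
    simp only [openInterval, groupPoint] at h3
    exact hb (openPoint_inj (Nat.add_left_cancel h3))
  · simp only [openInterval, groupPoint, Fin.le_def]; omega
  · simp only [openInterval, partner_groupPoint]
    simp only [groupPoint, Fin.le_def]; omega
  · simp only [openInterval, groupPoint, Fin.le_def]; omega
  · simp only [openInterval, partner_groupPoint]
    simp only [groupPoint, Fin.le_def]; omega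

theorem isLeft_second (g : Fin G) (t : Fin K) :
    groupPoint h g (K + 2 * t + 1) (by omega) <
      (groups τ h).partner (groupPoint h g (K + 2 * t + 1) (by omega)) := by
  rw [partner_groupPoint, Fin.lt_def]
  simp only [groupPoint, groupPartner_second]
  omega

/-- With `K` colours the interval that starts after the `t`-th right endpoint has to receive the
colour of the interval that ends there. -/
theorem color_second_eq {c : Fin (2 * N) → ℕ}
    (hc : ∀ u v : (groups τ h).Interval, (groups τ h).graph.Adj u v → c u.1 ≠ c v.1)
    (hcard : (Set.range fun v : (groups τ h).Interval => c v.1).encard = (K : ℕ∞))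
    (g : Fin G) (i : Fin K) :
    c (groupPoint h g (K + 2 * τ g i + 1) (by omega)) = c (groupPoint h g i (by omega)) := by
  set t := τ g i with ht
  let f : Fin K → ℕ := fun b => c (openInterval τ h g t b).1
  have hf : Function.Injective f := by
    intro b b' hb
    by_contra hne
    exact hc _ _ (openInterval_adj τ h g t hne) hb
  have hsub : Set.range f ⊆ Set.range fun v : (groups τ h).Interval => c v.1 := by
    rintro _ ⟨b, rfl⟩
    exact ⟨_, rfl⟩
  -- The `K` open intervals form a clique and hence use all `K` colours.
  have hrange : Set.range f = Set.range fun v : (groups τ h).Interval => c v.1 := by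
    refine Set.Finite.eq_of_subset_of_encard_le (Set.finite_range f) hsub ?_
    rw [hcard, ← Set.image_univ, hf.encard_image, Set.encard_univ, ENat.card_eq_coe_fintype_card,
      Fintype.card_fin]
  let x : (groups τ h).Interval :=
    ⟨groupPoint h g (K + 2 * t + 1) (by omega), isLeft_second τ h g t⟩
  have hx : c x.1 ∈ Set.range f := by rw [hrange]; exact ⟨x, rfl⟩
  obtain ⟨b, hb⟩ := hx
  by_cases hbt : τ g b = t
  · have hbi : b = i := (τ g).injective (hbt.trans ht)
    rw [show c (groupPoint h g (K + 2 * t + 1) (by omega)) = c x.1 from rfl, ← hb, ← hbi]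
    simp only [f, openInterval, openPoint, hbt, le_refl, if_true]
  -- Every open interval except the one ending at `t` still overlaps the new interval, so it cannot
  -- share its colour.
  · exfalso
    have h1 := openPoint_le (τ g) t b
    refine hc (openInterval τ h g t b) x ?_ hb
    refine adj_of_mem (x := x.1) ?_ ?_ ?_ le_rfl x.2.le
    · intro heq
      have h3 := Fin.val_eq_of_eq heq
      simp only [openInterval, x, groupPoint] at h3
      omega
    · simp only [openInterval, x, groupPoint, Fin.le_def]; omega
    · have h3 := h1.2.2 hbt
      simp only [openInterval, partner_groupPoint]
      simp only [x, groupPoint, Fin.le_def]; omega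

/-- `groupsColor` is proper with `K` colours, and the intervals open at the first right endpoint of
the first group form a clique of size `K`. -/
theorem chromaticNumber_groups (hK : 1 ≤ K) (hG : 1 ≤ G) :
    (groups τ h).graph.chromaticNumber = (K : ℕ∞) := by
  refine le_antisymm ?_ ?_
  · refine SimpleGraph.Colorable.chromaticNumber_le ?_
    refine ⟨SimpleGraph.Coloring.mk
      (fun v : (groups τ h).Interval => groupsColor (G := G) τ hK v.1.val) ?_⟩
    rintro u v ⟨hne, x, hu, hv⟩ hc
    refine hne (Subtype.ext (Fin.ext (eq_of_groupsColor_eq τ hK u.2 v.2 ?_ ?_ hc)))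
    · exact Fin.le_def.1 (hv.1.trans hu.2)
    · exact Fin.le_def.1 (hu.1.trans hv.2)
  · have f : (⊤ : SimpleGraph (Fin K)) →g (groups τ h).graph :=
      ⟨openInterval τ h ⟨0, hG⟩ ⟨0, hK⟩, fun hab => openInterval_adj τ h _ _ hab⟩
    have := SimpleGraph.chromaticNumber_mono_of_hom f
    rwa [SimpleGraph.chromaticNumber_top, Fintype.card_fin] at this

end

/-- Exchange the right endpoints of two intervals. -/
theorem exists_exchange {n : ℕ} (R : IntervalRep n) {l₁ l₂ : Fin (2 * n)}
    (h11 : l₁ < R.partner l₁) (h22 : l₂ < R.partner l₂) (h12 : l₁ < R.partner l₂)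
    (h21 : l₂ < R.partner l₁) :
    ∃ J : IntervalRep n, J.partner l₁ = R.partner l₂ ∧
      (∀ i, (i < J.partner i ↔ i < R.partner i)) ∧
      ∀ i, J.partner i = R.partner i ∨ ((i = l₁ ∨ i = l₂) ∧
        (J.partner i = R.partner l₁ ∨ J.partner i = R.partner l₂) ∧
        (R.partner i = R.partner l₁ ∨ R.partner i = R.partner l₂)) ∨
        ((i = R.partner l₁ ∨ i = R.partner l₂) ∧ (J.partner i = l₁ ∨ J.partner i = l₂) ∧
        (R.partner i = l₁ ∨ R.partner i = l₂)) := by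
  set s := Equiv.swap (R.partner l₁) (R.partner l₂) with hs
  have hss : ∀ i, s (s i) = i := Equiv.swap_apply_self _ _
  -- Conjugation by the transposition of the two right endpoints keeps the partner map a
  -- fixed-point-free involution.
  let J : IntervalRep n :=
    { partner := fun i => s (R.partner (s i))
      partner_ne := fun i hi => R.partner_ne (s i) (by
        have := congrArg s hi
        rwa [hss] at this)
      partner_partner := fun i => by rw [hss, R.partner_partner, hss] }
  have hs1 : s l₁ = l₁ := Equiv.swap_apply_of_ne_of_ne h11.ne h12.ne
  have hs2 : s l₂ = l₂ := Equiv.swap_apply_of_ne_of_ne h21.ne h22.ne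
  have hJ : ∀ i, J.partner i = s (R.partner (s i)) := fun _ => rfl
  have hJ1 : J.partner l₁ = R.partner l₂ := by rw [hJ, hs1, hs, Equiv.swap_apply_left]
  have hJ2 : J.partner l₂ = R.partner l₁ := by rw [hJ, hs2, hs, Equiv.swap_apply_right]
  have hJ3 : J.partner (R.partner l₂) = l₁ := by rw [← hJ1, J.partner_partner]
  have hJ4 : J.partner (R.partner l₁) = l₂ := by rw [← hJ2, J.partner_partner]
  have hJ5 : ∀ i, i ≠ l₁ → i ≠ l₂ → i ≠ R.partner l₁ → i ≠ R.partner l₂ →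
      J.partner i = R.partner i := by
    intro i h1 h2 h3 h4
    have hi : s i = i := Equiv.swap_apply_of_ne_of_ne h3 h4
    rw [hJ, hi, hs]
    refine Equiv.swap_apply_of_ne_of_ne (fun h => h1 ?_) (fun h => h2 ?_)
    · rw [← R.partner_partner i, h, R.partner_partner]
    · rw [← R.partner_partner i, h, R.partner_partner]
  refine ⟨J, hJ1, fun i => ?_, fun i => ?_⟩
  · by_cases h1 : i = l₁
    · rw [h1, hJ1]; exact iff_of_true h12 h11
    by_cases h2 : i = l₂
    · rw [h2, hJ2]; exact iff_of_true h21 h22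
    by_cases h3 : i = R.partner l₁
    · rw [h3, hJ4, R.partner_partner]; exact iff_of_false h21.not_gt h11.not_gt
    by_cases h4 : i = R.partner l₂
    · rw [h4, hJ3, R.partner_partner]; exact iff_of_false h12.not_gt h22.not_gt
    rw [hJ5 i h1 h2 h3 h4]
  · by_cases h1 : i = l₁
    · subst h1; exact .inr (.inl ⟨.inl rfl, .inr hJ1, .inl rfl⟩)
    by_cases h2 : i = l₂
    · subst h2; exact .inr (.inl ⟨.inr rfl, .inl hJ2, .inr rfl⟩)
    by_cases h3 : i = R.partner l₁
    · rw [h3]; exact .inr (.inr ⟨.inl rfl, .inr hJ4, .inl (R.partner_partner _)⟩)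
    by_cases h4 : i = R.partner l₂
    · rw [h4]; exact .inr (.inr ⟨.inr rfl, .inl hJ3, .inr (R.partner_partner _)⟩)
    exact .inl (hJ5 i h1 h2 h3 h4)

end IntervalRep

/-! ### The bound for interval graphs -/

open IntervalRep EMState

theorem IGC.exists_coloring {n M B : ℕ} {A : (IGC n).EMAlgorithm} (hA : A.Solves M B)
    (I : IntervalRep n) : ∃ c : Fin (2 * n) → ℕ, ∀ J : IntervalRep n,
      (∀ a, (initial (2 * n) B).Met (A.ops I) a a → (a < J.partner a ↔ a < I.partner a)) →
      (∀ a b, (initial (2 * n) B).Met (A.ops I) a b → (J.partner a = b ↔ I.partner a = b)) →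
      (∀ u v : J.Interval, J.graph.Adj u v → c u.1 ≠ c v.1) ∧
        (Set.range fun v : J.Interval => c v.1).encard = J.graph.chromaticNumber := by
  obtain ⟨c, hc⟩ := hA.exists_common_solution I
  refine ⟨c, fun J h1 h2 => hc J (fun a ha => ?_) h2⟩
  change decide _ = decide _
  exact decide_eq_decide.2 (h1 a ha)

section

variable {K G N M B : ℕ} (h : 4 * K * G ≤ 2 * N)

/-- Of two intervals of a group an endpoint has met the partner of itself or of the other. -/
theorem IGC.met_of_lt (hK : 1 ≤ K) {A : (IGC N).EMAlgorithm} (hA : A.Solves M B)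
    (τ : ℕ → Equiv.Perm (Fin K)) (g : Fin G) {i j : Fin K} (hij : τ g i < τ g j)
    {ops : List (EMOp (2 * N))} (hops : ops = A.ops (groups τ h))
    (hno : ∀ a ∈ ({i, j} : Set (Fin K)), ∀ b ∈ ({i, j} : Set (Fin K)),
      ¬ (initial (2 * N) B).Met ops (groupPoint h g a (by omega))
        (groupPoint h g (K + 2 * τ g b) (by omega))) : False := by
  subst hops
  obtain ⟨c, hc⟩ := IGC.exists_coloring hA (groups τ h)
  have hI := hc (groups τ h) (fun _ _ => Iff.rfl) (fun _ _ _ => Iff.rfl)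
  rw [chromaticNumber_groups τ h hK g.pos] at hI
  have hcol := color_second_eq τ h hI.1 hI.2 g i
  have hpart : ∀ a : Fin K, (groups τ h).partner (groupPoint h g a (by omega)) =
      groupPoint h g (K + 2 * τ g a) (by omega) := by
    intro a
    rw [partner_groupPoint]
    simp only [groupPartner_first]
  have hlt : ∀ a b : Fin K, groupPoint h g a (by omega) <
      (groups τ h).partner (groupPoint h g b (by omega)) := by
    intro a b
    rw [hpart, Fin.lt_def]
    simp only [groupPoint]
    omega
  obtain ⟨J, hJ1, hJ2, hJ3⟩ := exists_exchange (groups τ h) (hlt i i) (hlt j j) (hlt i j) (hlt j i)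
  simp only [hpart] at hJ1 hJ3
  have hJc := (hc J (fun a _ => hJ2 a) (fun a b hab => by
    have hi : i ∈ ({i, j} : Set (Fin K)) := .inl rfl
    have hj : j ∈ ({i, j} : Set (Fin K)) := .inr rfl
    rcases hJ3 a with h1 | ⟨h1, h2, h3⟩ | ⟨h1, h2, h3⟩
    · rw [h1]
    · refine iff_of_false ?_ ?_
      · rintro rfl
        rcases h1 with rfl | rfl <;> rcases h2 with h2 | h2 <;> rw [h2] at hab
        exacts [hno _ hi _ hi hab, hno _ hi _ hj hab, hno _ hj _ hi hab, hno _ hj _ hj hab]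
      · rintro rfl
        rcases h1 with rfl | rfl <;> rcases h3 with h3 | h3 <;> rw [h3] at hab
        exacts [hno _ hi _ hi hab, hno _ hi _ hj hab, hno _ hj _ hi hab, hno _ hj _ hj hab]
    · refine iff_of_false ?_ ?_
      · rintro rfl
        rcases h1 with rfl | rfl <;> rcases h2 with h2 | h2 <;> rw [h2] at hab
        exacts [hno _ hi _ hi hab.symm, hno _ hj _ hi hab.symm, hno _ hi _ hj hab.symm,
          hno _ hj _ hj hab.symm]
      · rintro rfl
        rcases h1 with rfl | rfl <;> rcases h3 with h3 | h3 <;> rw [h3] at hab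
        exacts [hno _ hi _ hi hab.symm, hno _ hj _ hi hab.symm, hno _ hi _ hj hab.symm,
          hno _ hj _ hj hab.symm])).1
  -- This interval is forced to share the colour of interval `i`. After the exchange interval `i`
  -- ends at `K + 2 * τ g j`, beyond `x`, so the two overlap and the common colouring fails.
  let x := groupPoint h g (K + 2 * τ g i + 1) (by omega)
  have hx : x < J.partner x := (hJ2 x).2 (isLeft_second τ h g (τ g i))
  have hl : groupPoint h g i (by omega) < J.partner (groupPoint h g i (by omega)) :=
    (hJ2 _).2 (hlt i i)
  refine hJc ⟨_, hx⟩ ⟨_, hl⟩ ?_ hcol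
  refine adj_of_mem (x := x) ?_ le_rfl hx.le ?_ ?_
  · intro heq
    have h3 := Fin.val_eq_of_eq heq
    simp only [x, groupPoint] at h3
    omega
  · simp only [x, groupPoint, Fin.le_def]
    omega
  · rw [hJ1]
    rw [Fin.lt_def] at hij
    simp only [x, groupPoint, Fin.le_def]
    omega

theorem IGC.exists_met (hK : 1 ≤ K) {A : (IGC N).EMAlgorithm} (hA : A.Solves M B)
    (τ : ℕ → Equiv.Perm (Fin K)) (g : Fin G) {i j : Fin K} (hij : i ≠ j)
    {ops : List (EMOp (2 * N))} (hops : ops = A.ops (groups τ h)) :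
    ∃ a ∈ ({i, j} : Set (Fin K)), ∃ b ∈ ({i, j} : Set (Fin K)),
      (initial (2 * N) B).Met ops (groupPoint h g a (by omega))
        (groupPoint h g (K + 2 * τ g b) (by omega)) := by
  by_contra! hno
  rcases lt_or_gt_of_ne ((τ g).injective.ne hij) with h1 | h1
  · exact IGC.met_of_lt h hK hA τ g h1 hops hno
  · exact IGC.met_of_lt h hK hA τ g h1 hops (by rwa [Set.pair_comm])

/-- By `IGC.exists_met` two untouched first left endpoints in one group are impossible, so all but
at most one per group have been read. -/
theorem IGC.scan (hB : 1 ≤ B) (hK : 1 ≤ K) {A : (IGC N).EMAlgorithm} (hA : A.Solves M B)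
    (τ : ℕ → Equiv.Perm (Fin K)) :
    G * (K - 1) ≤ (A.ops (groups τ h)).length * B := by
  classical
  obtain ⟨P, hP, hPm⟩ := EMState.exists_touched (n := 2 * N) hB (hA (groups τ h)).1
  refine le_trans ?_ hP
  let l : Fin G → Fin K → Fin (2 * N) := fun g i => groupPoint h g i (by omega)
  have hgroup : ∀ g, K - 1 ≤ (Finset.univ.filter fun i => l g i ∈ P).card := by
    intro g
    have h1 : (Finset.univ.filter fun i => ¬ l g i ∈ P).card ≤ 1 := by
      rw [Finset.card_le_one]
      intro i hi j hj
      by_contra hij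
      obtain ⟨a, ha, b, hb, hab⟩ := IGC.exists_met h hK hA τ g hij rfl
      have haP : l g a ∉ P := by
        rcases ha with rfl | rfl
        · exact (Finset.mem_filter.1 hi).2
        · exact (Finset.mem_filter.1 hj).2
      exact (hPm _ haP _).1 hab
    have h2 := Finset.card_filter_add_card_filter_not (s := (Finset.univ : Finset (Fin K)))
      fun i => l g i ∈ P
    rw [Finset.card_univ, Fintype.card_fin] at h2
    omega
  calc G * (K - 1) = ∑ _g : Fin G, (K - 1) := by simp
    _ ≤ ∑ g, (Finset.univ.filter fun i => l g i ∈ P).card := Finset.sum_le_sum fun g _ => hgroup g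
    _ = (Finset.univ.sigma fun g => Finset.univ.filter fun i => l g i ∈ P).card :=
        (Finset.card_sigma _ _).symm
    _ ≤ P.card := by
        refine Finset.card_le_card_of_injOn (fun q => l q.1 q.2) ?_ ?_
        · intro q hq
          exact (Finset.mem_filter.1 (Finset.mem_sigma.1 hq).2).2
        · rintro ⟨g, i⟩ - ⟨g', i'⟩ - heq
          obtain ⟨h1, h2⟩ := groupPoint_inj h heq
          dsimp only at h1 h2
          subst h1
          rw [Fin.ext h2]

open Classical in
/-- The first left endpoints of a group are tagged with their numbers, the right endpoints are
their hidden partners. -/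
noncomputable def IntervalRep.hidden : HiddenPerms (2 * N) G K where
  tag a := if h' : ∃ p : Fin G × Fin K, a = groupPoint h p.1 p.2 (by omega) then some h'.choose
    else none
  target p := groupPoint h p.1 (K + 2 * p.2) (by omega)
  target_injective p q hpq := by
    obtain ⟨h1, h2⟩ := groupPoint_inj h hpq
    exact Prod.ext h1 (Fin.ext (by omega))
  tag_target p := by
    refine dif_neg ?_
    rintro ⟨q, hq⟩
    have := (groupPoint_inj h hq).2
    omega

theorem IntervalRep.hidden_tag (p : Fin G × Fin K) :
    (IntervalRep.hidden h).tag (groupPoint h p.1 p.2 (by omega)) = some p := by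
  have h' : ∃ q : Fin G × Fin K, groupPoint h p.1 p.2 (by omega) =
      groupPoint h q.1 q.2 (by omega) := ⟨p, rfl⟩
  rw [IntervalRep.hidden]
  simp only [dif_pos h', Option.some.injEq]
  obtain ⟨h1, h2⟩ := groupPoint_inj h h'.choose_spec
  exact (Prod.ext h1 (Fin.ext h2)).symm

/-- The permutations of the groups, continued by the identity. -/
def IntervalRep.extendPerm (σ : Fin G → Equiv.Perm (Fin K)) (g : ℕ) : Equiv.Perm (Fin K) :=
  if h : g < G then σ ⟨g, h⟩ else 1

/-- The meeting found by `IGC.exists_met` either joins a left endpoint to its own partner, making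
the item seen, or joins records of the two items, making them cross. One colour class suffices. -/
theorem IGC.resolved (hK : 1 ≤ K) {A : (IGC N).EMAlgorithm} (hA : A.Solves M B)
    (σ : Fin G → Equiv.Perm (Fin K)) :
    (IntervalRep.hidden h).Resolved σ (initial (2 * N) B) (A.ops (groups (extendPerm σ) h)) := by
  intro g
  refine ⟨fun _ => 0, fun t₁ t₂ t₃ h12 _ _ _ _ hs1 hs2 _ => .inl ?_⟩
  have hσ : extendPerm σ g = σ g := by simp [extendPerm]
  obtain ⟨a, ha, b, hb, hab⟩ := IGC.exists_met h hK hA (extendPerm σ) g h12 rfl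
  simp only [hσ] at hab
  have howns1 : ∀ i, (IntervalRep.hidden h).Owns σ (g, i) (groupPoint h g i (by omega)) :=
    fun i => .inl (IntervalRep.hidden_tag h (g, i))
  have howns2 : ∀ i, (IntervalRep.hidden h).Owns σ (g, i)
      (groupPoint h g (K + 2 * σ g i) (by omega)) := fun i => .inr rfl
  rcases ha with rfl | rfl <;> rcases hb with rfl | rfl
  · exact absurd ⟨_, IntervalRep.hidden_tag h (g, _), hab⟩ hs1
  · exact ⟨_, _, howns1 _, howns2 _, hab⟩
  · exact ⟨_, _, howns2 _, howns1 _, hab.symm⟩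
  · exact absurd ⟨_, IntervalRep.hidden_tag h (g, _), hab⟩ hs2

end

theorem IGC.requiresIOs {N K M B : ℕ} (hB : 1 ≤ B) (hM : 2 * B ≤ M) (hK : 1 ≤ K)
    (hKN : 2 * K ≤ N) (hsort : sortIO M B N ≤ N) :
    (IGC N).RequiresIOs (fun R : IntervalRep N => R.graph.chromaticNumber = (K : ℕ∞)) M B
      (1 / 100000 * (((N : ℝ) / K) * sortIO M B K)) := by
  obtain ⟨G, hG1, hG2, hG3⟩ : ∃ G, 1 ≤ G ∧ 4 * K * G ≤ 2 * N ∧ N ≤ 4 * (G * K) := by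
    have h0 : 0 < 2 * K := by omega
    -- A group takes `2 * K` intervals. Since `N ≥ 2 * K` there is at least one group, and the
    -- groups cover at least half of the input.
    refine ⟨N / (2 * K), by rwa [Nat.le_div_iff_mul_le h0, one_mul], ?_, ?_⟩
    · have h1 := Nat.mul_div_le N (2 * K)
      have h2 : 4 * K * (N / (2 * K)) = 2 * (2 * K * (N / (2 * K))) := by ring
      omega
    · have h1 := Nat.div_add_mod N (2 * K)
      have h2 := Nat.mod_lt N h0
      have h3 : 1 ≤ N / (2 * K) := by rwa [Nat.le_div_iff_mul_le h0, one_mul]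
      have h4 := Nat.mul_le_mul_right K h3
      have h5 : 2 * K * (N / (2 * K)) = 2 * (N / (2 * K) * K) := by ring
      omega
  refine RecordProblem.requiresIOs_of_hiddenPerms hB hM hK hKN hsort le_rfl
    ⟨groups 1 hG2, chromaticNumber_groups 1 hG2 hK hG1⟩ ?_ ?_
  · intro hK2 A hA
    refine ⟨groups 1 hG2, chromaticNumber_groups 1 hG2 hK hG1, ?_⟩
    have h1 := IGC.scan hG2 hB hK hA 1
    have h2 : G * K ≤ 2 * (G * (K - 1)) := by
      have : K ≤ 2 * (K - 1) := by omega
      have := Nat.mul_le_mul_left G this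
      have h3 : G * (2 * (K - 1)) = 2 * (G * (K - 1)) := by ring
      omega
    omega
  · exact fun hK2 => ⟨G, K, IntervalRep.hidden hG2, by omega, by omega, fun A hA σ =>
      ⟨groups (extendPerm σ) hG2, chromaticNumber_groups _ hG2 hK hG1,
        IGC.resolved hG2 hK hA σ⟩⟩

theorem mainTheorem8 :
    ∃ c : ℝ, 0 < c ∧ ∀ N K M B : ℕ,
      1 ≤ B → 2 * B ≤ M → 1 ≤ K → 2 * K ≤ N → sortIO M B N ≤ (N : ℝ) →
        (IGC N).RequiresIOs (fun R : IntervalRep N => R.graph.chromaticNumber = (K : ℕ∞)) M B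
          (c * (((N : ℝ) / K) * sortIO M B K)) ∧
        (ThreeLC N).RequiresIOs (fun D : SingleList N => D.numStretches = K) M B
          (c * (((N : ℝ) / K) * sortIO M B K)) ∧
        (MLCC N).RequiresIOs (fun D : MonotonicLists N => D.numHeads = K) M B
          (c * (((N : ℝ) / K) * sortIO M B K)) ∧
        (TwoMLC N).RequiresIOs (fun D : MonotonicLists N => D.numHeads = K) M B
          (c * (((N : ℝ) / K) * sortIO M B K)) := by
  exact ⟨1 / 100000, by norm_num, fun _ _ _ _ hB hM hK hKN hsort =>
    ⟨IGC.requiresIOs hB hM hK hKN hsort, ThreeLC.requiresIOs hB hM hK hKN hsort,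
      MLCC.requiresIOs hB hM hK hKN hsort, TwoMLC.requiresIOs hB hM hK hKN hsort⟩⟩
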